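/- Let $L\subset\mathbb R^2$ be any lattice of full rank, let $T^2=\mathbb R^2/L$ carry the flat metric induced from the Euclidean metric of $\mathbb R^2$, and let $h$ be the standard round metric on the unit sphere $S^2\subset\mathbb R^3$. Let $Z_1,Z_2$ be the standard basis of $\mathbb R^2$ and let $c,c'$ be the linear maps from $\mathbb R^2$ to the symmetric traceless real $3\times3$ matrices with $$c_{Z_1}=c'_{Z_1}=\begin{pmatrix}-1&0&0\\0&0&0\\0&0&1\end{pmatrix},\quad c_{Z_2}=\begin{pmatrix}0&1&0\\1&0&1\\0&1&0\end{pmatrix},\quad c'_{Z_2}=\begin{pmatrix}0&0&\sqrt2\\0&0&0\\\sqrt2&0&0\end{pmatrix}.$$ Let $\lambda$ be the $\mathbb R^2$-valued $1$-form on $S^2$ with $\langle\lambda_p(X),Z\rangle=\langle c_Zp\times p,X\rangle$ for all $p\in S^2$, $X\in T_pS^2$, $Z\in\mathbb R^2$, and let $\lambda'$ be defined in the same way from $c'$. Let $g_\lambda$ be the Riemannian metric on $S^2\times T^2$ given by $$g_\lambda\bigl((X,U),(Y,V)\bigr)=h(X,Y)+\langle\lambda_p(X)+U,\lambda_p(Y)+V\rangle\qquad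 (X,Y\in T_pS^2,\ U,V\in T_zT^2\cong\mathbb R^2),$$ and define $g_{\lambda'}$ in the same way from $\lambda'$. Then the following hold. 1. $g_\lambda$ and $g_{\lambda'}$ are isospectral: their Laplace operators on functions have the same eigenvalues with the same multiplicities. 2. The maximum of the scalar curvature equals $2$ for both metrics. 3. The set where the scalar curvature of $g_\lambda$ equals $2$ is $$\bigl(\{p\in S^2\mid p_1=-p_3\}\cup\{(\tfrac1{\sqrt2},0,\tfrac1{\sqrt2}),(-\tfrac1{\sqrt2},0,-\tfrac1{\sqrt2})\}\bigr)\times T^2,$$ and it contains a nonempty submanifold of codimension one. 4. The set where the scalar curvature of $g_{\lambda'}$ equals $2$ is $\{(0,1,0),(0,-1,0)\}\times T^2$, a submanifold of codimension two. 5. $(S^2\times T^2,g_\lambda)$ and $(S^2\times T^2,g_{\lambda'})$ are not locally isometric: it is not true that every point of $(S^2\times T^2,g_\lambda)$ has an open neighbourhood which is isometric to an open subset of $(S^2\times T^2,g_{\lambda'})$. -/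

import Mathlib

noncomputable section

namespace SphereTorusMetrics

open Set Metric Bundle Module
open scoped Manifold ContDiff Matrix

section Coordinates

variable {E : Type*} [NormedAddCommGroup E] [NormedSpace ℝ E] [FiniteDimensional ℝ E]

/-- The trace, with respect to the metric `g`, of a bilinear map `B`: the sum over a basis `bᵢ` of
`B(bᵢ, ♯bⁱ)`, where `bⁱ` is the dual basis and `♯ = g⁻¹ : E* → E`. -/
def metricTrace {V : Type*} [AddCommMonoid V] (g : E →L[ℝ] E →L[ℝ] ℝ) (B : E → E → V) : V :=
  ∑ i, B (finBasis ℝ E i) (g.inverse ((finBasis ℝ E).coord i).toContinuousLinearMap)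

/-- The Christoffel symbols of the metric `g` on (an open subset of) `E`, as the vector `Γ(u, v)`
with `2 g(Γ(u, v), w) = ∂ᵤ g(v, w) + ∂ᵥ g(u, w) - ∂_w g(u, v)` for all `w`. -/
def christoffel (g : E → E →L[ℝ] E →L[ℝ] ℝ) (x u v : E) : E :=
  (g x).inverse ((2 : ℝ)⁻¹ •
    (fderiv ℝ g x u v + fderiv ℝ g x v u - ((fderiv ℝ g x).flip u).flip v))

/-- The curvature tensor
`R(u, v)w = ∂ᵤ Γ(v, w) - ∂ᵥ Γ(u, w) + Γ(u, Γ(v, w)) - Γ(v, Γ(u, w))`. -/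
def riemann (g : E → E →L[ℝ] E →L[ℝ] ℝ) (x u v w : E) : E :=
  fderiv ℝ (fun y => christoffel g y v w) x u - fderiv ℝ (fun y => christoffel g y u w) x v
    + christoffel g x u (christoffel g x v w) - christoffel g x v (christoffel g x u w)

/-- The Ricci tensor: `Ric(v, w)` is the trace of `u ↦ R(u, v)w`. -/
def ricci (g : E → E →L[ℝ] E →L[ℝ] ℝ) (x v w : E) : ℝ :=
  ∑ i, (finBasis ℝ E).coord i (riemann g x (finBasis ℝ E i) v w)

/-- The Hessian `∂ᵤ ∂ᵥ f - df(Γ(u, v))` of a function `f`. -/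
def hessian (g : E → E →L[ℝ] E →L[ℝ] ℝ) (f : E → ℂ) (x u v : E) : ℂ :=
  fderiv ℝ (fun y => fderiv ℝ f y v) x u - fderiv ℝ f x (christoffel g x u v)

end Coordinates

/-- The pullback `(v, w) ↦ B(Av, Aw)` of a bilinear form. -/
def pullbackForm {V W : Type*} [AddCommGroup V] [Module ℝ V] [TopologicalSpace V]
    [AddCommGroup W] [Module ℝ W] [TopologicalSpace W]
    (B : W →L[ℝ] W →L[ℝ] ℝ) (A : V →L[ℝ] W) : V →L[ℝ] V →L[ℝ] ℝ :=
  (ContinuousLinearMap.precomp ℝ A) ∘L B ∘L A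

section Manifolds

variable {E : Type*} [NormedAddCommGroup E] [NormedSpace ℝ E] [FiniteDimensional ℝ E]
  {H : Type*} [TopologicalSpace H] {I : ModelWithCorners ℝ E H} [I.Boundaryless]
  {M : Type*} [TopologicalSpace M] [ChartedSpace H M] [IsManifold I ∞ M]

variable (I M) in
/-- Smooth Riemannian metrics on a manifold without boundary. -/
abbrev RMetric := ContMDiffRiemannianMetric I ∞ E (fun x : M => TangentSpace I x)

/-- The metric `g` in the preferred chart at `x`, as a field of bilinear forms on the model space `E`. -/
def chartMetric (g : RMetric I M) (x : M) (y : E) : E →L[ℝ] E →L[ℝ] ℝ :=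
  pullbackForm (W := TangentSpace I ((extChartAt I x).symm y))
    (g.inner ((extChartAt I x).symm y))
    (mfderiv 𝓘(ℝ, E) I (extChartAt I x).symm y)

/-- The scalar curvature, computed in the preferred chart at each point. -/
def scalarCurvature (g : RMetric I M) (x : M) : ℝ :=
  metricTrace (chartMetric g x (extChartAt I x x))
    (ricci (chartMetric g x) (extChartAt I x x))

/-- The Laplace operator `Δf = - div grad f = - tr_g Hess f`, computed in the preferred chart at each
point. -/
def laplacian (g : RMetric I M) (f : M → ℂ) (x : M) : ℂ :=
  - metricTrace (chartMetric g x (extChartAt I x x))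
    (hessian (chartMetric g x) (f ∘ (extChartAt I x).symm) (extChartAt I x x))

theorem contDiffAt_chart {f : M → ℂ} (hf : ContMDiff I 𝓘(ℝ, ℂ) ∞ f) (x : M) :
    ContDiffAt ℝ ∞ (f ∘ (extChartAt I x).symm) (extChartAt I x x) := by
  have h := hf.comp_contMDiffOn (contMDiffOn_extChartAt_symm (I := I) (n := ∞) x)
  have h2 := h.contMDiffAt (extChartAt_target_mem_nhds (I := I) x)
  exact contMDiffAt_iff_contDiffAt.1 h2

theorem hessian_add {g : E → E →L[ℝ] E →L[ℝ] ℝ} {a b : E → ℂ} {x : E}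
    (ha : ContDiffAt ℝ ∞ a x) (hb : ContDiffAt ℝ ∞ b x) (u v : E) :
    hessian g (a + b) x u v = hessian g a x u v + hessian g b x u v := by
  have ha' : ∀ᶠ y in nhds x, DifferentiableAt ℝ a y :=
    ((ha.of_le (m := 1) (by norm_cast)).eventually (by simp)).mono
      fun y hy => hy.differentiableAt (by simp)
  have hb' : ∀ᶠ y in nhds x, DifferentiableAt ℝ b y :=
    ((hb.of_le (m := 1) (by norm_cast)).eventually (by simp)).mono
      fun y hy => hy.differentiableAt (by simp)
  have da : DifferentiableAt ℝ (fun y => fderiv ℝ a y v) x :=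
    ((ha.fderiv_right (m := 1) (by norm_cast)).differentiableAt (by simp)).clm_apply
      (differentiableAt_const v)
  have db : DifferentiableAt ℝ (fun y => fderiv ℝ b y v) x :=
    ((hb.fderiv_right (m := 1) (by norm_cast)).differentiableAt (by simp)).clm_apply
      (differentiableAt_const v)
  have e : (fun y => fderiv ℝ (a + b) y v) =ᶠ[nhds x]
      (fun y => fderiv ℝ a y v) + fun y => fderiv ℝ b y v := by
    filter_upwards [ha', hb'] with y h1 h2
    simp [fderiv_add h1 h2]
  unfold hessian
  rw [e.fderiv_eq, fderiv_add da db, fderiv_add ha'.self_of_nhds hb'.self_of_nhds]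
  simp only [add_apply]
  ring

theorem hessian_smul {g : E → E →L[ℝ] E →L[ℝ] ℝ} {a : E → ℂ} {x : E}
    (c : ℂ) (u v : E) : hessian g (c • a) x u v = c • hessian g a x u v := by
  unfold hessian
  have h : ∀ b : E → ℂ, ∀ y, fderiv ℝ (c • b) y = c • fderiv ℝ b y := fun b y =>
    congrFun (fderiv_const_smul_field c) y
  have e : (fun y => fderiv ℝ (c • a) y v) = c • fun y => fderiv ℝ a y v := by
    funext y; simp [h]
  rw [e, h, h]
  simp [mul_sub]

/-- The space of smooth complex valued functions `f` with `Δf = μ f`. On a closed manifold the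
spectrum of the Laplace operator consists of the `μ` for which it is nonzero, and its dimension is
the multiplicity of `μ`. -/
def eigenspace (g : RMetric I M) (μ : ℝ) : Submodule ℂ (M → ℂ) where
  carrier := {f | ContMDiff I 𝓘(ℝ, ℂ) ∞ f ∧ ∀ x, laplacian g f x = μ * f x}
  add_mem' := by
    rintro a b ⟨ha, ha'⟩ ⟨hb, hb'⟩
    refine ⟨ha.add hb, fun x => ?_⟩
    rw [Pi.add_apply, mul_add, ← ha', ← hb']
    have e : (a + b) ∘ (extChartAt I x).symm
      = a ∘ (extChartAt I x).symm + b ∘ (extChartAt I x).symm := rfl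
    simp only [laplacian, metricTrace, e,
      hessian_add (contDiffAt_chart ha x) (contDiffAt_chart hb x), Finset.sum_add_distrib]
    ring
  zero_mem' := by
    refine ⟨contMDiff_const, fun x => ?_⟩
    simp [laplacian, metricTrace, hessian]
  smul_mem' := by
    rintro c a ⟨ha, ha'⟩
    refine ⟨(contDiff_const_smul c).contMDiff.comp ha, fun x => ?_⟩
    have e : (c • a) ∘ (extChartAt I x).symm = c • (a ∘ (extChartAt I x).symm) := rfl
    have h := ha' x
    simp only [laplacian, metricTrace, e, hessian_smul, ← Finset.smul_sum] at h ⊢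
    rw [← smul_neg, h, Pi.smul_apply, smul_eq_mul, smul_eq_mul]
    ring

/-- Isospectrality of two metrics on a closed manifold: every real number is an eigenvalue of the two
Laplace operators with the same multiplicity. -/
def Isospectral (g g' : RMetric I M) : Prop :=
  ∀ μ : ℝ, Module.rank ℂ (eigenspace g μ) = Module.rank ℂ (eigenspace g' μ)

/-- `(M, g)` is locally isometric to `(M, g')`: every point has an open neighbourhood `e.source` and
a diffeomorphism `e` from it onto an open set such that `g` is the pullback of `g'`. -/
def LocallyIsometric (g g' : RMetric I M) : Prop :=
  ∀ x : M, ∃ e : OpenPartialHomeomorph M M, x ∈ e.source ∧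
    ContMDiffOn I I ∞ e e.source ∧ ContMDiffOn I I ∞ e.symm e.target ∧
    ∀ y ∈ e.source, ∀ v w : TangentSpace I y,
      g'.inner (e y) (mfderiv I I e y v) (mfderiv I I e y w) = g.inner y v w

variable (I) in
/-- `N` is a nonempty (embedded, smooth) submanifold of `M` of codimension `k`: near each of its
points it is the zero set of a smooth `ℝᵏ`-valued submersion. -/
def IsSubmanifoldOfCodim (k : ℕ) (N : Set M) : Prop :=
  N.Nonempty ∧ ∀ x ∈ N, ∃ (U : Set M) (F : M → EuclideanSpace ℝ (Fin k)), IsOpen U ∧ x ∈ U ∧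
    ContMDiffOn I 𝓘(ℝ, EuclideanSpace ℝ (Fin k)) ∞ F U ∧
    (∀ y ∈ U, Function.Surjective (mvfderiv I F y)) ∧ N ∩ U = {y ∈ U | F y = 0}

end Manifolds

section Aux
open Filter Topology
theorem pullbackForm_apply {V W : Type*} [AddCommGroup V] [Module ℝ V] [TopologicalSpace V]
    [AddCommGroup W] [Module ℝ W] [TopologicalSpace W]
    (B : W →L[ℝ] W →L[ℝ] ℝ) (A : V →L[ℝ] W) (v w : V) :
    pullbackForm B A v w = B (A v) (A w) := rfl

theorem isVonNBounded_of_pos {V : Type*} [NormedAddCommGroup V] [NormedSpace ℝ V]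
    [FiniteDimensional ℝ V] (B : V →L[ℝ] V →L[ℝ] ℝ) (hB : ∀ v, v ≠ 0 → 0 < B v v) :
    Bornology.IsVonNBounded ℝ {v : V | B v v < 1} := by
  have hc : Continuous fun v => B v v := by fun_prop
  obtain ⟨ε, hε, h⟩ : ∃ ε > 0, ∀ v : V, ‖v‖ = 1 → ε ≤ B v v := by
    rcases (sphere (0 : V) 1).eq_empty_or_nonempty with he | hne
    · exact ⟨1, one_pos, fun v hv => absurd (mem_sphere_zero_iff_norm.2 hv) (by simp [he])⟩
    · obtain ⟨v, hv, hmin⟩ := (isCompact_sphere (0 : V) 1).exists_isMinOn hne hc.continuousOn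
      refine ⟨B v v, hB v ?_, fun w hw => hmin (mem_sphere_zero_iff_norm.2 hw)⟩
      rintro rfl
      simp at hv
  rw [NormedSpace.isVonNBounded_iff]
  refine (isBounded_iff_forall_norm_le).2 ⟨Real.sqrt ε⁻¹, fun v hv => ?_⟩
  apply Real.le_sqrt_of_sq_le
  by_cases h0 : v = 0
  · subst h0; simp [hε.le]
  have hn : ‖v‖ ≠ 0 := norm_ne_zero_iff.2 h0
  have h1 := h (‖v‖⁻¹ • v) (by rw [norm_smul, norm_inv, norm_norm, inv_mul_cancel₀ hn])
  simp only [map_smul, smul_apply, smul_eq_mul] at h1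
  have hv' : B v v < 1 := hv
  have hpos : 0 < ‖v‖ ^ 2 := by positivity
  have h2 : ε * ‖v‖ ^ 2 ≤ B v v := by
    calc ε * ‖v‖ ^ 2 ≤ (‖v‖⁻¹ * (‖v‖⁻¹ * B v v)) * ‖v‖ ^ 2 := by gcongr
      _ = B v v := by field_simp
  rw [le_inv_comm₀ hpos hε, ← one_div, le_div_iff₀ hpos]
  linarith

variable {E : Type*} [NormedAddCommGroup E] [NormedSpace ℝ E] 
  {H : Type*} [TopologicalSpace H] {I : ModelWithCorners ℝ E H} 
  {M : Type*} [TopologicalSpace M] [ChartedSpace H M] [IsManifold I ∞ M]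
  {V : Type*} [NormedAddCommGroup V] [NormedSpace ℝ V]

theorem contMDiffAt_pullbackForm {f : M → V} {B : M → V →L[ℝ] V →L[ℝ] ℝ} {x : M}
    (hf : ContMDiffAt I 𝓘(ℝ, V) ∞ f x) (hB : ContMDiffAt I 𝓘(ℝ, V →L[ℝ] V →L[ℝ] ℝ) ∞ B x) :
    ContMDiffAt I (I.prod 𝓘(ℝ, E →L[ℝ] E →L[ℝ] ℝ)) ∞
      (fun y => TotalSpace.mk' (E →L[ℝ] E →L[ℝ] ℝ)
        (E := fun y : M => TangentSpace I y →L[ℝ] TangentSpace I y →L[ℝ] ℝ) y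
        (pullbackForm (B y) (mvfderiv I f y))) x := by
  rw [contMDiffAt_section]
  have h := hf.mfderiv_const (m := ∞) (by norm_cast)
  have key : ContMDiffAt I 𝓘(ℝ, E →L[ℝ] E →L[ℝ] ℝ) ∞ (fun y =>
      pullbackForm (B y) (inTangentCoordinates I 𝓘(ℝ, V) id f (fun y => mfderiv I 𝓘(ℝ, V) f y) x y)) x := by
    have h2 := hB.clm_comp h
    exact (ContMDiffAt.clm_precomp (F₃ := ℝ) h).clm_comp h2
  refine key.congr_of_eventuallyEq ?_
  filter_upwards [(trivializationAt E (TangentSpace I) x).open_baseSet.mem_nhds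
    (FiberBundle.mem_baseSet_trivializationAt' x)] with y hy
  ext v w
  rw [hom_trivializationAt_apply]
  rw [inCoordinates_apply_eq₂ hy hy (Set.mem_univ _)]
  rw [pullbackForm_apply, pullbackForm_apply]
  simp [ContinuousLinearMap.inCoordinates, inTangentCoordinates, mvfderiv]
  have hs : ∀ v, (trivializationAt E (TangentSpace I) x).symm y v
      = (trivializationAt E (TangentSpace I) x).symmL ℝ y v := fun v => (Trivialization.symmL_apply _ hy v).symm
  rw [hs v, hs w]
  rfl
end Aux

section SphereTorus

/-- Euclidean plane. -/
abbrev E2 := EuclideanSpace ℝ (Fin 2)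

/-- Euclidean space. -/
abbrev E3 := EuclideanSpace ℝ (Fin 3)

/-- The unit sphere `S²` in `ℝ³`. -/
abbrev S2 := sphere (0 : E3) 1

/-- The torus `ℝ² / L`. -/
abbrev Torus (L : Submodule ℤ E2) := E2 ⧸ L.toAddSubgroup

variable (L : Submodule ℤ E2) [DiscreteTopology L]

theorem isLocalHomeomorph_torusMk :
    IsLocalHomeomorph (QuotientAddGroup.mk : E2 → Torus L) :=
  haveI : DiscreteTopology L.toAddSubgroup := ‹DiscreteTopology L›
  (AddSubgroup.isAddQuotientCoveringMap_of_comm L.toAddSubgroup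
    DiscreteTopology.isDiscrete).isCoveringMap.isLocalHomeomorph

/-- The charts of the torus are the local inverses of the projection `ℝ² → ℝ² / L`. -/
instance instChartedSpaceTorus : ChartedSpace E2 (Torus L) :=
  (isLocalHomeomorph_torusMk L).chartedSpace QuotientAddGroup.mk_surjective

theorem mk_symm_of_mem_atlas {e : OpenPartialHomeomorph (Torus L) E2}
    (he : e ∈ atlas E2 (Torus L)) (x : E2) : e.symm x = QuotientAddGroup.mk x := by
  obtain ⟨q, rfl⟩ := he
  simp only [chartAt_self_eq, OpenPartialHomeomorph.trans_refl,
    IsLocalHomeomorph.localInverseAt_symm]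

theorem mk_of_mem_atlas {e : OpenPartialHomeomorph (Torus L) E2}
    (he : e ∈ atlas E2 (Torus L)) {q : Torus L} (hq : q ∈ e.source) :
    (QuotientAddGroup.mk (e q) : Torus L) = q := by
  rw [← mk_symm_of_mem_atlas L he, e.left_inv hq]

/-- The difference of two continuous lifts of the same map to the torus is locally constant. -/
theorem eventually_sub_eq {X : Type*} [TopologicalSpace X] {a b : X → E2} {x : X} {s : Set X}
    (hs : IsOpen s) (hx : x ∈ s) (ha : ContinuousOn a s) (hb : ContinuousOn b s)
    (hab : ∀ y ∈ s, (QuotientAddGroup.mk (a y) : Torus L) = QuotientAddGroup.mk (b y)) :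
    ∀ᶠ y in nhds x, a y = b y + (a x - b x) := by
  obtain ⟨U, hU, hUL⟩ : ∃ U : Set E2, IsOpen U ∧ ∀ v ∈ L, v ∈ U ↔ v = 0 := by
    have h : IsOpen ({0} : Set L) := isOpen_discrete _
    obtain ⟨U, hU, h⟩ := isOpen_induced_iff.1 h
    refine ⟨U, hU, fun v hv => ?_⟩
    have := Set.ext_iff.1 h ⟨v, hv⟩
    simpa [Subtype.ext_iff] using this
  have hd : ∀ y ∈ s, a y - b y ∈ L := fun y hy => by
    have := QuotientAddGroup.eq.1 (hab y hy).symm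
    rwa [neg_add_eq_sub] at this
  have hc : ContinuousAt (fun y => (a y - b y) - (a x - b x)) x :=
    ((ha.sub hb).continuousAt (hs.mem_nhds hx)).sub continuousAt_const
  have h0 : (0 : E2) ∈ U := (hUL 0 L.zero_mem).2 rfl
  have hev : ∀ᶠ y in nhds x, (a y - b y) - (a x - b x) ∈ U :=
    hc.eventually (hU.mem_nhds (by simpa using h0))
  filter_upwards [hev, hs.mem_nhds hx] with y hy hys
  have := (hUL _ (L.sub_mem (hd y hys) (hd x hx))).1 hy
  rw [sub_eq_zero] at this
  rw [← this]; abel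

instance instIsManifoldTorus : IsManifold 𝓘(ℝ, E2) ω (Torus L) := by
  refine isManifold_of_contDiffOn _ _ _ fun e e' he he' => ?_
  simp only [modelWithCornersSelf_coe, modelWithCornersSelf_coe_symm, Function.id_comp,
    Function.comp_id, preimage_id, range_id, inter_univ]
  intro x hx
  have h := eventually_sub_eq L (e.symm.trans e').open_source hx
    (e.symm.trans e').continuousOn continuousOn_id (fun y hy => by
      have hy' : e.symm y ∈ e'.source := by
        have := hy; simp only [mfld_simps] at this; exact this.2
      simpa [mk_symm_of_mem_atlas L he] using mk_of_mem_atlas L he' hy')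
  exact (ContDiffAt.congr_of_eventuallyEq (by fun_prop) h).contDiffWithinAt

/-- The manifold `S² × T²`. -/
abbrev SphereTorus := S2 × Torus L

/-- The model with corners of the four-dimensional manifold `S² × T²`. -/
abbrev IST := (𝓡 2).prod 𝓘(ℝ, E2)

/-- The differential at `x` of `(p, z) ↦ p`, followed by the inclusion `T_p S² ⊆ ℝ³`. -/
def dSphere (x : SphereTorus L) : TangentSpace IST x →L[ℝ] E3 :=
  mvfderiv IST (fun y : SphereTorus L => (y.1 : E3)) x

/-- The differential at `x` of `(p, z) ↦ z`, followed by the canonical identification of the tangent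
space of `T² = ℝ² / L` with `ℝ²`, the derivative of a local inverse of the projection `ℝ² → T²`. -/
def dTorus (x : SphereTorus L) : TangentSpace IST x →L[ℝ] E2 :=
  mvfderiv IST (fun y : SphereTorus L => chartAt E2 x.2 y.2) x

/-- Value at `p : ℝ³`, `X : ℝ³` of the `ℝ²`-valued 1-form `λ` with
`⟨λ_p(X), Z⟩ = ⟨c_Z p × p, X⟩` for all `Z : ℝ²`. -/
def oneForm (c : E2 →ₗ[ℝ] Matrix (Fin 3) (Fin 3) ℝ) (p : E3) : E3 →L[ℝ] E2 :=
  ∑ i, (innerSL ℝ (WithLp.toLp 2 ((c (EuclideanSpace.single i 1) *ᵥ p.ofLp) ⨯₃ p.ofLp) : E3)).smulRight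
    (EuclideanSpace.single i (1 : ℝ))

/-- The connection form `ω(X, Z) = λ(X) + Z`. -/
def connectionForm (c : E2 →ₗ[ℝ] Matrix (Fin 3) (Fin 3) ℝ) (x : SphereTorus L) :
    TangentSpace IST x →L[ℝ] E2 :=
  oneForm c x.1 ∘L dSphere L x + dTorus L x

theorem oneForm_inner (c : E2 →ₗ[ℝ] Matrix (Fin 3) (Fin 3) ℝ) (p X : E3) (Z : E2) :
    inner ℝ (oneForm c p X) Z
      = inner ℝ (WithLp.toLp 2 ((c Z *ᵥ p.ofLp) ⨯₃ p.ofLp) : E3) X := by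
  have hZ : c Z = Z 0 • c (EuclideanSpace.single 0 1) + Z 1 • c (EuclideanSpace.single 1 1) := by
    rw [← map_smul, ← map_smul, ← map_add]
    congr 1
    ext i; fin_cases i <;> simp
  rw [hZ]
  simp [oneForm, PiLp.inner_apply, Fin.sum_univ_two, Fin.sum_univ_three, Matrix.add_mulVec, Matrix.smul_mulVec, inner_add_left, inner_smul_left]
  ring

theorem contDiff_oneForm (c : E2 →ₗ[ℝ] Matrix (Fin 3) (Fin 3) ℝ) : ContDiff ℝ ∞ (oneForm c) := by
  unfold oneForm
  have : ∀ i : Fin 2, ContDiff ℝ ∞ (fun p : E3 => (WithLp.toLp 2 ((c (EuclideanSpace.single i 1) *ᵥ p.ofLp) ⨯₃ p.ofLp) : E3)) := by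
    intro i
    rw [contDiff_euclidean]
    intro j
    fin_cases j <;> simp [cross_apply, Matrix.mulVec, dotProduct, Fin.sum_univ_three] <;> fun_prop
  refine ContDiff.sum fun i _ => ?_
  exact ((innerSL ℝ).contDiff.comp (this i)).smulRight contDiff_const


theorem dSphere_apply (x : SphereTorus L) (v : TangentSpace IST x) :
    dSphere L x v = mvfderiv (𝓡 2) (Subtype.val : S2 → E3) x.1 (v : E2 × E2).1 := by
  have h1 : MDifferentiableAt (𝓡 2) 𝓘(ℝ, E3) (Subtype.val : S2 → E3) x.1 :=
    have : Fact (finrank ℝ E3 = 2 + 1) := ⟨by simp⟩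
    (contMDiff_coe_sphere (m := 1)).mdifferentiableAt one_ne_zero
  have h2 : MDifferentiableAt IST (𝓡 2) (Prod.fst : SphereTorus L → S2) x := mdifferentiableAt_fst
  have := mfderiv_comp x h1 h2
  rw [mfderiv_fst] at this
  exact congrArg (fun A => A v) this

theorem dTorus_apply (x : SphereTorus L) (v : TangentSpace IST x) :
    dTorus L x v = mvfderiv 𝓘(ℝ, E2) (chartAt E2 x.2) x.2 (v : E2 × E2).2 := by
  have h1 : MDifferentiableAt 𝓘(ℝ, E2) 𝓘(ℝ, E2) (chartAt E2 x.2) x.2 :=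
    mdifferentiableAt_atlas (chart_mem_atlas E2 x.2) (mem_chart_source E2 x.2)
  have h2 : MDifferentiableAt IST 𝓘(ℝ, E2) (Prod.snd : SphereTorus L → Torus L) x :=
    mdifferentiableAt_snd
  have := mfderiv_comp x h1 h2
  rw [mfderiv_snd] at this
  exact congrArg (fun A => A v) this

theorem eq_zero_of_forms (x : SphereTorus L) (v : TangentSpace IST x)
    (h1 : dSphere L x v = 0) (h2 : dTorus L x v = 0) : v = 0 := by
  rw [dSphere_apply] at h1
  rw [dTorus_apply] at h2
  have : Fact (finrank ℝ E3 = 2 + 1) := ⟨by simp⟩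
  have e1 : (v : E2 × E2).1 = 0 :=
    injective_mvfderiv_subtypeVal_sphere x.1 (h1.trans (map_zero _).symm)
  have e2 : (v : E2 × E2).2 = 0 := by
    have := (isInvertible_mfderiv_extChartAt (I := 𝓘(ℝ, E2))
      (mem_extChartAt_source (I := 𝓘(ℝ, E2)) x.2)).injective
    exact this (h2.trans (map_zero _).symm)
  exact Prod.ext e1 e2

/-- The fixed chart at a nearby point gives the same form. -/
theorem dTorus_eventually (x : SphereTorus L) : ∀ᶠ y in nhds x,
    dTorus L y = mvfderiv IST (fun y : SphereTorus L => chartAt E2 x.2 y.2) y := by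
  have : ∀ᶠ y in nhds x, y.2 ∈ (chartAt E2 x.2).source :=
    continuous_snd.continuousAt.eventually
      ((chartAt E2 x.2).open_source.mem_nhds (mem_chart_source E2 x.2))
  filter_upwards [this] with y hy
  have h := eventually_sub_eq L
    ((chartAt E2 y.2).open_source.inter (chartAt E2 x.2).open_source)
    ⟨mem_chart_source E2 y.2, hy⟩
    ((chartAt E2 y.2).continuousOn.mono inter_subset_left)
    ((chartAt E2 x.2).continuousOn.mono inter_subset_right)
    (fun z hz => by
      rw [mk_of_mem_atlas L (chart_mem_atlas E2 y.2) hz.1,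
        mk_of_mem_atlas L (chart_mem_atlas E2 x.2) hz.2])
  have h' := (continuous_snd.continuousAt (x := y)).eventually h
  have hd : MDifferentiableAt IST 𝓘(ℝ, E2) (fun y : SphereTorus L => chartAt E2 x.2 y.2) y :=
    (mdifferentiableAt_atlas (chart_mem_atlas E2 x.2) hy).comp y mdifferentiableAt_snd
  have e : mvfderiv IST (fun z : SphereTorus L => chartAt E2 y.2 z.2) y
      = mvfderiv IST (fun z : SphereTorus L => chartAt E2 x.2 z.2
        + (chartAt E2 y.2 y.2 - chartAt E2 x.2 y.2)) y := by
    unfold mvfderiv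
    have := Filter.EventuallyEq.mfderiv_eq (I := IST) (I' := 𝓘(ℝ, E2)) h'
    exact this
  rw [dTorus, e]
  have := mvfderiv_add hd (mdifferentiableAt_const
    (c := chartAt E2 y.2 y.2 - chartAt E2 x.2 y.2))
  rw [mvfderiv_const, add_zero] at this
  exact this


theorem metric_pos (c : E2 →ₗ[ℝ] Matrix (Fin 3) (Fin 3) ℝ) (x : SphereTorus L)
    (v : TangentSpace IST x) (hv : v ≠ 0) :
    0 < (pullbackForm (innerSL ℝ) (dSphere L x)
      + pullbackForm (innerSL ℝ) (connectionForm L c x)) v v := by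
  change 0 < inner ℝ (dSphere L x v) (dSphere L x v)
    + inner ℝ (connectionForm L c x v) (connectionForm L c x v)
  by_contra! h
  have h1 := real_inner_self_nonneg (x := dSphere L x v)
  have h2 := real_inner_self_nonneg (x := connectionForm L c x v)
  have e1 : dSphere L x v = 0 := inner_self_eq_zero (𝕜 := ℝ).1 (by linarith)
  have e2 : connectionForm L c x v = 0 := inner_self_eq_zero (𝕜 := ℝ).1 (by linarith)
  have e3 : connectionForm L c x v = oneForm c x.1 (dSphere L x v) + dTorus L x v := rfl
  rw [e1, map_zero, zero_add] at e3
  exact hv (eq_zero_of_forms L x v e1 (e3.symm.trans e2))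

theorem metric_contMDiffAt (c : E2 →ₗ[ℝ] Matrix (Fin 3) (Fin 3) ℝ) (x : SphereTorus L) :
    ContMDiffAt IST (IST.prod 𝓘(ℝ, (E2 × E2) →L[ℝ] (E2 × E2) →L[ℝ] ℝ)) ∞
      (fun y => TotalSpace.mk' ((E2 × E2) →L[ℝ] (E2 × E2) →L[ℝ] ℝ)
        (E := fun y : SphereTorus L => TangentSpace IST y →L[ℝ] TangentSpace IST y →L[ℝ] ℝ) y
        (pullbackForm (innerSL ℝ) (dSphere L y)
          + pullbackForm (innerSL ℝ) (connectionForm L c y))) x := by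
  have hs : ContMDiff IST 𝓘(ℝ, E3) ∞ (fun y : SphereTorus L => (y.1 : E3)) := by
    have : Fact (finrank ℝ E3 = 2 + 1) := ⟨by simp⟩
    exact contMDiff_coe_sphere.comp contMDiff_fst
  have ht : ContMDiffAt IST 𝓘(ℝ, E2) ∞ (fun y : SphereTorus L => chartAt E2 x.2 y.2) x :=
    (contMDiffAt_of_mem_maximalAtlas (IsManifold.chart_mem_maximalAtlas x.2)
      (mem_chart_source E2 x.2)).comp x contMDiffAt_snd
  let f : SphereTorus L → E3 × E2 := fun y => ((y.1 : E3), chartAt E2 x.2 y.2)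
  have hf : ContMDiffAt IST 𝓘(ℝ, E3 × E2) ∞ f x := hs.contMDiffAt.prodMk_space ht
  let P : E3 × E2 →L[ℝ] E3 := ContinuousLinearMap.fst ℝ E3 E2
  let Q : E3 → E3 × E2 →L[ℝ] E2 := fun p =>
    oneForm c p ∘L P + ContinuousLinearMap.snd ℝ E3 E2
  let B : SphereTorus L → E3 × E2 →L[ℝ] E3 × E2 →L[ℝ] ℝ := fun y =>
    pullbackForm (innerSL ℝ) P + pullbackForm (innerSL ℝ) (Q y.1)
  have hQ : ContMDiff IST 𝓘(ℝ, E3 × E2 →L[ℝ] E2) ∞ (fun y : SphereTorus L => Q y.1) := by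
    have : ContDiff ℝ ∞ Q := ((contDiff_oneForm c).clm_comp contDiff_const).add contDiff_const
    exact this.contMDiff.comp hs
  have hB : ContMDiffAt IST 𝓘(ℝ, E3 × E2 →L[ℝ] E3 × E2 →L[ℝ] ℝ) ∞ B x := by
    have h1 : ContMDiff IST 𝓘(ℝ, E3 × E2 →L[ℝ] E3 × E2 →L[ℝ] ℝ) ∞
        (fun y : SphereTorus L => pullbackForm (innerSL ℝ) (Q y.1)) :=
      (ContMDiff.clm_precomp (F₃ := ℝ) hQ).clm_comp (contMDiff_const.clm_comp hQ)
    exact (contMDiff_const.add h1).contMDiffAt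
  refine (contMDiffAt_pullbackForm hf hB).congr_of_eventuallyEq ?_
  have hsrc : ∀ᶠ y in nhds x, y.2 ∈ (chartAt E2 x.2).source :=
    continuous_snd.continuousAt.eventually
      ((chartAt E2 x.2).open_source.mem_nhds (mem_chart_source E2 x.2))
  filter_upwards [dTorus_eventually L x, hsrc] with y hy hsy
  have hd1 : MDifferentiableAt IST 𝓘(ℝ, E3) (fun y : SphereTorus L => (y.1 : E3)) y :=
    hs.mdifferentiableAt (by simp)
  have hd2 : MDifferentiableAt IST 𝓘(ℝ, E2) (fun y : SphereTorus L => chartAt E2 x.2 y.2) y :=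
    (mdifferentiableAt_atlas (chart_mem_atlas E2 x.2) hsy).comp y mdifferentiableAt_snd
  have hdf : MDifferentiableAt IST 𝓘(ℝ, E3 × E2) f y := hd1.prodMk_space hd2
  have e1 : dSphere L y = P ∘L mvfderiv IST f y := by
    have := mfderiv_comp y (g := P) P.mdifferentiableAt hdf
    rw [ContinuousLinearMap.mfderiv_eq] at this
    exact this
  have e2 : dTorus L y = ContinuousLinearMap.snd ℝ E3 E2 ∘L mvfderiv IST f y := by
    have := mfderiv_comp y (g := ContinuousLinearMap.snd ℝ E3 E2)
      (ContinuousLinearMap.snd ℝ E3 E2).mdifferentiableAt hdf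
    rw [ContinuousLinearMap.mfderiv_eq] at this
    exact hy.trans this
  unfold connectionForm
  rw [e1, e2]
  rfl

/-- The metric `g_λ` on `S² × T²`, for `λ` associated with `c`: the `ℝ³`-inner product of the
`S²`-components plus the `ℝ²`-inner product of the values of the connection form. -/
def metric (c : E2 →ₗ[ℝ] Matrix (Fin 3) (Fin 3) ℝ) : RMetric IST (SphereTorus L) where
  inner x := pullbackForm (innerSL ℝ) (dSphere L x) + pullbackForm (innerSL ℝ) (connectionForm L c x)
  symm x v w := by
    change inner ℝ (dSphere L x v) (dSphere L x w)
        + inner ℝ (connectionForm L c x v) (connectionForm L c x w)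
      = inner ℝ (dSphere L x w) (dSphere L x v)
        + inner ℝ (connectionForm L c x w) (connectionForm L c x v)
    rw [real_inner_comm, real_inner_comm (connectionForm L c x w)]
  pos x v hv := metric_pos L c x v hv
  isVonNBounded x := isVonNBounded_of_pos (V := E2 × E2)
    (pullbackForm (innerSL ℝ) (dSphere L x) + pullbackForm (innerSL ℝ) (connectionForm L c x))
    (fun v hv => metric_pos L c x v hv)
  contMDiff x := metric_contMDiffAt L c x

/-- The linear map `Z ↦ Z₁ A + Z₂ B`. -/
def pencil (A B : Matrix (Fin 3) (Fin 3) ℝ) : E2 →ₗ[ℝ] Matrix (Fin 3) (Fin 3) ℝ where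
  toFun Z := Z 0 • A + Z 1 • B
  map_add' Z W := by simp only [PiLp.add_apply, add_smul]; abel
  map_smul' a Z := by simp [mul_smul]

/-- The first of the two linear maps `ℝ² → S₀(ℝ³)`. -/
def c₁ : E2 →ₗ[ℝ] Matrix (Fin 3) (Fin 3) ℝ :=
  pencil !![-1, 0, 0; 0, 0, 0; 0, 0, 1] !![0, 1, 0; 1, 0, 1; 0, 1, 0]

/-- The second of the two linear maps `ℝ² → S₀(ℝ³)`. -/
def c₂ : E2 →ₗ[ℝ] Matrix (Fin 3) (Fin 3) ℝ :=
  pencil !![-1, 0, 0; 0, 0, 0; 0, 0, 1] !![0, 0, √2; 0, 0, 0; √2, 0, 0]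

end SphereTorus

end SphereTorusMetrics

end

/-! Curvature. In the stereographic chart centred at p the round metric is conformal to the flat
one, with a conformal factor that equals 1, has vanishing derivative and Hessian -⟨·,·⟩ at the
origin. The connection form vanishes on the vectors (eᵢ, -λ(eᵢ)), so at p the scalar curvature is 2
minus half the sum over a of the squares of dλ_a(e₀, e₁). For c_Z symmetric and traceless, dλ_Z(v,
w) = 3⟨v × w, c_Z p⟩, and on an orthonormal tangent frame this is ±3⟨p, c_Z p⟩. Hence scal = 2 -
(9/2) ∑ₐ ⟨p, c_a p⟩² (`scalarCurvature_metric`). The maximum 2 is attained exactly where two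
explicit quadratic forms vanish together on the sphere: a great circle and two points for `c₁`, two
points for `c₂`.

Isospectrality. The torus acts by isometries, so an eigenfunction splits into Fourier components
whose weights k lie in the dual lattice. To see what the Laplacian does to a component, functions
are lifted to (ℝ³ ∖ 0) × ℝ², constant along rays. There -Δ is a sum of second derivatives in the
directions (eᵢ, -λ(eᵢ)) and (0, e_a), without first-order terms, because λ is divergence free
(`laplacian_metric`). On a function of weight k this operator sees λ only through ⟨k, λ⟩, which is
built from the single matrix c_k (`secondDeriv_weight_congr`). The matrices `c₁ k` and `c₂ k` have
the same characteristic polynomial for every k, hence are conjugate under a rotation, and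
composition with that rotation identifies the two weight spaces (`weightSpaceEquiv`). The rotation
depends on k, so no single map relates the two metrics. The maximum principle gives 4π²‖k‖² ≤ μ for
every weight that occurs (`norm_weight_le`). Thus an eigenspace is a finite product of weight spaces
(`bijective_fourierDecomposition`), and multiplicities agree.

Local isometry. Scalar curvature is preserved by local isometries
(`scalarCurvature_eq_of_isometry`). A local isometry from the first metric to the second would
immerse a three-dimensional piece of great circle × torus into two points × torus, which has
dimension two (`not_locallyIsometric`). -/

noncomputable section

namespace SphereTorusMetrics

open Set Metric Bundle Module MeasureTheory
open scoped Manifold ContDiff Matrix Topology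

/-! ### Curvature of a metric on an open subset of a vector space, in orthonormal bases -/

section LocalGeometry

set_option linter.unusedSectionVars false

set_option maxSynthPendingDepth 5

variable {E : Type*} [NormedAddCommGroup E] [NormedSpace ℝ E] [FiniteDimensional ℝ E]

/-- Near `x`, the field `g` of bilinear forms is a smooth Riemannian metric. -/
structure IsRiemannianNear (g : E → E →L[ℝ] E →L[ℝ] ℝ) (x : E) : Prop where
  smooth : ∀ᶠ y in 𝓝 x, ContDiffAt ℝ ∞ g y
  symm : ∀ᶠ y in 𝓝 x, ∀ v w, g y v w = g y w v
  pos : ∀ᶠ y in 𝓝 x, ∀ v, v ≠ 0 → 0 < g y v v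

/-- Positivity makes `B` injective into the dual space, which has the same dimension. -/
theorem isInvertible_of_pos (B : E →L[ℝ] E →L[ℝ] ℝ) (hB : ∀ v, v ≠ 0 → 0 < B v v) :
    B.IsInvertible := by
  have hinj : Function.Injective (B : E →ₗ[ℝ] E →L[ℝ] ℝ) := by
    rw [← LinearMap.ker_eq_bot, LinearMap.ker_eq_bot']
    intro v hv
    by_contra h
    have := hB v h
    have h2 : B v = 0 := hv
    rw [h2] at this
    simp at this
  have hdim : finrank ℝ E = finrank ℝ (E →L[ℝ] ℝ) := by
    rw [← (LinearMap.toContinuousLinearMap : (E →ₗ[ℝ] ℝ) ≃ₗ[ℝ] E →L[ℝ] ℝ).finrank_eq]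
    exact (Subspace.dual_finrank_eq (K := ℝ) (V := E)).symm
  refine ⟨(LinearEquiv.ofInjectiveOfFinrankEq _ hinj hdim).toContinuousLinearEquiv, ?_⟩
  ext v w
  rfl

/-- The Christoffel symbols of the first kind. -/
def koszul (g : E → E →L[ℝ] E →L[ℝ] ℝ) (x : E) : E →L[ℝ] E →L[ℝ] E →L[ℝ] ℝ :=
  (2 : ℝ)⁻¹ • (fderiv ℝ g x + (fderiv ℝ g x).flip
    - (ContinuousLinearMap.flipₗᵢ ℝ E E ℝ).toContinuousLinearEquiv.toContinuousLinearMap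
        ∘L (fderiv ℝ g x).flip)

theorem koszul_apply (g : E → E →L[ℝ] E →L[ℝ] ℝ) (x u v w : E) :
    koszul g x u v w = 2⁻¹ * (fderiv ℝ g x u v w + fderiv ℝ g x v u w - fderiv ℝ g x w u v) := rfl

/-- The Christoffel symbols as a bilinear map. -/
def christoffelL (g : E → E →L[ℝ] E →L[ℝ] ℝ) (x : E) : E →L[ℝ] E →L[ℝ] E :=
  ContinuousLinearMap.compL ℝ E (E →L[ℝ] ℝ) E (g x).inverse ∘L koszul g x

theorem christoffelL_apply (g : E → E →L[ℝ] E →L[ℝ] ℝ) (x u v : E) :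
    christoffelL g x u v = christoffel g x u v := rfl

variable {g : E → E →L[ℝ] E →L[ℝ] ℝ} {x : E}

namespace IsRiemannianNear

theorem contDiffAt (hg : IsRiemannianNear g x) : ContDiffAt ℝ ∞ g x := hg.smooth.self_of_nhds

theorem isInvertible (hg : IsRiemannianNear g x) : ∀ᶠ y in 𝓝 x, (g y).IsInvertible :=
  hg.pos.mono fun _ hy => isInvertible_of_pos _ hy

theorem eventually (hg : IsRiemannianNear g x) : ∀ᶠ y in 𝓝 x, IsRiemannianNear g y := by
  filter_upwards [hg.smooth.eventually_nhds, hg.symm.eventually_nhds,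
    hg.pos.eventually_nhds] with y h1 h2 h3 using ⟨h1, h2, h3⟩

theorem congr {g' : E → E →L[ℝ] E →L[ℝ] ℝ} (hg : IsRiemannianNear g x) (h : g' =ᶠ[𝓝 x] g) :
    IsRiemannianNear g' x := by
  refine ⟨?_, ?_, ?_⟩
  · filter_upwards [h.eventually_nhds, hg.smooth] with y hy h1
    exact h1.congr_of_eventuallyEq hy
  · filter_upwards [h, hg.symm] with y hy h1
    rw [hy]; exact h1
  · filter_upwards [h, hg.pos] with y hy h1
    rw [hy]; exact h1

theorem contDiffAt_fderiv (hg : IsRiemannianNear g x) : ContDiffAt ℝ ∞ (fderiv ℝ g) x :=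
  hg.contDiffAt.fderiv_right (by norm_cast)

theorem differentiableAt (hg : IsRiemannianNear g x) : DifferentiableAt ℝ g x :=
  hg.contDiffAt.differentiableAt (by simp)

theorem differentiableAt_fderiv (hg : IsRiemannianNear g x) :
    DifferentiableAt ℝ (fderiv ℝ g) x :=
  hg.contDiffAt_fderiv.differentiableAt (by simp)

theorem contDiffAt_koszul (hg : IsRiemannianNear g x) : ContDiffAt ℝ ∞ (koszul g) x := by
  have h := hg.contDiffAt_fderiv
  have hf : ContDiffAt ℝ ∞ (fun y => (fderiv ℝ g y).flip) x :=
    (ContinuousLinearMap.flipₗᵢ ℝ E E (E →L[ℝ] ℝ)).contDiff.contDiffAt.comp x h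
  exact (contDiffAt_const (c := (2 : ℝ)⁻¹)).smul ((h.add hf).sub (contDiffAt_const.clm_comp hf))

theorem contDiffAt_inverse (hg : IsRiemannianNear g x) :
    ContDiffAt ℝ ∞ (fun y => (g y).inverse) x :=
  (hg.isInvertible.self_of_nhds.contDiffAt_map_inverse).comp x hg.contDiffAt

theorem contDiffAt_christoffelL (hg : IsRiemannianNear g x) :
    ContDiffAt ℝ ∞ (christoffelL g) x :=
  ((ContinuousLinearMap.contDiff _).contDiffAt.comp x hg.contDiffAt_inverse).clm_comp
    hg.contDiffAt_koszul

theorem fderiv_symm (hg : IsRiemannianNear g x) (u v w : E) :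
    fderiv ℝ g x u v w = fderiv ℝ g x u w v := by
  have h : g =ᶠ[𝓝 x] fun y => ContinuousLinearMap.flipₗᵢ ℝ E E ℝ (g y) := by
    filter_upwards [hg.symm] with y hy
    ext v w
    exact hy v w
  have h2 := h.fderiv_eq (𝕜 := ℝ)
  rw [show (fun y => ContinuousLinearMap.flipₗᵢ ℝ E E ℝ (g y))
    = (ContinuousLinearMap.flipₗᵢ ℝ E E ℝ).toContinuousLinearEquiv ∘ g from rfl,
    ContinuousLinearEquiv.comp_fderiv] at h2
  conv_lhs => rw [h2]
  rfl

/-- Compatibility of the Levi-Civita connection with the metric, in coordinates. -/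
theorem fderiv_eq_koszul (hg : IsRiemannianNear g x) (u v w : E) :
    fderiv ℝ g x u v w = koszul g x u v w + koszul g x u w v := by
  rw [koszul_apply, koszul_apply, hg.fderiv_symm u w v, hg.fderiv_symm v u w,
    hg.fderiv_symm w u v]; ring

theorem inner_christoffel (hg : IsRiemannianNear g x) (u v w : E) :
    g x (christoffel g x u v) w = koszul g x u v w := by
  change g x ((g x).inverse (koszul g x u v)) w = _
  rw [hg.isInvertible.self_of_nhds.self_apply_inverse]

theorem ext_inner (hg : IsRiemannianNear g x) {a b : E} (h : ∀ w, g x a w = g x b w) : a = b :=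
  hg.isInvertible.self_of_nhds.injective (ContinuousLinearMap.ext h)

theorem fderiv_koszul (hg : IsRiemannianNear g x) (s u v w : E) :
    fderiv ℝ (koszul g) x s u v w = 2⁻¹ * (fderiv ℝ (fderiv ℝ g) x s u v w
      + fderiv ℝ (fderiv ℝ g) x s v u w - fderiv ℝ (fderiv ℝ g) x s w u v) := by
  have hd := hg.differentiableAt_fderiv
  have key : ∀ a b c : E, HasFDerivAt (fun y => fderiv ℝ g y a b c)
      (((fderiv ℝ (fderiv ℝ g) x).flip a).flip b |>.flip c) x := by
    intro a b c
    have h1 := hd.hasFDerivAt.clm_apply (hasFDerivAt_const a x)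
    have h2 := h1.clm_apply (hasFDerivAt_const b x)
    have h3 := h2.clm_apply (hasFDerivAt_const c x)
    refine h3.congr_fderiv ?_
    ext z; simp
  have hk := (hg.contDiffAt_koszul.differentiableAt (by simp)).hasFDerivAt
  have h1 := hk.clm_apply (hasFDerivAt_const u x)
  have h2 := h1.clm_apply (hasFDerivAt_const v x)
  have h3 := h2.clm_apply (hasFDerivAt_const w x)
  have h4 : HasFDerivAt (fun y => koszul g y u v w) _ x :=
    (((key u v w).add (key v u w)).sub (key w u v)).const_mul 2⁻¹
  have := congrArg (fun A => A s) (h3.unique h4)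
  simpa using this

theorem fderiv_christoffel (hg : IsRiemannianNear g x) (u v w : E) :
    fderiv ℝ (fun y => christoffel g y v w) x u = fderiv ℝ (christoffelL g) x u v w := by
  have hk := (hg.contDiffAt_christoffelL.differentiableAt (by simp)).hasFDerivAt
  have h1 := hk.clm_apply (hasFDerivAt_const v x)
  have h2 := h1.clm_apply (hasFDerivAt_const w x)
  have h3 : HasFDerivAt (fun y => christoffel g y v w) _ x := h2
  rw [h3.fderiv]
  simp

/-- Differentiate g(Γ(v, w), t) = `koszul g y v w t` in y; the inverse metric never has to be
differentiated explicitly. -/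
theorem inner_fderiv_christoffel (hg : IsRiemannianNear g x) (u v w t : E) :
    g x (fderiv ℝ (christoffelL g) x u v w) t
      = fderiv ℝ (koszul g) x u v w t - fderiv ℝ g x u (christoffel g x v w) t := by
  have hk := (hg.contDiffAt_christoffelL.differentiableAt (by simp)).hasFDerivAt
  have h1 := hk.clm_apply (hasFDerivAt_const v x)
  have h2 := h1.clm_apply (hasFDerivAt_const w x)
  have h3 := (hg.differentiableAt.hasFDerivAt.clm_apply h2).clm_apply (hasFDerivAt_const t x)
  have hk' := (hg.contDiffAt_koszul.differentiableAt (by simp)).hasFDerivAt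
  have h1' := hk'.clm_apply (hasFDerivAt_const v x)
  have h2' := h1'.clm_apply (hasFDerivAt_const w x)
  have h3' := h2'.clm_apply (hasFDerivAt_const t x)
  have he : (fun y => g y (christoffelL g y v w) t) =ᶠ[𝓝 x] fun y => koszul g y v w t := by
    filter_upwards [hg.eventually] with y hy
    exact hy.inner_christoffel v w t
  have := congrArg (fun A => A u) (h3.unique (h3'.congr_of_eventuallyEq he))
  simp [christoffelL_apply] at this
  linarith

/-- Metric compatibility splits each ∂g(Γ, t) into two Koszul terms, one of which cancels against
g(Γ(u, Γ(v, w)), t) or its counterpart. What remains is computable from the 2-jet of g alone. -/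
theorem inner_riemann (hg : IsRiemannianNear g x) (u v w t : E) :
    g x (riemann g x u v w) t = 2⁻¹ * (fderiv ℝ (fderiv ℝ g) x u w v t
        - fderiv ℝ (fderiv ℝ g) x u t v w - fderiv ℝ (fderiv ℝ g) x v w u t
        + fderiv ℝ (fderiv ℝ g) x v t u w)
      - g x (christoffel g x u t) (christoffel g x v w)
      + g x (christoffel g x v t) (christoffel g x u w) := by
  have hs : fderiv ℝ (fderiv ℝ g) x u v = fderiv ℝ (fderiv ℝ g) x v u :=
    (hg.contDiffAt.isSymmSndFDerivAt (by simp; norm_cast)) u v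
  unfold riemann
  rw [hg.fderiv_christoffel, hg.fderiv_christoffel]
  simp only [map_add, map_sub, add_apply, sub_apply]
  rw [hg.inner_fderiv_christoffel, hg.inner_fderiv_christoffel, hg.inner_christoffel,
    hg.inner_christoffel, hg.inner_christoffel, hg.inner_christoffel, hg.fderiv_koszul,
    hg.fderiv_koszul, hs, hg.fderiv_eq_koszul u, hg.fderiv_eq_koszul v]
  ring

/-- The curvature tensor is linear in its first argument. -/
theorem riemann_linear (hg : IsRiemannianNear g x) :
    ∃ R : E →ₗ[ℝ] E →ₗ[ℝ] E →ₗ[ℝ] E, ∀ u v w, riemann g x u v w = R u v w := by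
  let D := fderiv ℝ (christoffelL g) x
  let Γ := christoffelL g x
  have e : ∀ u v w, riemann g x u v w = D u v w - D v u w + Γ u (Γ v w) - Γ v (Γ u w) := by
    intro u v w
    unfold riemann
    rw [hg.fderiv_christoffel, hg.fderiv_christoffel]
    rfl
  refine ⟨LinearMap.mk₂ ℝ (fun u v => ((D u v - D v u + Γ u ∘L Γ v - Γ v ∘L Γ u : E →L[ℝ] E) :
    E →ₗ[ℝ] E)) ?_ ?_ ?_ ?_, fun u v w => e u v w⟩ <;> intros <;> ext <;> simp [smul_sub] <;> abel

end IsRiemannianNear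

variable {ι : Type*} [Fintype ι] [DecidableEq ι]

/-- The trace of a bilinear map is the sum over an orthonormal basis. -/
theorem metricTrace_eq_sum {V : Type*} [AddCommGroup V] [Module ℝ V] {B : E →L[ℝ] E →L[ℝ] ℝ}
    (hB : B.IsInvertible)
    (o : Basis ι ℝ E) (ho : ∀ i j, B (o i) (o j) = if i = j then 1 else 0)
    (A : E →ₗ[ℝ] E →ₗ[ℝ] V) : metricTrace B (fun v w => A v w) = ∑ j, A (o j) (o j) := by
  have hc : ∀ v, v = ∑ j, B v (o j) • o j := by
    intro v
    have h : ∀ j, B v (o j) = o.repr v j := by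
      intro j
      have := congrArg (fun z => B z (o j)) (o.sum_repr v)
      simp only [map_sum, map_smul, sum_apply, smul_apply, ho] at this
      simpa using this.symm
    simp_rw [h]
    exact (o.sum_repr v).symm
  have hinv : ∀ α : E →L[ℝ] ℝ, B.inverse α = ∑ j, α (o j) • o j := by
    intro α
    rw [hc (B.inverse α)]
    simp_rw [hB.self_apply_inverse]
  unfold metricTrace
  simp_rw [hinv, map_sum, map_smul]
  rw [Finset.sum_comm]
  refine Finset.sum_congr rfl fun j _ => ?_
  have := congrArg (fun z => A z (o j)) ((finBasis ℝ E).sum_repr (o j))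
  simp only [map_sum, map_smul, LinearMap.sum_apply, LinearMap.smul_apply] at this
  exact this

theorem trace_eq_sum_inner {B : E →L[ℝ] E →L[ℝ] ℝ}
    (o : Basis ι ℝ E) (ho : ∀ i j, B (o i) (o j) = if i = j then 1 else 0) (A : E →ₗ[ℝ] E) :
    ∑ i, (finBasis ℝ E).coord i (A (finBasis ℝ E i)) = ∑ j, B (A (o j)) (o j) := by
  have h1 : ∀ {κ : Type _} [Fintype κ] [DecidableEq κ] (b : Basis κ ℝ E),
      LinearMap.trace ℝ E A = ∑ i, b.coord i (A (b i)) := by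
    intro κ _ _ b
    rw [LinearMap.trace_eq_matrix_trace ℝ b, Matrix.trace]
    simp [LinearMap.toMatrix_apply]
  rw [← h1, LinearMap.trace_eq_matrix_trace ℝ o, Matrix.trace]
  refine Finset.sum_congr rfl fun j _ => ?_
  rw [Matrix.diag_apply, LinearMap.toMatrix_apply]
  have := congrArg (fun z => B z (o j)) (o.sum_repr (A (o j)))
  simp only [map_sum, map_smul, sum_apply, smul_apply, ho] at this
  simpa using this

/-- The scalar curvature of a metric on an open subset of a vector space. -/
def scalarCurvatureAt (g : E → E →L[ℝ] E →L[ℝ] ℝ) (x : E) : ℝ :=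
  metricTrace (g x) (ricci g x)

/-- Both traces, over the fixed basis of `E`, may be taken over an orthonormal basis instead, since
each is basis independent. -/
theorem scalarCurvatureAt_eq_sum (hg : IsRiemannianNear g x)
    (o : Basis ι ℝ E) (ho : ∀ i j, g x (o i) (o j) = if i = j then 1 else 0) :
    scalarCurvatureAt g x = ∑ j, ∑ i, g x (riemann g x (o i) (o j) (o j)) (o i) := by
  obtain ⟨R, hR⟩ := hg.riemann_linear
  let A : E →ₗ[ℝ] E →ₗ[ℝ] ℝ := LinearMap.mk₂ ℝ
    (fun v w => ∑ i, (finBasis ℝ E).coord i (R (finBasis ℝ E i) v w))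
    (by intros; simp [Finset.sum_add_distrib]) (by intros; simp [Finset.mul_sum])
    (by intros; simp [Finset.sum_add_distrib]) (by intros; simp [Finset.mul_sum])
  have hA : ∀ v w, ricci g x v w = A v w := by
    intro v w
    simp [ricci, hR, A]
  have : ricci g x = fun v w => A v w := by ext v w; exact hA v w
  rw [scalarCurvatureAt, this, metricTrace_eq_sum hg.isInvertible.self_of_nhds
    o ho A]
  refine Finset.sum_congr rfl fun j _ => ?_
  let T : E →ₗ[ℝ] E := (R.flip (o j)).flip (o j)
  have := trace_eq_sum_inner o ho T
  simpa [A, T, hR] using this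

end LocalGeometry

/-! ### Transformation of Christoffel symbols and curvature under local isometries -/

section Naturality

set_option linter.unusedSectionVars false
set_option maxSynthPendingDepth 5

variable {E : Type*} [NormedAddCommGroup E] [NormedSpace ℝ E] [FiniteDimensional ℝ E]
  {g g' : E → E →L[ℝ] E →L[ℝ] ℝ} {φ : E → E} {x : E}

/-- Near `x`, the metric `g` is the pullback of `g'` under the local diffeomorphism `φ`. -/
structure IsPullbackNear (g g' : E → E →L[ℝ] E →L[ℝ] ℝ) (φ : E → E) (x : E) : Prop where
  source : IsRiemannianNear g x
  target : IsRiemannianNear g' (φ x)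
  smooth : ∀ᶠ y in 𝓝 x, ContDiffAt ℝ ∞ φ y
  surjective : ∀ᶠ y in 𝓝 x, Function.Surjective (fderiv ℝ φ y)
  pullback : ∀ᶠ y in 𝓝 x, ∀ v w, g y v w = g' (φ y) (fderiv ℝ φ y v) (fderiv ℝ φ y w)

namespace IsPullbackNear

theorem eventually (h : IsPullbackNear g g' φ x) : ∀ᶠ y in 𝓝 x, IsPullbackNear g g' φ y := by
  filter_upwards [h.source.eventually,
    h.smooth.self_of_nhds.continuousAt.eventually h.target.eventually, h.smooth.eventually_nhds,
    h.surjective.eventually_nhds, h.pullback.eventually_nhds] with y h1 h2 h3 h4 h5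
    using ⟨h1, h2, h3, h4, h5⟩

theorem hasFDerivAt (h : IsPullbackNear g g' φ x) : HasFDerivAt φ (fderiv ℝ φ x) x :=
  (h.smooth.self_of_nhds.differentiableAt (by simp)).hasFDerivAt

theorem hasFDerivAt_fderiv (h : IsPullbackNear g g' φ x) :
    HasFDerivAt (fderiv ℝ φ) (fderiv ℝ (fderiv ℝ φ) x) x :=
  ((h.smooth.self_of_nhds.fderiv_right (m := ∞) (by norm_cast)).differentiableAt
    (by simp)).hasFDerivAt

theorem hasFDerivAt_fderiv_fderiv (h : IsPullbackNear g g' φ x) :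
    HasFDerivAt (fderiv ℝ (fderiv ℝ φ)) (fderiv ℝ (fderiv ℝ (fderiv ℝ φ)) x) x :=
  (((h.smooth.self_of_nhds.fderiv_right (m := ∞) (by norm_cast)).fderiv_right
    (m := ∞) (by norm_cast)).differentiableAt (by simp)).hasFDerivAt

theorem snd_symm (h : IsPullbackNear g g' φ x) (u v : E) :
    fderiv ℝ (fderiv ℝ φ) x u v = fderiv ℝ (fderiv ℝ φ) x v u :=
  (h.smooth.self_of_nhds.isSymmSndFDerivAt (by simp; norm_cast)) u v

theorem fderiv_metric (h : IsPullbackNear g g' φ x) (u v w : E) :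
    fderiv ℝ g x u v w
      = fderiv ℝ g' (φ x) (fderiv ℝ φ x u) (fderiv ℝ φ x v) (fderiv ℝ φ x w)
        + g' (φ x) (fderiv ℝ (fderiv ℝ φ) x u v) (fderiv ℝ φ x w)
        + g' (φ x) (fderiv ℝ φ x v) (fderiv ℝ (fderiv ℝ φ) x u w) := by
  have hL := (h.source.differentiableAt.hasFDerivAt.clm_apply (hasFDerivAt_const v x)).clm_apply
    (hasFDerivAt_const w x)
  have hφ := fun a => h.hasFDerivAt_fderiv.clm_apply (hasFDerivAt_const a x)
  have hR := ((h.target.differentiableAt.hasFDerivAt.comp x h.hasFDerivAt).clm_apply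
    (hφ v)).clm_apply (hφ w)
  have he : (fun y => g y v w) =ᶠ[𝓝 x]
      fun y => (g' ∘ φ) y (fderiv ℝ φ y v) (fderiv ℝ φ y w) := by
    filter_upwards [h.pullback] with y hy using hy v w
  have := congrArg (fun A => A u) (hL.unique (hR.congr_of_eventuallyEq he))
  simp at this
  rw [this]
  ring

theorem ext_inner (h : IsPullbackNear g g' φ x) {a b : E}
    (hab : ∀ t, g' (φ x) a (fderiv ℝ φ x t) = g' (φ x) b (fderiv ℝ φ x t)) : a = b :=
  h.target.ext_inner fun w => by
    obtain ⟨t, rfl⟩ := h.surjective.self_of_nhds w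
    exact hab t

/-- The transformation law of the Christoffel symbols. -/
theorem fderiv_christoffel (h : IsPullbackNear g g' φ x) (u v : E) :
    fderiv ℝ φ x (christoffel g x u v)
      = christoffel g' (φ x) (fderiv ℝ φ x u) (fderiv ℝ φ x v)
        + fderiv ℝ (fderiv ℝ φ) x u v := by
  refine h.ext_inner fun t => ?_
  rw [← h.pullback.self_of_nhds, h.source.inner_christoffel, map_add, add_apply,
    h.target.inner_christoffel, koszul_apply, koszul_apply, h.fderiv_metric, h.fderiv_metric,
    h.fderiv_metric, h.snd_symm v u, h.snd_symm t u, h.snd_symm t v,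
    h.target.symm.self_of_nhds (fderiv ℝ φ x u), h.target.symm.self_of_nhds (fderiv ℝ φ x v)]
  ring

/-- The transformation law of the Christoffel symbols, differentiated along u. -/
theorem fderiv_fderiv_christoffel (h : IsPullbackNear g g' φ x) (u v w : E) :
    fderiv ℝ φ x (fderiv ℝ (christoffelL g) x u v w)
      = fderiv ℝ (christoffelL g') (φ x) (fderiv ℝ φ x u) (fderiv ℝ φ x v) (fderiv ℝ φ x w)
        + christoffel g' (φ x) (fderiv ℝ (fderiv ℝ φ) x u v) (fderiv ℝ φ x w)
        + christoffel g' (φ x) (fderiv ℝ φ x v) (fderiv ℝ (fderiv ℝ φ) x u w)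
        + fderiv ℝ (fderiv ℝ (fderiv ℝ φ)) x u v w
        - fderiv ℝ (fderiv ℝ φ) x u (christoffel g x v w) := by
  have hk := (h.source.contDiffAt_christoffelL.differentiableAt (by simp)).hasFDerivAt
  have hk' := (h.target.contDiffAt_christoffelL.differentiableAt (by simp)).hasFDerivAt
  have hφ := fun a => h.hasFDerivAt_fderiv.clm_apply (hasFDerivAt_const a x)
  have hL := h.hasFDerivAt_fderiv.clm_apply
    ((hk.clm_apply (hasFDerivAt_const v x)).clm_apply (hasFDerivAt_const w x))
  have hR := (((hk'.comp x h.hasFDerivAt).clm_apply (hφ v)).clm_apply (hφ w)).add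
    ((h.hasFDerivAt_fderiv_fderiv.clm_apply (hasFDerivAt_const v x)).clm_apply
      (hasFDerivAt_const w x))
  have he : (fun y => fderiv ℝ φ y (christoffelL g y v w)) =ᶠ[𝓝 x]
      (fun y => (christoffelL g' ∘ φ) y (fderiv ℝ φ y v) (fderiv ℝ φ y w))
        + fun y => fderiv ℝ (fderiv ℝ φ) y v w := by
    filter_upwards [h.eventually] with y hy
    exact hy.fderiv_christoffel v w
  have := congrArg (fun A => A u) (hL.unique (hR.congr_of_eventuallyEq he))
  simp [christoffelL_apply] at this
  rw [eq_sub_iff_add_eq, this]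
  abel

/-- Antisymmetrising in u and v removes the third derivative of φ by symmetry, and the terms with
its second derivative cancel against those coming from the quadratic terms in Γ. -/
theorem fderiv_riemann (h : IsPullbackNear g g' φ x) (u v w : E) :
    fderiv ℝ φ x (riemann g x u v w)
      = riemann g' (φ x) (fderiv ℝ φ x u) (fderiv ℝ φ x v) (fderiv ℝ φ x w) := by
  have hs : fderiv ℝ (fderiv ℝ (fderiv ℝ φ)) x u v = fderiv ℝ (fderiv ℝ (fderiv ℝ φ)) x v u :=
    (((h.smooth.self_of_nhds.fderiv_right (m := ∞) (by norm_cast))).isSymmSndFDerivAt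
      (by simp; norm_cast)) u v
  have hadd : ∀ a b c, christoffel g' (φ x) a (b + c)
      = christoffel g' (φ x) a b + christoffel g' (φ x) a c := fun a b c => by
    simp only [← christoffelL_apply, map_add]
  unfold riemann
  rw [h.source.fderiv_christoffel, h.source.fderiv_christoffel, h.target.fderiv_christoffel,
    h.target.fderiv_christoffel, map_sub, map_add, map_sub, h.fderiv_fderiv_christoffel,
    h.fderiv_fderiv_christoffel, hs, h.snd_symm u v]
  simp only [h.fderiv_christoffel, hadd]
  abel

/-- The differential of φ carries an orthonormal basis to an orthonormal basis and intertwines the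
curvature tensors. -/
theorem scalarCurvatureAt_eq (h : IsPullbackNear g g' φ x) {ι : Type*} [Fintype ι] [DecidableEq ι]
    (o : Basis ι ℝ E) (ho : ∀ i j, g x (o i) (o j) = if i = j then 1 else 0) :
    scalarCurvatureAt g x = scalarCurvatureAt g' (φ x) := by
  have hinj : LinearMap.ker (fderiv ℝ φ x : E →ₗ[ℝ] E) = ⊥ :=
    LinearMap.ker_eq_bot.2 (LinearMap.injective_iff_surjective.2 h.surjective.self_of_nhds)
  let T : E ≃ₗ[ℝ] E := LinearEquiv.ofBijective (fderiv ℝ φ x : E →ₗ[ℝ] E)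
    ⟨LinearMap.ker_eq_bot.1 hinj, h.surjective.self_of_nhds⟩
  have hT : ∀ i, o.map T i = fderiv ℝ φ x (o i) := fun i => by
    rw [Basis.map_apply]; rfl
  have ho' : ∀ i j, g' (φ x) (o.map T i) (o.map T j) = if i = j then 1 else 0 := by
    intro i j
    rw [hT, hT, ← h.pullback.self_of_nhds, ho]
  rw [scalarCurvatureAt_eq_sum h.source o ho, scalarCurvatureAt_eq_sum h.target (o.map T) ho']
  refine Finset.sum_congr rfl fun j _ => Finset.sum_congr rfl fun i _ => ?_
  rw [hT, hT, ← h.fderiv_riemann, ← h.pullback.self_of_nhds]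

end IsPullbackNear
end Naturality

/-! ### The metric g_λ in the charts of S² × T² -/

section Charts

/-- The inverse of the stereographic projection from `-p`, in terms of an isometry `ι` of `ℝ²` onto
the orthogonal complement of `p`. -/
def invStereo (ι : E2 →ₗᵢ[ℝ] E3) (p : E3) (u : E2) : E3 :=
  (‖u‖ ^ 2 + 4)⁻¹ • ((4 : ℝ) • ι u - (‖u‖ ^ 2 - 4) • p)

/-- The chart at p projects stereographically from -p onto the plane orthogonal to p, then
identifies that plane with ℝ² by some isometry. Which isometry does not matter, so it stays
existential. -/
theorem exists_extChartAt_sphere_symm (p : S2) :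
    ∃ ι : E2 →ₗᵢ[ℝ] E3, (∀ u, inner ℝ (ι u) (p : E3) = 0) ∧
      ∀ u, ((extChartAt (𝓡 2) p).symm u : E3) = invStereo ι p u := by
  have : Fact (finrank ℝ E3 = 2 + 1) := ⟨by simp⟩
  let U := (OrthonormalBasis.fromOrthogonalSpanSingleton (𝕜 := ℝ) 2
    (ne_zero_of_mem_unit_sphere (-p))).repr
  refine ⟨(Submodule.subtypeₗᵢ _).comp U.symm.toLinearIsometry, fun u => ?_, fun u => ?_⟩
  · have := Submodule.mem_orthogonal_singleton_iff_inner_left.1 (U.symm u).2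
    have h2 : inner ℝ ((U.symm u : (ℝ ∙ ((-p : S2) : E3))ᗮ) : E3) (-(p : E3)) = 0 := this
    rwa [inner_neg_right, neg_eq_zero] at h2
  · have h := stereographic'_symm_apply (n := 2) (-p) u
    have h2 : ((extChartAt (𝓡 2) p).symm u : E3) = (stereographic' 2 (-p)).symm u := rfl
    rw [h2, h]
    have hn : ‖((U.symm u : (ℝ ∙ ((-p : S2) : E3))ᗮ) : E3)‖ = ‖u‖ := by
      exact U.symm.norm_map u
    change (‖((U.symm u : (ℝ ∙ ((-p : S2) : E3))ᗮ) : E3)‖ ^ 2 + 4)⁻¹ • (4 : ℝ) • (U.symm u : E3)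
      + (‖((U.symm u : (ℝ ∙ ((-p : S2) : E3))ᗮ) : E3)‖ ^ 2 + 4)⁻¹
        • (‖((U.symm u : (ℝ ∙ ((-p : S2) : E3))ᗮ) : E3)‖ ^ 2 - 4) • (-p : E3)
      = (‖u‖ ^ 2 + 4)⁻¹ • ((4 : ℝ) • (U.symm u : E3) - (‖u‖ ^ 2 - 4) • (p : E3))
    rw [hn, ← smul_add, smul_neg, ← sub_eq_add_neg]

theorem extChartAt_sphere_self (p : S2) : extChartAt (𝓡 2) p p = (0 : E2) := by
  have : Fact (finrank ℝ E3 = 2 + 1) := ⟨by simp⟩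
  change stereographic' 2 (-p) p = 0
  have h := stereographic_apply_neg (-p)
  rw [neg_neg] at h
  change (OrthonormalBasis.fromOrthogonalSpanSingleton (𝕜 := ℝ) 2
    (ne_zero_of_mem_unit_sphere (-p))).repr (stereographic (norm_eq_of_mem_sphere (-p)) p) = 0
  rw [h, map_zero]

variable (L : Submodule ℤ E2) [DiscreteTopology L]

theorem extChartAt_symm_fst (x : SphereTorus L) (y : E2 × E2) :
    ((extChartAt IST x).symm y).1 = (extChartAt (𝓡 2) x.1).symm y.1 := by
  rw [extChartAt_prod]; rfl

theorem extChartAt_symm_snd (x : SphereTorus L) (y : E2 × E2) :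
    ((extChartAt IST x).symm y).2 = QuotientAddGroup.mk y.2 := by
  rw [extChartAt_prod]
  exact mk_symm_of_mem_atlas L (chart_mem_atlas E2 x.2) y.2

/-- The metric `g_λ` in the coordinates given by a map `P : ℝ² → ℝ³` into the sphere. -/
def modelMetric (c : E2 →ₗ[ℝ] Matrix (Fin 3) (Fin 3) ℝ) (P : E2 → E3) (y : E2 × E2) :
    (E2 × E2) →L[ℝ] (E2 × E2) →L[ℝ] ℝ :=
  pullbackForm (innerSL ℝ) (fderiv ℝ P y.1 ∘L ContinuousLinearMap.fst ℝ E2 E2)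
    + pullbackForm (innerSL ℝ) (oneForm c (P y.1) ∘L fderiv ℝ P y.1
        ∘L ContinuousLinearMap.fst ℝ E2 E2 + ContinuousLinearMap.snd ℝ E2 E2)

theorem modelMetric_apply (c : E2 →ₗ[ℝ] Matrix (Fin 3) (Fin 3) ℝ) (P : E2 → E3) (y v w : E2 × E2) :
    modelMetric c P y v w = inner ℝ (fderiv ℝ P y.1 v.1) (fderiv ℝ P y.1 w.1)
      + inner ℝ (oneForm c (P y.1) (fderiv ℝ P y.1 v.1) + v.2)
        (oneForm c (P y.1) (fderiv ℝ P y.1 w.1) + w.2) := rfl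

theorem contDiff_invStereo (ι : E2 →ₗᵢ[ℝ] E3) (p : E3) : ContDiff ℝ ∞ (invStereo ι p) := by
  unfold invStereo
  have h : ContDiff ℝ ∞ fun u : E2 => ‖u‖ ^ 2 := contDiff_norm_sq ℝ
  refine ContDiff.smul (ContDiff.inv (h.add contDiff_const) fun u => by positivity) ?_
  exact ((contDiff_const (c := (4 : ℝ))).smul ι.toContinuousLinearMap.contDiff).sub
    ((h.sub contDiff_const).smul contDiff_const)

/-- The stereographic chart is onto ℝ², so only the torus coordinate is constrained. -/
theorem mem_extChartAt_target_of_snd {x : SphereTorus L} {y : E2 × E2}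
    (hy : y.2 ∈ (chartAt E2 x.2).target) : y ∈ (extChartAt IST x).target := by
  rw [extChartAt_prod]
  have : Fact (finrank ℝ E3 = 2 + 1) := ⟨by simp⟩
  refine ⟨?_, by simpa [extChartAt] using hy⟩
  have h : (chartAt E2 x.1).target = univ := stereographic'_target (-x.1)
  change y.1 ∈ (extChartAt (𝓡 2) x.1).target
  rw [extChartAt_target, h]
  simp

theorem dSphere_comp_mfderiv_symm {x : SphereTorus L} {y : E2 × E2} {P : E2 → E3}
    (hP : ∀ u, ((extChartAt (𝓡 2) x.1).symm u : E3) = P u) (hPd : DifferentiableAt ℝ P y.1)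
    (hy : y.2 ∈ (chartAt E2 x.2).target) (v : E2 × E2) :
    dSphere L ((extChartAt IST x).symm y)
      (mfderiv 𝓘(ℝ, E2 × E2) IST (extChartAt IST x).symm y v) = fderiv ℝ P y.1 v.1 := by
  have hs : MDifferentiableAt 𝓘(ℝ, E2 × E2) IST (extChartAt IST x).symm y :=
    ((contMDiffOn_extChartAt_symm (I := IST) (n := ∞) x).contMDiffAt
      ((isOpen_extChartAt_target x).mem_nhds (mem_extChartAt_target_of_snd L hy))).mdifferentiableAt
      (by simp)
  have hc : ContMDiff IST 𝓘(ℝ, E3) ∞ (fun y : SphereTorus L => (y.1 : E3)) := by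
    have : Fact (finrank ℝ E3 = 2 + 1) := ⟨by simp⟩
    exact contMDiff_coe_sphere.comp contMDiff_fst
  have h := mfderiv_comp y (hc.mdifferentiableAt (x := (extChartAt IST x).symm y) (by simp)) hs
  have e : (fun y : SphereTorus L => (y.1 : E3)) ∘ (extChartAt IST x).symm = P ∘ Prod.fst := by
    funext y
    simp only [Function.comp_apply]
    rw [extChartAt_symm_fst, hP]
  rw [e, mfderiv_eq_fderiv, fderiv_comp _ hPd differentiableAt_fst, fderiv_fst] at h
  exact (congrArg (fun A => A v) h).symm

/-- Two charts of the torus are local inverses of one projection, so they differ locally by a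
translation, whose derivative is the identity. -/
theorem dTorus_comp_mfderiv_symm {x : SphereTorus L} {y : E2 × E2}
    (hy : y.2 ∈ (chartAt E2 x.2).target) (v : E2 × E2) :
    dTorus L ((extChartAt IST x).symm y)
      (mfderiv 𝓘(ℝ, E2 × E2) IST (extChartAt IST x).symm y v) = v.2 := by
  have hs : MDifferentiableAt 𝓘(ℝ, E2 × E2) IST (extChartAt IST x).symm y :=
    ((contMDiffOn_extChartAt_symm (I := IST) (n := ∞) x).contMDiffAt
      ((isOpen_extChartAt_target x).mem_nhds (mem_extChartAt_target_of_snd L hy))).mdifferentiableAt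
      (by simp)
  set x' := (extChartAt IST x).symm y with hx'
  have hd : MDifferentiableAt IST 𝓘(ℝ, E2) (fun y : SphereTorus L => chartAt E2 x'.2 y.2) x' :=
    (mdifferentiableAt_atlas (chart_mem_atlas E2 x'.2) (mem_chart_source E2 x'.2)).comp x'
      mdifferentiableAt_snd
  have h := mfderiv_comp y hd hs
  have e : ((fun y : SphereTorus L => chartAt E2 x'.2 y.2) ∘ (extChartAt IST x).symm)
      =ᶠ[𝓝 y] fun y' => y'.2 + (chartAt E2 x'.2 x'.2 - y.2) := by
    have hx2 : x'.2 = QuotientAddGroup.mk y.2 := extChartAt_symm_snd L x y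
    have hcont : Continuous fun z : E2 => (QuotientAddGroup.mk z : Torus L) :=
      QuotientAddGroup.continuous_mk
    have h1 := eventually_sub_eq L (X := E2) (x := y.2)
      (a := fun z => chartAt E2 x'.2 (QuotientAddGroup.mk z)) (b := id)
      ((chartAt E2 x'.2).open_source.preimage hcont)
      (by rw [mem_preimage, ← hx2]; exact mem_chart_source E2 x'.2)
      ((chartAt E2 x'.2).continuousOn.comp hcont.continuousOn fun z hz => hz) continuousOn_id
      (fun z hz => mk_of_mem_atlas L (chart_mem_atlas E2 x'.2) hz)
    filter_upwards [continuous_snd.continuousAt.eventually h1] with y' hy'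
    simp only [Function.comp_apply]
    refine (congrArg (chartAt E2 x'.2) (extChartAt_symm_snd L x y')).trans (hy'.trans ?_)
    rw [hx2]; rfl
  rw [e.mfderiv_eq, mfderiv_eq_fderiv, fderiv_add_const, fderiv_snd] at h
  exact (congrArg (fun A => A v) h).symm

theorem chartMetric_metric (c : E2 →ₗ[ℝ] Matrix (Fin 3) (Fin 3) ℝ) {x : SphereTorus L}
    {y : E2 × E2} {P : E2 → E3}
    (hP : ∀ u, ((extChartAt (𝓡 2) x.1).symm u : E3) = P u) (hPd : DifferentiableAt ℝ P y.1)
    (hy : y.2 ∈ (chartAt E2 x.2).target) :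
    chartMetric (metric L c) x y = modelMetric c P y := by
  refine ContinuousLinearMap.ext fun v => ContinuousLinearMap.ext fun w => ?_
  have h1 := dSphere_comp_mfderiv_symm L hP hPd hy
  have h2 := dTorus_comp_mfderiv_symm L hy
  have h3 : (((extChartAt IST x).symm y).1 : E3) = P y.1 := by rw [extChartAt_symm_fst, hP]
  have h4 : ∀ v : E2 × E2, connectionForm L c ((extChartAt IST x).symm y)
      (mfderiv 𝓘(ℝ, E2 × E2) IST (extChartAt IST x).symm y v)
      = oneForm c (P y.1) (fderiv ℝ P y.1 v.1) + v.2 := by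
    intro v
    change oneForm c (((extChartAt IST x).symm y).1 : E3) (dSphere L ((extChartAt IST x).symm y)
        (mfderiv 𝓘(ℝ, E2 × E2) IST (extChartAt IST x).symm y v))
      + dTorus L ((extChartAt IST x).symm y)
        (mfderiv 𝓘(ℝ, E2 × E2) IST (extChartAt IST x).symm y v) = _
    rw [h1 v, h2 v, h3]
  refine (congrArg₂ (· + ·) (congrArg₂ (inner ℝ) (h1 v) (h1 w))
    (congrArg₂ (inner ℝ) (h4 v) (h4 w)) :)

theorem eventually_snd_mem_target (x : SphereTorus L) :
    ∀ᶠ y in 𝓝 (extChartAt IST x x), y.2 ∈ (chartAt E2 x.2).target := by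
  refine continuous_snd.continuousAt.eventually ((chartAt E2 x.2).open_target.mem_nhds ?_)
  rw [extChartAt_prod]
  exact (chartAt E2 x.2).map_source (mem_chart_source E2 x.2)
end Charts

/-! ### The 2-jet at the origin of the inverse stereographic projection -/

section Stereographic

set_option maxSynthPendingDepth 5

/-- The factor `(‖u‖² + 4)⁻¹` in the inverse of the stereographic projection. -/
def stereoFactor (u : E2) : ℝ := (‖u‖ ^ 2 + 4)⁻¹

theorem stereoFactor_pos (u : E2) : 0 < stereoFactor u := by unfold stereoFactor; positivity

theorem stereoFactor_zero : stereoFactor 0 = 4⁻¹ := by simp [stereoFactor]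

theorem hasFDerivAt_stereoFactor (u : E2) :
    HasFDerivAt stereoFactor ((-2 * stereoFactor u ^ 2) • innerSL ℝ u) u := by
  have h := ((hasStrictFDerivAt_norm_sq u).hasFDerivAt.add_const (4 : ℝ))
  have h2 := (hasDerivAt_inv (x := ‖u‖ ^ 2 + 4) (by positivity)).comp_hasFDerivAt u h
  refine h2.congr_fderiv ?_
  ext v
  simp [stereoFactor]
  ring

theorem fderiv_stereoFactor :
    fderiv ℝ stereoFactor = fun u => (-2 * stereoFactor u ^ 2) • innerSL ℝ u :=
  funext fun u => (hasFDerivAt_stereoFactor u).fderiv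

/-- The factor ⟨u, ·⟩ vanishes at the origin, so only the value 4⁻¹ of the scalar factor there
survives. It is needed for the pairs (-64, 3) and (-2, 2). -/
theorem hasFDerivAt_innerSL_pow (k : ℝ) (m : ℕ) :
    HasFDerivAt (fun u : E2 => (k * stereoFactor u ^ m) • (innerSL ℝ u : E2 →L[ℝ] ℝ))
      ((k * 4⁻¹ ^ m) • (innerSL ℝ : E2 →L[ℝ] E2 →L[ℝ] ℝ)) 0 := by
  have h := ((hasFDerivAt_stereoFactor 0).pow m).const_mul k
  have h2 := h.smul ((innerSL ℝ : E2 →L[ℝ] E2 →L[ℝ] ℝ).hasFDerivAt (x := 0))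
  refine h2.congr_fderiv ?_
  ext u v
  simp [stereoFactor_zero]

/-- The conformal factor of the inverse of the stereographic projection. -/
def conformalFactor (u : E2) : ℝ := 16 * stereoFactor u ^ 2

theorem conformalFactor_pos (u : E2) : 0 < conformalFactor u := by
  have := stereoFactor_pos u
  unfold conformalFactor; positivity

theorem conformalFactor_zero : conformalFactor 0 = 1 := by
  simp [conformalFactor, stereoFactor_zero]; norm_num

theorem fderiv_conformalFactor :
    fderiv ℝ conformalFactor = fun u => (-64 * stereoFactor u ^ 3) • innerSL ℝ u := by
  funext u
  have h := ((hasFDerivAt_stereoFactor u).pow 2).const_mul 16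
  refine (h.congr_fderiv ?_).fderiv
  ext v
  simp
  ring

theorem fderiv_conformalFactor_zero : fderiv ℝ conformalFactor 0 = 0 := by
  simp [fderiv_conformalFactor]

/-- The coefficient is -64 / 4³ = -1; it is the source of the Gauss curvature 1 of the sphere. -/
theorem fderiv_fderiv_conformalFactor_zero (s t : E2) :
    fderiv ℝ (fderiv ℝ conformalFactor) 0 s t = -inner ℝ s t := by
  rw [fderiv_conformalFactor, (hasFDerivAt_innerSL_pow (-64) 3).fderiv]
  simp; norm_num
  rfl

theorem contDiff_stereoFactor : ContDiff ℝ ∞ stereoFactor := by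
  unfold stereoFactor
  exact ContDiff.inv ((contDiff_norm_sq ℝ).add contDiff_const) fun u => by positivity

theorem contDiff_conformalFactor : ContDiff ℝ ∞ conformalFactor :=
  contDiff_const.mul (contDiff_stereoFactor.pow 2)

variable (ι : E2 →ₗᵢ[ℝ] E3) (p : E3)

/-- Subtracting p takes ‖u‖² out of the numerator, so that u enters only through ι u and one scalar
factor. -/
theorem invStereo_eq (u : E2) :
    invStereo ι p u = stereoFactor u • ((4 : ℝ) • ι u + (8 : ℝ) • p) - p := by
  have h : ‖u‖ ^ 2 + 4 ≠ 0 := by positivity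
  have h2 : stereoFactor u • (‖u‖ ^ 2 + 4) • p = p := by
    rw [stereoFactor, smul_smul, inv_mul_cancel₀ h, one_smul]
  calc invStereo ι p u
      = stereoFactor u • ((4 : ℝ) • ι u + (8 : ℝ) • p) - stereoFactor u • (‖u‖ ^ 2 + 4) • p := by
        change stereoFactor u • _ = _
        module
    _ = _ := by rw [h2]

theorem invStereo_zero : invStereo ι p 0 = p := by
  rw [invStereo_eq, stereoFactor_zero, map_zero]; module

theorem hasFDerivAt_invStereo (u : E2) : HasFDerivAt (invStereo ι p)
    (stereoFactor u • (4 : ℝ) • ι.toContinuousLinearMap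
      + (fderiv ℝ stereoFactor u).smulRight ((4 : ℝ) • ι u + (8 : ℝ) • p)) u := by
  have h1 : HasFDerivAt (fun u => (4 : ℝ) • ι u + (8 : ℝ) • p)
      ((4 : ℝ) • ι.toContinuousLinearMap) u :=
    (ι.toContinuousLinearMap.hasFDerivAt.const_smul (4 : ℝ)).add_const _
  have h := ((hasFDerivAt_stereoFactor u).smul h1).sub_const p
  rw [fderiv_stereoFactor]
  exact h.congr_of_eventuallyEq (Filter.Eventually.of_forall fun u => invStereo_eq ι p u)

theorem fderiv_invStereo_apply (u v : E2) : fderiv ℝ (invStereo ι p) u v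
    = (4 * stereoFactor u) • ι v
      + (-2 * stereoFactor u ^ 2 * inner ℝ u v) • ((4 : ℝ) • ι u + (8 : ℝ) • p) := by
  rw [(hasFDerivAt_invStereo ι p u).fderiv, fderiv_stereoFactor]
  simp [smul_smul, mul_comm]

theorem fderiv_invStereo_zero (v : E2) : fderiv ℝ (invStereo ι p) 0 v = ι v := by
  rw [fderiv_invStereo_apply, stereoFactor_zero]; simp

/-- This is the second fundamental form of the unit sphere: the second derivative at the centre is
purely radial. -/
theorem fderiv_fderiv_invStereo_zero (s t : E2) :
    fderiv ℝ (fderiv ℝ (invStereo ι p)) 0 s t = -(inner ℝ s t) • p := by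
  have hd : HasFDerivAt (fderiv ℝ (invStereo ι p)) (fderiv ℝ (fderiv ℝ (invStereo ι p)) 0) 0 :=
    (((contDiff_invStereo ι p).fderiv_right (m := ∞) (by norm_cast)).differentiable
      (by simp) 0).hasFDerivAt
  have h := hd.clm_apply (hasFDerivAt_const t 0)
  have h0 : HasFDerivAt (fun u : E2 => (-2 * stereoFactor u ^ 2) * inner ℝ u t)
      (((-2 * 4⁻¹ ^ 2 : ℝ) • (innerSL ℝ : E2 →L[ℝ] E2 →L[ℝ] ℝ)).flip t) 0 := by
    have := (hasFDerivAt_innerSL_pow (-2) 2).clm_apply (hasFDerivAt_const t 0)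
    refine this.congr_fderiv ?_
    ext v; simp; rfl
  have h1 : HasFDerivAt (fun u => (4 : ℝ) • ι u + (8 : ℝ) • p)
      ((4 : ℝ) • ι.toContinuousLinearMap) 0 :=
    (ι.toContinuousLinearMap.hasFDerivAt.const_smul (4 : ℝ)).add_const _
  have h2 := ((((hasFDerivAt_stereoFactor 0).const_mul 4).smul_const (ι t))).add (h0.smul h1)
  have he : (fun u => fderiv ℝ (invStereo ι p) u t) = fun u => (4 * stereoFactor u) • ι t
      + (-2 * stereoFactor u ^ 2 * inner ℝ u t) • ((4 : ℝ) • ι u + (8 : ℝ) • p) :=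
    funext fun u => fderiv_invStereo_apply ι p u t
  rw [he] at h
  have := congrArg (fun A => A s) (h.unique h2)
  simp at this
  rw [this, smul_smul]
  norm_num
  ring_nf

variable {ι p}

theorem inner_fderiv_invStereo (hι : ∀ u, inner ℝ (ι u) p = 0) (hp : ‖p‖ = 1) (u v w : E2) :
    inner ℝ (fderiv ℝ (invStereo ι p) u v) (fderiv ℝ (invStereo ι p) u w)
      = conformalFactor u * inner ℝ v w := by
  have h1 : ∀ v w, inner ℝ (ι v) (ι w) = inner ℝ v w := ι.inner_map_map
  have hι' : ∀ u, inner ℝ p (ι u) = 0 := fun u => by rw [real_inner_comm, hι]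
  have hpp : inner ℝ p p = 1 := by rw [real_inner_self_eq_norm_sq, hp]; norm_num
  -- The defining relation (‖u‖² + 4) s = 1 of the factor s, solved for ‖u‖² s.
  have hu : inner ℝ u u * stereoFactor u = 1 - 4 * stereoFactor u := by
    rw [real_inner_self_eq_norm_sq, stereoFactor]
    field_simp; ring
  rw [fderiv_invStereo_apply, fderiv_invStereo_apply]
  simp only [inner_add_left, inner_add_right, real_inner_smul_left, real_inner_smul_right, h1, hι,
    hι', hpp, conformalFactor]
  rw [real_inner_comm u v]
  linear_combination (64 * stereoFactor u ^ 3 * inner ℝ u v * inner ℝ u w) * hu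

end Stereographic

/-! ### First and second derivatives of the metric in stereographic coordinates -/

section ModelMetric

set_option maxSynthPendingDepth 5

variable {c : E2 →ₗ[ℝ] Matrix (Fin 3) (Fin 3) ℝ} {ι : E2 →ₗᵢ[ℝ] E3} {p : E3}

/-- The one-form `λ` in stereographic coordinates. -/
def chartForm (c : E2 →ₗ[ℝ] Matrix (Fin 3) (Fin 3) ℝ) (ι : E2 →ₗᵢ[ℝ] E3) (p : E3) (u : E2) :
    E2 →L[ℝ] E2 :=
  oneForm c (invStereo ι p u) ∘L fderiv ℝ (invStereo ι p) u

theorem contDiff_chartForm : ContDiff ℝ ∞ (chartForm c ι p) :=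
  ((contDiff_oneForm c).comp (contDiff_invStereo ι p)).clm_comp
    ((contDiff_invStereo ι p).fderiv_right (m := ∞) (by norm_cast))

theorem modelMetric_invStereo_apply (hι : ∀ u, inner ℝ (ι u) p = 0) (hp : ‖p‖ = 1)
    (y v w : E2 × E2) :
    modelMetric c (invStereo ι p) y v w = conformalFactor y.1 * inner ℝ v.1 w.1
      + inner ℝ (chartForm c ι p y.1 v.1 + v.2) (chartForm c ι p y.1 w.1 + w.2) := by
  rw [modelMetric_apply, inner_fderiv_invStereo hι hp]; rfl

theorem contDiff_modelMetric : ContDiff ℝ ∞ (modelMetric c (invStereo ι p)) := by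
  have hP := contDiff_invStereo ι p
  have hfd : ContDiff ℝ ∞ (fderiv ℝ (invStereo ι p)) := hP.fderiv_right (m := ∞) (by norm_cast)
  have h1 : ContDiff ℝ ∞ fun y : E2 × E2 =>
      fderiv ℝ (invStereo ι p) y.1 ∘L ContinuousLinearMap.fst ℝ E2 E2 :=
    (hfd.comp contDiff_fst).clm_comp contDiff_const
  have h2 : ContDiff ℝ ∞ fun y : E2 × E2 => oneForm c (invStereo ι p y.1)
      ∘L fderiv ℝ (invStereo ι p) y.1 ∘L ContinuousLinearMap.fst ℝ E2 E2
        + ContinuousLinearMap.snd ℝ E2 E2 :=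
    (((contDiff_oneForm c).comp (hP.comp contDiff_fst)).clm_comp h1).add contDiff_const
  have hp : ∀ {F : Type} [NormedAddCommGroup F] [InnerProductSpace ℝ F]
      {B : E2 × E2 → E2 × E2 →L[ℝ] F}, ContDiff ℝ ∞ B →
      ContDiff ℝ ∞ fun y => pullbackForm (innerSL ℝ) (B y) := by
    intro F _ _ B hB
    have h3 : ContDiff ℝ ∞ fun y => ContinuousLinearMap.precomp ℝ (B y) :=
      (ContinuousLinearMap.contDiff
        ((ContinuousLinearMap.compL ℝ (E2 × E2) F ℝ).flip)).comp hB
    exact h3.clm_comp (contDiff_const.clm_comp hB)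
  exact (hp h1).add (hp h2)

theorem isRiemannianNear_modelMetric (hι : ∀ u, inner ℝ (ι u) p = 0) (hp : ‖p‖ = 1)
    (y : E2 × E2) : IsRiemannianNear (modelMetric c (invStereo ι p)) y := by
  refine ⟨.of_forall fun y => contDiff_modelMetric.contDiffAt, .of_forall fun y v w => ?_,
    .of_forall fun y v hv => ?_⟩
  · rw [modelMetric_apply, modelMetric_apply, real_inner_comm,
      real_inner_comm (oneForm c (invStereo ι p y.1) (fderiv ℝ (invStereo ι p) y.1 v.1) + v.2)]
  · rw [modelMetric_invStereo_apply hι hp]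
    have h1 := conformalFactor_pos y.1
    by_contra! h
    have h2 := real_inner_self_nonneg (x := v.1)
    have h3 := real_inner_self_nonneg (x := chartForm c ι p y.1 v.1 + v.2)
    have h4 : inner ℝ v.1 v.1 = 0 := by
      have := mul_nonneg h1.le h2
      have : conformalFactor y.1 * inner ℝ v.1 v.1 = 0 := by linarith
      exact (mul_eq_zero.1 this).resolve_left h1.ne'
    have h5 : inner ℝ (chartForm c ι p y.1 v.1 + v.2) (chartForm c ι p y.1 v.1 + v.2) = 0 := by
      rw [h4] at h; linarith
    have e1 : v.1 = 0 := inner_self_eq_zero (𝕜 := ℝ).1 h4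
    have e2 := inner_self_eq_zero (𝕜 := ℝ).1 h5
    rw [e1, map_zero, zero_add] at e2
    exact hv (Prod.ext e1 e2)

theorem fderiv_modelMetric (hι : ∀ u, inner ℝ (ι u) p = 0) (hp : ‖p‖ = 1)
    (y s v w : E2 × E2) :
    fderiv ℝ (modelMetric c (invStereo ι p)) y s v w
      = fderiv ℝ conformalFactor y.1 s.1 * inner ℝ v.1 w.1
        + (inner ℝ (chartForm c ι p y.1 v.1 + v.2) (fderiv ℝ (chartForm c ι p) y.1 s.1 w.1)
        + inner ℝ (fderiv ℝ (chartForm c ι p) y.1 s.1 v.1) (chartForm c ι p y.1 w.1 + w.2)) := by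
  have hL := (((contDiff_modelMetric (c := c) (ι := ι) (p := p)).differentiable
    (by simp) y).hasFDerivAt.clm_apply (hasFDerivAt_const v y)).clm_apply (hasFDerivAt_const w y)
  have hρ : HasFDerivAt (fun y : E2 × E2 => conformalFactor y.1) _ y :=
    (contDiff_conformalFactor.differentiable (by simp) y.1).hasFDerivAt.comp y hasFDerivAt_fst
  have hA : HasFDerivAt (fun y : E2 × E2 => chartForm c ι p y.1) _ y :=
    (contDiff_chartForm.differentiable (by simp) y.1).hasFDerivAt.comp y hasFDerivAt_fst
  have hω := fun a : E2 × E2 => (hA.clm_apply (hasFDerivAt_const a.1 y)).add_const a.2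
  have hR := (hρ.mul_const (inner ℝ v.1 w.1)).add ((hω v).inner ℝ (hω w))
  have he : (fun y => modelMetric c (invStereo ι p) y v w) = _ :=
    funext fun y => modelMetric_invStereo_apply hι hp y v w
  rw [he] at hL
  have := congrArg (fun A => A s) (hL.unique hR)
  simpa [mul_comm] using this

theorem fderiv_fderiv_modelMetric (hι : ∀ u, inner ℝ (ι u) p = 0) (hp : ‖p‖ = 1)
    (y t s v w : E2 × E2) :
    fderiv ℝ (fderiv ℝ (modelMetric c (invStereo ι p))) y t s v w
      = fderiv ℝ (fderiv ℝ conformalFactor) y.1 t.1 s.1 * inner ℝ v.1 w.1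
        + ((inner ℝ (chartForm c ι p y.1 v.1 + v.2)
            (fderiv ℝ (fderiv ℝ (chartForm c ι p)) y.1 t.1 s.1 w.1)
          + inner ℝ (fderiv ℝ (chartForm c ι p) y.1 t.1 v.1)
            (fderiv ℝ (chartForm c ι p) y.1 s.1 w.1))
        + (inner ℝ (fderiv ℝ (chartForm c ι p) y.1 s.1 v.1)
            (fderiv ℝ (chartForm c ι p) y.1 t.1 w.1)
          + inner ℝ (fderiv ℝ (fderiv ℝ (chartForm c ι p)) y.1 t.1 s.1 v.1)
            (chartForm c ι p y.1 w.1 + w.2))) := by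
  have hL := ((((contDiff_modelMetric (c := c) (ι := ι) (p := p)).fderiv_right (m := ∞)
    (by norm_cast)).differentiable (by simp) y).hasFDerivAt.clm_apply
      (hasFDerivAt_const s y)).clm_apply (hasFDerivAt_const v y) |>.clm_apply (hasFDerivAt_const w y)
  have hρ : HasFDerivAt (fun y : E2 × E2 => fderiv ℝ conformalFactor y.1) _ y :=
    ((contDiff_conformalFactor.fderiv_right (m := ∞) (by norm_cast)).differentiable
      (by simp) y.1).hasFDerivAt.comp y hasFDerivAt_fst
  have hA : HasFDerivAt (fun y : E2 × E2 => chartForm c ι p y.1) _ y :=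
    (contDiff_chartForm.differentiable (by simp) y.1).hasFDerivAt.comp y hasFDerivAt_fst
  have hA' : HasFDerivAt (fun y : E2 × E2 => fderiv ℝ (chartForm c ι p) y.1) _ y :=
    (((contDiff_chartForm (c := c) (ι := ι) (p := p)).fderiv_right (m := ∞)
      (by norm_cast)).differentiable (by simp) y.1).hasFDerivAt.comp y hasFDerivAt_fst
  have hω := fun a : E2 × E2 => (hA.clm_apply (hasFDerivAt_const a.1 y)).add_const a.2
  have hω' := fun a : E2 × E2 =>
    (hA'.clm_apply (hasFDerivAt_const s.1 y)).clm_apply (hasFDerivAt_const a.1 y)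
  have hR := ((hρ.clm_apply (hasFDerivAt_const s.1 y)).mul_const (inner ℝ v.1 w.1)).add
    (((hω v).inner ℝ (hω' w)).add ((hω' v).inner ℝ (hω w)))
  have he : (fun y => fderiv ℝ (modelMetric c (invStereo ι p)) y s v w) = _ :=
    funext fun y => fderiv_modelMetric hι hp y s v w
  rw [he] at hL
  have := congrArg (fun A => A t) (hL.unique hR)
  simpa [mul_comm] using this

theorem chartForm_zero (u : E2) : chartForm c ι p 0 u = oneForm c p (ι u) := by
  rw [chartForm, ContinuousLinearMap.comp_apply, invStereo_zero, fderiv_invStereo_zero]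

/-- The last term comes from the radial second derivative of the parametrisation; it vanishes
because λ_p(p) = 0. -/
theorem fderiv_chartForm_zero (s t : E2) : fderiv ℝ (chartForm c ι p) 0 s t
    = fderiv ℝ (oneForm c) p (ι s) (ι t) - inner ℝ s t • oneForm c p p := by
  have hP : HasFDerivAt (invStereo ι p) (fderiv ℝ (invStereo ι p) 0) 0 :=
    ((contDiff_invStereo ι p).differentiable (by simp) 0).hasFDerivAt
  have hP' : HasFDerivAt (fderiv ℝ (invStereo ι p)) (fderiv ℝ (fderiv ℝ (invStereo ι p)) 0) 0 :=
    (((contDiff_invStereo ι p).fderiv_right (m := ∞) (by norm_cast)).differentiable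
      (by simp) 0).hasFDerivAt
  have hc : HasFDerivAt (oneForm c) (fderiv ℝ (oneForm c) (invStereo ι p 0)) (invStereo ι p 0) :=
    ((contDiff_oneForm c).differentiable (by simp) _).hasFDerivAt
  have h : HasFDerivAt (chartForm c ι p) _ 0 := (hc.comp 0 hP).clm_comp hP'
  rw [h.fderiv]
  simp [invStereo_zero, fderiv_invStereo_zero, fderiv_fderiv_invStereo_zero]
  abel

end ModelMetric

/-! ### Locality of the tensors, and Christoffel symbols in an orthonormal basis -/

section Congruence

set_option linter.unusedSectionVars false

variable {E : Type*} [NormedAddCommGroup E] [NormedSpace ℝ E] [FiniteDimensional ℝ E]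
  {g g' : E → E →L[ℝ] E →L[ℝ] ℝ} {x : E}

theorem christoffel_congr (h : g =ᶠ[𝓝 x] g') (u v : E) :
    christoffel g x u v = christoffel g' x u v := by
  rw [christoffel, christoffel, h.fderiv_eq, h.eq_of_nhds]

theorem scalarCurvatureAt_congr (h : g =ᶠ[𝓝 x] g') :
    scalarCurvatureAt g x = scalarCurvatureAt g' x := by
  have h1 : ∀ v w, (fun y => christoffel g y v w) =ᶠ[𝓝 x] fun y => christoffel g' y v w :=
    fun v w => h.eventuallyEq_nhds.mono fun y hy => christoffel_congr hy v w
  have h2 : ricci g x = ricci g' x := by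
    funext v w
    unfold ricci riemann
    simp only [(h1 _ _).fderiv_eq, christoffel_congr h]
  rw [scalarCurvatureAt, scalarCurvatureAt, h2, h.eq_of_nhds]

theorem hessian_congr {f f' : E → ℂ} (h : g =ᶠ[𝓝 x] g') (hf : f =ᶠ[𝓝 x] f') :
    hessian g f x = hessian g' f' x := by
  funext u v
  have h1 : (fun y => fderiv ℝ f y v) =ᶠ[𝓝 x] fun y => fderiv ℝ f' y v :=
    hf.eventuallyEq_nhds.mono fun y hy => by
      simp only [hy.fderiv_eq]
  rw [hessian, hessian, h1.fderiv_eq, hf.fderiv_eq, christoffel_congr h]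

theorem IsRiemannianNear.christoffel_eq_sum (hg : IsRiemannianNear g x)
    {ι : Type*} [Fintype ι] [DecidableEq ι]
    (o : Basis ι ℝ E) (ho : ∀ i j, g x (o i) (o j) = if i = j then 1 else 0) (a b : E) :
    christoffel g x a b = ∑ k, koszul g x a b (o k) • o k := by
  conv_lhs => rw [← o.sum_repr (christoffel g x a b)]
  refine Finset.sum_congr rfl fun k _ => ?_
  have := congrArg (fun z => g x z (o k)) (o.sum_repr (christoffel g x a b))
  simp only [map_sum, map_smul, sum_apply, smul_apply, ho, hg.inner_christoffel] at this
  congr 1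
  simpa using this

theorem IsRiemannianNear.inner_christoffel_christoffel (hg : IsRiemannianNear g x)
    {ι : Type*} [Fintype ι] [DecidableEq ι]
    (o : Basis ι ℝ E) (ho : ∀ i j, g x (o i) (o j) = if i = j then 1 else 0) (a b c d : E) :
    g x (christoffel g x a b) (christoffel g x c d)
      = ∑ k, koszul g x a b (o k) * koszul g x c d (o k) := by
  rw [hg.christoffel_eq_sum o ho c d, map_sum]
  simp [hg.inner_christoffel, mul_comm]

end Congruence

/-! ### The scalar curvature at the centre of a stereographic chart -/

section Curvature

set_option maxSynthPendingDepth 5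

variable {c : E2 →ₗ[ℝ] Matrix (Fin 3) (Fin 3) ℝ} {ι : E2 →ₗᵢ[ℝ] E3} {p : E3}

/-- The basis `(eᵢ, -A eᵢ)`, `(0, eₐ)` of `ℝ² × ℝ²`. -/
def shearBasis (A : E2 →L[ℝ] E2) : Basis (Fin 2 ⊕ Fin 2) ℝ (E2 × E2) :=
  ((EuclideanSpace.basisFun (Fin 2) ℝ).toBasis.prod (EuclideanSpace.basisFun (Fin 2) ℝ).toBasis).map
    ((LinearEquiv.refl ℝ E2).skewProd (LinearEquiv.refl ℝ E2) (-(A : E2 →ₗ[ℝ] E2)))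

theorem shearBasis_inl (A : E2 →L[ℝ] E2) (i : Fin 2) :
    shearBasis A (Sum.inl i) = (EuclideanSpace.single i 1, -A (EuclideanSpace.single i 1)) := by
  simp [shearBasis]

theorem shearBasis_inr (A : E2 →L[ℝ] E2) (i : Fin 2) :
    shearBasis A (Sum.inr i) = (0, EuclideanSpace.single i 1) := by
  simp [shearBasis]

theorem shearBasis_orthonormal (hι : ∀ u, inner ℝ (ι u) p = 0) (hp : ‖p‖ = 1) (z : E2)
    (i j : Fin 2 ⊕ Fin 2) :
    modelMetric c (invStereo ι p) (0, z) (shearBasis (chartForm c ι p 0) i)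
      (shearBasis (chartForm c ι p 0) j) = if i = j then 1 else 0 := by
  rw [modelMetric_invStereo_apply hι hp]
  rcases i with i | i <;> rcases j with j | j <;>
    simp [shearBasis_inl, shearBasis_inr, conformalFactor_zero, EuclideanSpace.inner_single_left]

/-- The partial derivatives `∂ᵢ A_{ja}` of the one-form `λ` at the origin. -/
def formDeriv (c : E2 →ₗ[ℝ] Matrix (Fin 3) (Fin 3) ℝ) (ι : E2 →ₗᵢ[ℝ] E3) (p : E3)
    (i j a : Fin 2) : ℝ :=
  fderiv ℝ (chartForm c ι p) 0 (EuclideanSpace.single i 1) (EuclideanSpace.single j 1) a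

/-- The Christoffel symbols of the first kind of `g_λ` in the basis `shearBasis`. -/
def koszulTable (α : Fin 2 → Fin 2 → Fin 2 → ℝ) : Fin 2 ⊕ Fin 2 → Fin 2 ⊕ Fin 2 → Fin 2 ⊕ Fin 2 → ℝ
  | .inl i, .inl j, .inr a => 2⁻¹ * (α i j a + α j i a)
  | .inl i, .inr a, .inl j => 2⁻¹ * (α i j a - α j i a)
  | .inr a, .inl i, .inl j => 2⁻¹ * (α i j a - α j i a)
  | _, _, _ => 0

/-- At the origin the conformal factor has no first derivative and the connection form kills the
horizontal basis vectors. Only first derivatives of λ paired with exactly one vertical vector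
survive. -/
theorem koszul_modelMetric (hι : ∀ u, inner ℝ (ι u) p = 0) (hp : ‖p‖ = 1) (z : E2)
    (i j k : Fin 2 ⊕ Fin 2) :
    koszul (modelMetric c (invStereo ι p)) (0, z) (shearBasis (chartForm c ι p 0) i)
      (shearBasis (chartForm c ι p 0) j) (shearBasis (chartForm c ι p 0) k)
      = koszulTable (formDeriv c ι p) i j k := by
  rw [koszul_apply, fderiv_modelMetric hι hp, fderiv_modelMetric hι hp, fderiv_modelMetric hι hp]
  rcases i with i | i <;> rcases j with j | j <;> rcases k with k | k <;>
    simp [shearBasis_inl, shearBasis_inr, fderiv_conformalFactor_zero, koszulTable, formDeriv,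
      EuclideanSpace.inner_single_left, EuclideanSpace.inner_single_right]

/-- The Hessian of the conformal factor contributes the 2 of the round sphere. Second derivatives of
λ are paired with the connection form of horizontal vectors, which is zero, or are evaluated on a
vertical vector, and so drop out. The products of first derivatives combine into the squared
curvature of the torus bundle. -/
theorem scalarCurvatureAt_modelMetric (hι : ∀ u, inner ℝ (ι u) p = 0) (hp : ‖p‖ = 1) (z : E2) :
    scalarCurvatureAt (modelMetric c (invStereo ι p)) (0, z)
      = 2 - 2⁻¹ * ∑ a, (formDeriv c ι p 0 1 a - formDeriv c ι p 1 0 a) ^ 2 := by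
  have hg := isRiemannianNear_modelMetric (c := c) hι hp (0, z)
  have ho := shearBasis_orthonormal (c := c) hι hp z
  rw [scalarCurvatureAt_eq_sum hg _ ho]
  simp_rw [hg.inner_riemann, hg.inner_christoffel_christoffel _ ho, koszul_modelMetric hι hp,
    fderiv_fderiv_modelMetric hι hp]
  simp only [Fintype.sum_sum_type, Fin.sum_univ_two, koszulTable, shearBasis_inl, shearBasis_inr]
  simp [fderiv_fderiv_conformalFactor_zero, PiLp.inner_apply, Fin.sum_univ_two, formDeriv,
    EuclideanSpace.real_norm_sq_eq]
  ring

end Curvature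

/-! ### Algebra of the one-form λ -/

section OneForm

variable (c : E2 →ₗ[ℝ] Matrix (Fin 3) (Fin 3) ℝ)

theorem oneForm_apply (x X : E3) (a : Fin 2) :
    oneForm c x X a = ((c (EuclideanSpace.single a 1) *ᵥ x.ofLp) ⨯₃ x.ofLp) ⬝ᵥ X.ofLp := by
  have h := oneForm_inner c x X (EuclideanSpace.single a 1)
  rw [EuclideanSpace.inner_single_right] at h
  simpa [PiLp.inner_apply, dotProduct, mul_comm] using h

theorem oneForm_self (x : E3) : oneForm c x x = 0 := by
  ext a
  rw [oneForm_apply, dotProduct_comm, dot_cross_self]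
  rfl

/-- λ is quadratic in the base point, so along x + t s it is a polynomial in t, and the derivative
is its linear coefficient. -/
theorem fderiv_oneForm_apply (x s X : E3) (a : Fin 2) :
    fderiv ℝ (oneForm c) x s X a
      = ((c (EuclideanSpace.single a 1) *ᵥ s.ofLp) ⨯₃ x.ofLp
        + (c (EuclideanSpace.single a 1) *ᵥ x.ofLp) ⨯₃ s.ofLp) ⬝ᵥ X.ofLp := by
  obtain ⟨M, hM⟩ : ∃ M, M = c (EuclideanSpace.single a 1) := ⟨_, rfl⟩
  rw [← hM]
  have h0 : HasFDerivAt (oneForm c) (fderiv ℝ (oneForm c) x) (x + (0 : ℝ) • s) := by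
    rw [zero_smul, add_zero]
    exact ((contDiff_oneForm c).differentiable (by simp) x).hasFDerivAt
  have hl : HasDerivAt (fun t : ℝ => x + t • s) s 0 := by
    simpa using ((hasDerivAt_id (0 : ℝ)).smul_const s).const_add x
  let T : (E3 →L[ℝ] E2) →L[ℝ] ℝ :=
    (EuclideanSpace.proj a : E2 →L[ℝ] ℝ) ∘L ContinuousLinearMap.apply ℝ E2 X
  have h2 : HasDerivAt (fun t : ℝ => (oneForm c (x + t • s) X) a)
      (fderiv ℝ (oneForm c) x s X a) 0 := by
    have h5 := (T.hasFDerivAt (x := oneForm c (x + (0 : ℝ) • s))).comp (x + (0 : ℝ) • s) h0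
    have h6 := h5.comp_hasDerivAt (0 : ℝ) hl
    exact h6
  have he : (fun t : ℝ => (oneForm c (x + t • s) X) a) = fun t : ℝ =>
      ((M *ᵥ x.ofLp) ⨯₃ x.ofLp) ⬝ᵥ X.ofLp
      + t * (((M *ᵥ s.ofLp) ⨯₃ x.ofLp + (M *ᵥ x.ofLp) ⨯₃ s.ofLp) ⬝ᵥ X.ofLp)
      + t ^ 2 * (((M *ᵥ s.ofLp) ⨯₃ s.ofLp) ⬝ᵥ X.ofLp) := by
    funext t
    rw [oneForm_apply, ← hM]
    simp only [WithLp.ofLp_add, WithLp.ofLp_smul, Matrix.mulVec_add, Matrix.mulVec_smul, map_add,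
      map_smul, LinearMap.add_apply, LinearMap.smul_apply, add_dotProduct, smul_dotProduct,
      smul_eq_mul]
    ring
  have h3 : HasDerivAt (fun t : ℝ => (oneForm c (x + t • s) X) a)
      (((M *ᵥ s.ofLp) ⨯₃ x.ofLp + (M *ᵥ x.ofLp) ⨯₃ s.ofLp) ⬝ᵥ X.ofLp) 0 := by
    rw [he]
    generalize ((M *ᵥ x.ofLp) ⨯₃ x.ofLp) ⬝ᵥ X.ofLp = A
    generalize ((M *ᵥ s.ofLp) ⨯₃ x.ofLp + (M *ᵥ x.ofLp) ⨯₃ s.ofLp) ⬝ᵥ X.ofLp = B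
    generalize ((M *ᵥ s.ofLp) ⨯₃ s.ofLp) ⬝ᵥ X.ofLp = C
    have h4 : HasDerivAt (fun t : ℝ => A + t * B + t ^ 2 * C) (1 * B + 2 * 0 ^ 1 * 1 * C) 0 :=
      (((hasDerivAt_id (0 : ℝ)).mul_const B).const_add A).add
        (((hasDerivAt_id (0 : ℝ)).pow 2).mul_const C)
    simpa using h4
  exact h2.unique h3

variable {c}

/-- The two terms containing M q each give det(v, w, Mq). The other two give -det(Mv, w, q) - det(v,
Mw, q) = det(v, w, Mq) - tr(M) det(v, w, q), a third copy since the trace vanishes. This computes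
dλ. -/
theorem cross_mulVec_alternating {M : Matrix (Fin 3) (Fin 3) ℝ} (hs : M.IsSymm)
    (ht : M.trace = 0) (v w q : Fin 3 → ℝ) :
    ((M *ᵥ v) ⨯₃ q + (M *ᵥ q) ⨯₃ v) ⬝ᵥ w - ((M *ᵥ w) ⨯₃ q + (M *ᵥ q) ⨯₃ w) ⬝ᵥ v
      = 3 * ((v ⨯₃ w) ⬝ᵥ (M *ᵥ q)) := by
  have h1 := hs.apply 0 1
  have h2 := hs.apply 0 2
  have h3 := hs.apply 1 2
  have h4 : M 2 2 = -M 0 0 - M 1 1 := by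
    rw [Matrix.trace_fin_three] at ht; linarith
  simp [cross_apply, Matrix.mulVec, dotProduct, Fin.sum_univ_three, h1, h2, h3, h4]
  ring

/-- The second summand vanishes termwise; the first contracts the symmetric M with the skew form (v,
w) ↦ det(v, x, w). -/
theorem divergence_cross_mulVec {M : Matrix (Fin 3) (Fin 3) ℝ} (hs : M.IsSymm)
    (x : Fin 3 → ℝ) :
    ∑ i, ((M *ᵥ Pi.single i 1) ⨯₃ x + (M *ᵥ x) ⨯₃ Pi.single i 1) ⬝ᵥ Pi.single i 1 = 0 := by
  have h1 := hs.apply 0 1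
  have h2 := hs.apply 0 2
  have h3 := hs.apply 1 2
  simp [Fin.sum_univ_three, cross_apply, Matrix.mulVec, dotProduct, Pi.single_apply, h1, h2, h3]

/-- The squared triple product is the Gram determinant. -/
theorem cross_dotProduct_sq (v w q : Fin 3 → ℝ) :
    ((v ⨯₃ w) ⬝ᵥ q) ^ 2 = (v ⬝ᵥ v) * (w ⬝ᵥ w) * (q ⬝ᵥ q) + 2 * (v ⬝ᵥ w) * (w ⬝ᵥ q) * (v ⬝ᵥ q)
      - (v ⬝ᵥ v) * (w ⬝ᵥ q) ^ 2 - (w ⬝ᵥ w) * (v ⬝ᵥ q) ^ 2 - (q ⬝ᵥ q) * (v ⬝ᵥ w) ^ 2 := by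
  simp [cross_apply, dotProduct, Fin.sum_univ_three]
  ring

end OneForm

/-! ### Orthonormal frames adapted to a point of the sphere -/

section Frame

variable {ι : E2 →ₗᵢ[ℝ] E3} {p : E3}

theorem exists_frame (hι : ∀ u, inner ℝ (ι u) p = 0) (hp : ‖p‖ = 1) :
    ∃ b : OrthonormalBasis (Fin 3) ℝ E3, b 0 = ι (EuclideanSpace.single 0 1) ∧
      b 1 = ι (EuclideanSpace.single 1 1) ∧ b 2 = p := by
  have hon : Orthonormal ℝ ![ι (EuclideanSpace.single 0 1), ι (EuclideanSpace.single 1 1), p] := by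
    have hι' : ∀ u, inner ℝ p (ι u) = 0 := fun u => by rw [real_inner_comm, hι]
    have hpp : inner ℝ p p = 1 := by rw [real_inner_self_eq_norm_sq, hp]; norm_num
    rw [orthonormal_iff_ite]
    intro i j
    fin_cases i <;> fin_cases j <;>
      simp [hι, hι', hp, LinearIsometry.inner_map_map, EuclideanSpace.inner_single_left]
  let b := (basisOfOrthonormalOfCardEqFinrank hon (by simp)).toOrthonormalBasis (by
    rw [coe_basisOfOrthonormalOfCardEqFinrank]; exact hon)
  have hb : ⇑b = ![ι (EuclideanSpace.single 0 1), ι (EuclideanSpace.single 1 1), p] := by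
    simp [b]
  exact ⟨b, by rw [hb]; rfl, by rw [hb]; rfl, by rw [hb]; rfl⟩

theorem dotProduct_eq_inner (x y : E3) : x.ofLp ⬝ᵥ y.ofLp = inner ℝ x y := by
  simp [PiLp.inner_apply, dotProduct, mul_comm]

/-- The cross product of the two tangent vectors is p or -p. Squaring makes the orientation
irrelevant, and the identity follows from the Gram determinant and Parseval. -/
theorem cross_frame_sq (hι : ∀ u, inner ℝ (ι u) p = 0) (hp : ‖p‖ = 1) (q : E3) :
    (((ι (EuclideanSpace.single 0 1)).ofLp ⨯₃ (ι (EuclideanSpace.single 1 1)).ofLp)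
      ⬝ᵥ q.ofLp) ^ 2 = (p.ofLp ⬝ᵥ q.ofLp) ^ 2 := by
  obtain ⟨b, h0, h1, h2⟩ := exists_frame hι hp
  have hsum := b.sum_inner_mul_inner q q
  have ho : ∀ i j, inner ℝ (b i) (b j) = if i = j then 1 else 0 :=
    orthonormal_iff_ite.1 b.orthonormal
  rw [Fin.sum_univ_three] at hsum
  rw [cross_dotProduct_sq, ← h0, ← h1, ← h2]
  simp only [dotProduct_eq_inner, ho]
  rw [real_inner_comm (b 0) q, real_inner_comm (b 1) q, real_inner_comm (b 2) q] at hsum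
  simp
  rw [real_inner_self_eq_norm_sq] at hsum
  linarith

end Frame

/-! ### The scalar curvature of g_λ -/

section ScalarCurvature

variable {c : E2 →ₗ[ℝ] Matrix (Fin 3) (Fin 3) ℝ} {ι : E2 →ₗᵢ[ℝ] E3} {p : E3}

theorem formDeriv_eq (i j a : Fin 2) : formDeriv c ι p i j a
    = fderiv ℝ (oneForm c) p (ι (EuclideanSpace.single i 1)) (ι (EuclideanSpace.single j 1)) a := by
  rw [formDeriv, fderiv_chartForm_zero, oneForm_self, smul_zero, sub_zero]

theorem chartMetric_eventuallyEq (L : Submodule ℤ E2) [DiscreteTopology L] {x : SphereTorus L}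
    (h : ∀ u, ((extChartAt (𝓡 2) x.1).symm u : E3) = invStereo ι x.1 u) :
    chartMetric (metric L c) x =ᶠ[𝓝 (extChartAt IST x x)] modelMetric c (invStereo ι x.1) := by
  filter_upwards [eventually_snd_mem_target L x] with y hy
  exact chartMetric_metric L c h ((contDiff_invStereo ι x.1).differentiable (by simp) _) hy

theorem extChartAt_self_eq (L : Submodule ℤ E2) [DiscreteTopology L] (x : SphereTorus L) :
    extChartAt IST x x = ((0 : E2), chartAt E2 x.2 x.2) := by
  refine Prod.ext ?_ ?_
  · rw [extChartAt_prod]; exact extChartAt_sphere_self x.1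
  · rw [extChartAt_prod]; rfl

theorem scalarCurvature_metric (hs : ∀ Z, (c Z).IsSymm) (ht : ∀ Z, (c Z).trace = 0)
    (L : Submodule ℤ E2) [DiscreteTopology L] (x : SphereTorus L) :
    scalarCurvature (metric L c) x = 2 - 9 / 2 * ∑ a,
      ((x.1 : E3).ofLp ⬝ᵥ (c (EuclideanSpace.single a 1) *ᵥ (x.1 : E3).ofLp)) ^ 2 := by
  obtain ⟨ι, hι, h⟩ := exists_extChartAt_sphere_symm x.1
  have hp : ‖(x.1 : E3)‖ = 1 := norm_eq_of_mem_sphere x.1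
  have h1 : scalarCurvature (metric L c) x
      = scalarCurvatureAt (chartMetric (metric L c) x) (extChartAt IST x x) := rfl
  rw [h1, scalarCurvatureAt_congr (chartMetric_eventuallyEq L h), extChartAt_self_eq,
    scalarCurvatureAt_modelMetric hι hp]
  have key : ∀ a, (formDeriv c ι x.1 0 1 a - formDeriv c ι x.1 1 0 a) ^ 2
      = 9 * ((x.1 : E3).ofLp ⬝ᵥ (c (EuclideanSpace.single a 1) *ᵥ (x.1 : E3).ofLp)) ^ 2 := by
    intro a
    rw [formDeriv_eq, formDeriv_eq, fderiv_oneForm_apply, fderiv_oneForm_apply,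
      cross_mulVec_alternating (hs _) (ht _), mul_pow]
    have := cross_frame_sq hι hp
      (WithLp.toLp 2 (c (EuclideanSpace.single a 1) *ᵥ (x.1 : E3).ofLp))
    rw [this]
    norm_num
  simp_rw [key, ← Finset.mul_sum]
  ring

end ScalarCurvature

/-! ### Second derivatives and traces over orthonormal bases -/

section SecondDerivative

set_option maxSynthPendingDepth 5

variable {E F G : Type*} [NormedAddCommGroup E] [NormedSpace ℝ E] [NormedAddCommGroup F]
  [NormedSpace ℝ F] [NormedAddCommGroup G] [NormedSpace ℝ G]

theorem fderiv_fderiv_comp {f : F → G} {φ : E → F} {x : E} (hf : ContDiffAt ℝ 2 f (φ x))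
    (hφ : ContDiffAt ℝ 2 φ x) (u v : E) :
    fderiv ℝ (fderiv ℝ (f ∘ φ)) x u v
      = fderiv ℝ (fderiv ℝ f) (φ x) (fderiv ℝ φ x u) (fderiv ℝ φ x v)
        + fderiv ℝ f (φ x) (fderiv ℝ (fderiv ℝ φ) x u v) := by
  have hf' : HasFDerivAt (fderiv ℝ f) (fderiv ℝ (fderiv ℝ f) (φ x)) (φ x) :=
    ((hf.fderiv_right (m := 1) (by norm_num)).differentiableAt (by simp)).hasFDerivAt
  have hφ' : HasFDerivAt (fderiv ℝ φ) (fderiv ℝ (fderiv ℝ φ) x) x :=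
    ((hφ.fderiv_right (m := 1) (by norm_num)).differentiableAt (by simp)).hasFDerivAt
  have hφ1 : HasFDerivAt φ (fderiv ℝ φ x) x := (hφ.differentiableAt (by simp)).hasFDerivAt
  have he : fderiv ℝ (f ∘ φ) =ᶠ[𝓝 x] fun y => (fderiv ℝ f (φ y)) ∘L (fderiv ℝ φ y) := by
    filter_upwards [hφ.eventually (by simp),
      hφ.continuousAt.eventually (hf.eventually (by simp))] with y h1 h2
    exact fderiv_comp y (h2.differentiableAt (by simp)) (h1.differentiableAt (by simp))
  have hc : HasFDerivAt (fun y => (fderiv ℝ f (φ y)) ∘L (fderiv ℝ φ y)) _ x :=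
    (hf'.comp x hφ1).clm_comp hφ'
  rw [he.fderiv_eq, hc.fderiv]
  simp
  abel

/-- The second derivative of `f` at `x` in the direction `v`. -/
def secondDeriv (f : E → G) (x v : E) : G := fderiv ℝ (fderiv ℝ f) x v v

theorem sum_orthonormalBasis_eq {V : Type*} [NormedAddCommGroup V] [InnerProductSpace ℝ V]
    [FiniteDimensional ℝ V] {κ κ' W : Type*} [Fintype κ] [Fintype κ'] [AddCommGroup W] [Module ℝ W]
    (b : OrthonormalBasis κ ℝ V) (b' : OrthonormalBasis κ' ℝ V) (A : V →ₗ[ℝ] V →ₗ[ℝ] W) :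
    ∑ i, A (b i) (b i) = ∑ i, A (b' i) (b' i) := by
  classical
  have hpos : ∀ v : V, v ≠ 0 → 0 < (innerSL ℝ : V →L[ℝ] V →L[ℝ] ℝ) v v := fun v hv =>
    real_inner_self_pos.2 hv
  have h1 := metricTrace_eq_sum (isInvertible_of_pos _ hpos) b.toBasis
    (fun i j => by
      rw [b.coe_toBasis]
      exact orthonormal_iff_ite.1 b.orthonormal i j) A
  have h2 := metricTrace_eq_sum (isInvertible_of_pos _ hpos) b'.toBasis
    (fun i j => by
      rw [b'.coe_toBasis]
      exact orthonormal_iff_ite.1 b'.orthonormal i j) A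
  rw [b.coe_toBasis] at h1
  rw [b'.coe_toBasis] at h2
  exact h1.symm.trans h2

/-- The bilinear map underlying a continuous one. -/
def toBilin (B : E →L[ℝ] E →L[ℝ] G) : E →ₗ[ℝ] E →ₗ[ℝ] G :=
  LinearMap.mk₂ ℝ (fun u v => B u v) (by simp) (by simp) (by simp) (by simp)

theorem toBilin_apply (B : E →L[ℝ] E →L[ℝ] G) (u v : E) : toBilin B u v = B u v := rfl

end SecondDerivative

/-! ### Functions on S² × T² as functions on (ℝ³ ∖ 0) × ℝ² -/

section Lift

/-- The radial projection of `ℝ³ ∖ {0}` to the sphere. -/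
def sphereProj (x : E3) : S2 :=
  if h : x = 0 then ⟨EuclideanSpace.single 0 1, by simp⟩
  else ⟨‖x‖⁻¹ • x, by simp [norm_smul, norm_ne_zero_iff.2 h]⟩

theorem coe_sphereProj {x : E3} (h : x ≠ 0) : (sphereProj x : E3) = ‖x‖⁻¹ • x := by
  simp [sphereProj, h]

theorem sphereProj_coe (p : S2) : sphereProj p = p := by
  have h : (p : E3) ≠ 0 := ne_zero_of_mem_unit_sphere p
  apply Subtype.ext
  rw [coe_sphereProj h, norm_eq_of_mem_sphere p]
  simp

theorem sphereProj_smul {x : E3} (hx : x ≠ 0) {r : ℝ} (hr : 0 < r) :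
    sphereProj (r • x) = sphereProj x := by
  apply Subtype.ext
  rw [coe_sphereProj hx, coe_sphereProj (smul_ne_zero hr.ne' hx), norm_smul, smul_smul,
    Real.norm_of_nonneg hr.le]
  congr 1
  field_simp

theorem contMDiffAt_sphereProj {x : E3} (hx : x ≠ 0) :
    ContMDiffAt 𝓘(ℝ, E3) (𝓡 2) ∞ sphereProj x := by
  have : Fact (finrank ℝ E3 = 2 + 1) := ⟨by simp⟩
  let U : TopologicalSpace.Opens E3 := ⟨{0}ᶜ, isOpen_compl_singleton⟩
  have h : ContMDiff 𝓘(ℝ, E3) 𝓘(ℝ, E3) ∞ fun y : U => (sphereProj y : E3) := by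
    intro y
    have hy : (y : E3) ≠ 0 := y.2
    rw [contMDiffAt_subtype_iff (f := fun y : E3 => (sphereProj y : E3)), contMDiffAt_iff_contDiffAt]
    have h1 : ContDiffAt ℝ ∞ (fun y : E3 => ‖y‖⁻¹ • y) (y : E3) :=
      ((contDiffAt_norm ℝ hy).inv (norm_ne_zero_iff.2 hy)).smul contDiffAt_id
    refine h1.congr_of_eventuallyEq ?_
    filter_upwards [isOpen_compl_singleton.mem_nhds hy] with z hz
    exact coe_sphereProj hz
  have h2 : ContMDiff 𝓘(ℝ, E3) (𝓡 2) ∞ fun y : U => sphereProj y :=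
    h.codRestrict_sphere (n := 2) fun y => (sphereProj y).2
  exact (contMDiffAt_subtype_iff (x := (⟨x, hx⟩ : U))).1 (h2 ⟨x, hx⟩)

variable (L : Submodule ℤ E2)

/-- The function on `(ℝ³ ∖ {0}) × ℝ²` induced by a function on `S² × T²`. -/
def lift (f : SphereTorus L → ℂ) (y : E3 × E2) : ℂ := f (sphereProj y.1, QuotientAddGroup.mk y.2)

theorem lift_coe (f : SphereTorus L → ℂ) (p : S2) (z : E2) :
    lift L f (p, z) = f (p, QuotientAddGroup.mk z) := by
  rw [lift, sphereProj_coe]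

theorem lift_smul (f : SphereTorus L → ℂ) {x : E3} (hx : x ≠ 0) {r : ℝ} (hr : 0 < r) (z : E2) :
    lift L f (r • x, z) = lift L f (x, z) := by
  rw [lift, lift, sphereProj_smul hx hr]

variable [DiscreteTopology L]

theorem contMDiff_torusMk :
    ContMDiff 𝓘(ℝ, E2) 𝓘(ℝ, E2) ∞ (QuotientAddGroup.mk : E2 → Torus L) := by
  intro z
  let e := chartAt E2 (QuotientAddGroup.mk z : Torus L)
  have he : e ∈ atlas E2 (Torus L) := chart_mem_atlas _ _
  set w := e (QuotientAddGroup.mk z) with hw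
  have hwt : w ∈ e.target := e.map_source (mem_chart_source E2 _)
  have h1 : ContMDiffAt 𝓘(ℝ, E2) 𝓘(ℝ, E2) ∞ e.symm w :=
    (contMDiffOn_symm_of_mem_maximalAtlas
      (IsManifold.subset_maximalAtlas he)).contMDiffAt (e.open_target.mem_nhds hwt)
  have hz : (QuotientAddGroup.mk w : Torus L) = QuotientAddGroup.mk z :=
    mk_of_mem_atlas L he (mem_chart_source E2 _)
  have h2 : ContMDiffAt 𝓘(ℝ, E2) 𝓘(ℝ, E2) ∞ (fun y : E2 => y + (w - z)) z :=
    (contDiff_id.add contDiff_const).contMDiff.contMDiffAt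
  have h3 : ContMDiffAt 𝓘(ℝ, E2) 𝓘(ℝ, E2) ∞ (e.symm ∘ fun y : E2 => y + (w - z)) z :=
    ContMDiffAt.comp z (by simpa using h1) h2
  refine h3.congr_of_eventuallyEq (.of_forall fun y => ?_)
  simp only [Function.comp_apply]
  rw [mk_symm_of_mem_atlas L he, QuotientAddGroup.mk_add, QuotientAddGroup.mk_sub, hz, sub_self,
    add_zero]

theorem contDiffAt_lift {f : SphereTorus L → ℂ} (hf : ContMDiff IST 𝓘(ℝ, ℂ) ∞ f) {y : E3 × E2}
    (hy : y.1 ≠ 0) : ContDiffAt ℝ ∞ (lift L f) y := by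
  rw [← contMDiffAt_iff_contDiffAt]
  have h1 : ContMDiffAt 𝓘(ℝ, E3 × E2) (𝓡 2) ∞ (fun y : E3 × E2 => sphereProj y.1) y :=
    ContMDiffAt.comp (g := sphereProj) y (contMDiffAt_sphereProj hy) contDiff_fst.contMDiff.contMDiffAt
  have h2 : ContMDiffAt 𝓘(ℝ, E3 × E2) 𝓘(ℝ, E2) ∞
      (fun y : E3 × E2 => (QuotientAddGroup.mk y.2 : Torus L)) y :=
    (contMDiff_torusMk L).contMDiffAt.comp y contDiff_snd.contMDiff.contMDiffAt
  exact hf.contMDiffAt.comp y (h1.prodMk h2)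

theorem contMDiff_of_lift {f : SphereTorus L → ℂ} {G : E3 × E2 → ℂ}
    (hG : ∀ y : E3 × E2, y.1 ≠ 0 → ContDiffAt ℝ ∞ G y)
    (h : ∀ (p : S2) (z : E2), f (p, QuotientAddGroup.mk z) = G (p, z)) :
    ContMDiff IST 𝓘(ℝ, ℂ) ∞ f := by
  intro x
  have : Fact (finrank ℝ E3 = 2 + 1) := ⟨by simp⟩
  have hs : ContMDiffAt IST 𝓘(ℝ, E3) ∞ (fun y : SphereTorus L => (y.1 : E3)) x :=
    (contMDiff_coe_sphere.comp contMDiff_fst).contMDiffAt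
  have ht : ContMDiffAt IST 𝓘(ℝ, E2) ∞ (fun y : SphereTorus L => chartAt E2 x.2 y.2) x :=
    (contMDiffAt_of_mem_maximalAtlas (IsManifold.chart_mem_maximalAtlas x.2)
      (mem_chart_source E2 x.2)).comp x contMDiffAt_snd
  have h1 : ContMDiffAt IST 𝓘(ℝ, ℂ) ∞
      (G ∘ fun y : SphereTorus L => ((y.1 : E3), chartAt E2 x.2 y.2)) x :=
    ContMDiffAt.comp x (hG _ (ne_zero_of_mem_unit_sphere x.1)).contMDiffAt (hs.prodMk_space ht)
  refine h1.congr_of_eventuallyEq ?_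
  have hsrc : ∀ᶠ y in 𝓝 x, y.2 ∈ (chartAt E2 x.2).source :=
    continuous_snd.continuousAt.eventually
      ((chartAt E2 x.2).open_source.mem_nhds (mem_chart_source E2 x.2))
  filter_upwards [hsrc] with y hy
  simp only [Function.comp_apply]
  rw [← h, mk_of_mem_atlas L (chart_mem_atlas E2 x.2) hy]

end Lift

/-! ### The Laplacian as a flat second-order operator on lifts -/

section Laplacian

set_option maxSynthPendingDepth 5

/-- The horizontal lift `(X, -λ(X))` of a vector `X`. -/
def horizontalLift (c : E2 →ₗ[ℝ] Matrix (Fin 3) (Fin 3) ℝ) (x : E3) : E3 →L[ℝ] E3 × E2 :=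
  (ContinuousLinearMap.id ℝ E3).prod (-oneForm c x)

theorem horizontalLift_apply (c : E2 →ₗ[ℝ] Matrix (Fin 3) (Fin 3) ℝ) (x X : E3) :
    horizontalLift c x X = (X, -oneForm c x X) := rfl

/-- The operator on functions on `ℝ³ × ℝ²` which induces `-Δ`: the sum of the second derivatives in
horizontal and vertical orthonormal directions. -/
def liftLaplacian (c : E2 →ₗ[ℝ] Matrix (Fin 3) (Fin 3) ℝ) (F : E3 × E2 → ℂ) (y : E3 × E2) : ℂ :=
  ∑ i : Fin 3, secondDeriv F y (horizontalLift c y.1 (EuclideanSpace.single i 1))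
    + ∑ a : Fin 2, secondDeriv F y (0, EuclideanSpace.single a 1)

variable {c : E2 →ₗ[ℝ] Matrix (Fin 3) (Fin 3) ℝ}

/-- The horizontal part is a trace. The freedom of basis is used for a frame adapted to a point, and
later for a rotated basis. -/
theorem liftLaplacian_eq_sum {κ : Type*} [Fintype κ] (b : OrthonormalBasis κ ℝ E3)
    (F : E3 × E2 → ℂ) (y : E3 × E2) :
    liftLaplacian c F y = ∑ i, secondDeriv F y (horizontalLift c y.1 (b i))
      + ∑ a : Fin 2, secondDeriv F y (0, EuclideanSpace.single a 1) := by
  have h := sum_orthonormalBasis_eq (EuclideanSpace.basisFun (Fin 3) ℝ) b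
    ((toBilin (fderiv ℝ (fderiv ℝ F) y)).compl₁₂
      (horizontalLift c y.1 : E3 →ₗ[ℝ] E3 × E2) (horizontalLift c y.1 : E3 →ₗ[ℝ] E3 × E2))
  simp only [EuclideanSpace.basisFun_apply] at h
  exact congrArg (· + _) h

theorem sum_fderiv_oneForm_eq_zero (hs : ∀ Z, (c Z).IsSymm) {κ : Type*} [Fintype κ]
    (b : OrthonormalBasis κ ℝ E3) (x : E3) :
    ∑ i, fderiv ℝ (oneForm c) x (b i) (b i) = 0 := by
  have h := sum_orthonormalBasis_eq (EuclideanSpace.basisFun (Fin 3) ℝ) b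
    (toBilin (fderiv ℝ (oneForm c) x))
  simp only [EuclideanSpace.basisFun_apply, toBilin_apply] at h
  rw [← h]
  ext a
  have h2 := divergence_cross_mulVec (hs (EuclideanSpace.single a 1)) x.ofLp
  simpa [fderiv_oneForm_apply] using h2

theorem fderiv_oneForm_radial (x : E3) : fderiv ℝ (oneForm c) x x x = 0 := by
  ext a
  rw [fderiv_oneForm_apply, add_dotProduct, dotProduct_comm, dot_cross_self]
  simp

variable {L : Submodule ℤ E2} [DiscreteTopology L] {f : SphereTorus L → ℂ}

theorem fderiv_lift_radial (hf : ContMDiff IST 𝓘(ℝ, ℂ) ∞ f) {y : E3 × E2} (hy : y.1 ≠ 0) :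
    fderiv ℝ (lift L f) y (y.1, 0) = 0 := by
  have hl : HasDerivAt (fun t : ℝ => y + t • ((y.1, 0) : E3 × E2)) (y.1, 0) 0 := by
    simpa using ((hasDerivAt_id (0 : ℝ)).smul_const ((y.1, 0) : E3 × E2)).const_add y
  have hd : HasFDerivAt (lift L f) (fderiv ℝ (lift L f) y) (y + (0 : ℝ) • ((y.1, 0) : E3 × E2)) := by
    rw [zero_smul, add_zero]
    exact ((contDiffAt_lift L hf hy).differentiableAt (by simp)).hasFDerivAt
  have h := hd.comp_hasDerivAt (0 : ℝ) hl
  have he : (lift L f ∘ fun t : ℝ => y + t • ((y.1, 0) : E3 × E2)) =ᶠ[𝓝 0] fun _ => lift L f y := by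
    filter_upwards [isOpen_Ioi.mem_nhds (show (-1 : ℝ) < 0 by norm_num)] with t ht
    have ht' : 0 < 1 + t := by have : -1 < t := ht; linarith
    have e : y + t • ((y.1, 0) : E3 × E2) = ((1 + t) • y.1, y.2) := by
      ext1 <;> simp [add_smul]
    simp only [Function.comp_apply]
    rw [e, lift_smul L f hy ht']
  exact h.unique ((hasDerivAt_const (0 : ℝ) (lift L f y)).congr_of_eventuallyEq he)

/-- Differentiate the vanishing of the radial derivative once more along the ray; the extra term is
the radial derivative itself. -/
theorem secondDeriv_lift_radial (hf : ContMDiff IST 𝓘(ℝ, ℂ) ∞ f) {y : E3 × E2} (hy : y.1 ≠ 0) :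
    secondDeriv (lift L f) y (y.1, 0) = 0 := by
  have hd : HasFDerivAt (fderiv ℝ (lift L f)) (fderiv ℝ (fderiv ℝ (lift L f)) y) y :=
    (((contDiffAt_lift L hf hy).fderiv_right (m := ∞) (by norm_cast)).differentiableAt
      (by simp)).hasFDerivAt
  have hr : HasFDerivAt (fun y : E3 × E2 => ((y.1, 0) : E3 × E2))
      ((ContinuousLinearMap.fst ℝ E3 E2).prod 0) y :=
    hasFDerivAt_fst.prodMk (hasFDerivAt_const 0 y)
  have h := hd.clm_apply hr
  have he : (fun y : E3 × E2 => fderiv ℝ (lift L f) y (y.1, 0)) =ᶠ[𝓝 y] fun _ => 0 := by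
    filter_upwards [(isOpen_compl_singleton.preimage continuous_fst).mem_nhds
      (show y ∈ Prod.fst ⁻¹' {(0 : E3)}ᶜ from hy)] with z hz
    exact fderiv_lift_radial hf hz
  have h2 := congrArg (fun A => A (y.1, 0))
    (h.unique ((hasFDerivAt_const (0 : ℂ) y).congr_of_eventuallyEq he))
  simp [fderiv_lift_radial hf hy] at h2
  exact h2

/-- All first-order terms vanish: the trace of the Christoffel symbols because λ is divergence free,
and the contribution of the curved parametrisation because it is radial. -/
theorem laplacian_metric (hs : ∀ Z, (c Z).IsSymm) (hf : ContMDiff IST 𝓘(ℝ, ℂ) ∞ f)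
    (x : SphereTorus L) :
    laplacian (metric L c) f x
      = - liftLaplacian c (lift L f) ((x.1 : E3), chartAt E2 x.2 x.2) := by
  obtain ⟨ι, hι, h⟩ := exists_extChartAt_sphere_symm x.1
  have hp : ‖(x.1 : E3)‖ = 1 := norm_eq_of_mem_sphere x.1
  have hp0 : (x.1 : E3) ≠ 0 := ne_zero_of_mem_unit_sphere x.1
  obtain ⟨p, hpdef⟩ : ∃ p : E3, p = (x.1 : E3) := ⟨_, rfl⟩
  have hgc := chartMetric_eventuallyEq (c := c) L h
  rw [← hpdef] at hp hp0 hgc ⊢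
  simp only [← hpdef] at hι h
  set z : E2 := chartAt E2 x.2 x.2
  let g := modelMetric c (invStereo ι p)
  let Φ : E2 × E2 → E3 × E2 := Prod.map (invStereo ι p) id
  have hg : IsRiemannianNear g (0, z) := isRiemannianNear_modelMetric hι hp _
  have hfΦ : f ∘ (extChartAt IST x).symm = lift L f ∘ Φ := by
    funext y
    have e : (extChartAt IST x).symm y
        = ((extChartAt (𝓡 2) x.1).symm y.1, QuotientAddGroup.mk y.2) :=
      Prod.ext (extChartAt_symm_fst L x y) (extChartAt_symm_snd L x y)
    simp only [Function.comp_apply]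
    rw [e, ← lift_coe L f, h]
    rfl
  rw [extChartAt_self_eq] at hgc
  have h1 : laplacian (metric L c) f x
      = - metricTrace (g (0, z)) (hessian g (lift L f ∘ Φ) (0, z)) := by
    rw [laplacian, hfΦ, extChartAt_self_eq, hgc.eq_of_nhds,
      hessian_congr hgc (Filter.EventuallyEq.refl _ _)]
  have hΦ0 : Φ (0, z) = (p, z) := by simp [Φ, invStereo_zero]
  have hΦ : ContDiff ℝ ∞ Φ := (contDiff_invStereo ι p).prodMap contDiff_id
  have hΦ' : ∀ y v, fderiv ℝ Φ y v = (fderiv ℝ (invStereo ι p) y.1 v.1, v.2) := by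
    intro y v
    have : HasFDerivAt Φ _ y :=
      (((contDiff_invStereo ι p).differentiable (by simp) y.1).hasFDerivAt).prodMap y
        (hasFDerivAt_id y.2)
    rw [this.fderiv]
    rfl
  have hΦ'' : ∀ u v, fderiv ℝ (fderiv ℝ Φ) (0, z) u v = (-(inner ℝ u.1 v.1) • p, 0) := by
    intro u v
    have hL := ((hΦ.fderiv_right (m := ∞) (by norm_cast)).differentiable
      (by simp) (0, z)).hasFDerivAt.clm_apply (hasFDerivAt_const v (0, z))
    have hP : HasFDerivAt (fun y : E2 × E2 => fderiv ℝ (invStereo ι p) y.1) _ (0, z) :=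
      (((contDiff_invStereo ι p).fderiv_right (m := ∞) (by norm_cast)).differentiable
        (by simp) 0).hasFDerivAt.comp (0, z) hasFDerivAt_fst
    have hR := (hP.clm_apply (hasFDerivAt_const v.1 (0, z))).prodMk
      (hasFDerivAt_const v.2 ((0 : E2), z))
    have he : (fun y => fderiv ℝ Φ y v) = _ := funext fun y => hΦ' y v
    rw [he] at hL
    have := congrArg (fun A => A u) (hL.unique hR)
    simpa [fderiv_fderiv_invStereo_zero] using this
  have hlift : ContDiffAt ℝ 2 (lift L f) (Φ (0, z)) := by
    rw [hΦ0]
    exact (contDiffAt_lift L hf (y := (p, z)) hp0).of_le (by norm_cast)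
  let D := fderiv ℝ (lift L f) (p, z)
  have hhess : ∀ u v, hessian g (lift L f ∘ Φ) (0, z) u v
      = fderiv ℝ (fderiv ℝ (lift L f ∘ Φ)) (0, z) u v
        - fderiv ℝ (lift L f ∘ Φ) (0, z) (christoffelL g (0, z) u v) := by
    intro u v
    have hd : HasFDerivAt (fderiv ℝ (lift L f ∘ Φ))
        (fderiv ℝ (fderiv ℝ (lift L f ∘ Φ)) (0, z)) (0, z) :=
      (((hlift.comp (0, z) (hΦ.contDiffAt.of_le (by norm_cast))).fderiv_right
        (m := 1) (by norm_num)).differentiableAt (by simp)).hasFDerivAt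
    have := (hd.clm_apply (hasFDerivAt_const v (0, z))).fderiv
    rw [hessian, this, christoffelL_apply]
    simp
  let A : E2 × E2 →ₗ[ℝ] E2 × E2 →ₗ[ℝ] ℂ := toBilin (fderiv ℝ (fderiv ℝ (lift L f ∘ Φ)) (0, z))
    - (toBilin (christoffelL g (0, z))).compr₂
      (fderiv ℝ (lift L f ∘ Φ) (0, z) : E2 × E2 →ₗ[ℝ] ℂ)
  have hA : hessian g (lift L f ∘ Φ) (0, z) = fun u v => A u v := by
    funext u v
    rw [hhess]
    rfl
  let o := shearBasis (chartForm c ι p 0)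
  have ho : ∀ i j, g (0, z) (o i) (o j) = if i = j then 1 else 0 :=
    shearBasis_orthonormal hι hp z
  obtain ⟨b, hb0, hb1, hb2⟩ := exists_frame hι hp
  -- Only the vertical components ∑ᵢ ∂ᵢλ(eᵢ) could survive. They are the divergence of λ in ℝ³,
  -- whose radial summand is zero.
  have hΓ : ∑ j, christoffel g (0, z) (o j) (o j) = 0 := by
    have hk : ∀ i j k, koszul g (0, z) (o i) (o j) (o k) = koszulTable (formDeriv c ι p) i j k :=
      koszul_modelMetric hι hp z
    have hdiv : ∀ a, formDeriv c ι p 0 0 a + formDeriv c ι p 1 1 a = 0 := by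
      intro a
      have h2 := sum_fderiv_oneForm_eq_zero hs b p
      rw [Fin.sum_univ_three, hb2, fderiv_oneForm_radial, add_zero, hb0, hb1] at h2
      rw [formDeriv_eq, formDeriv_eq]
      exact congrArg (fun X : E2 => X a) h2
    simp_rw [hg.christoffel_eq_sum o ho, hk]
    simp only [Fintype.sum_sum_type, Fin.sum_univ_two, koszulTable, zero_smul, zero_add, add_zero]
    have e0 : formDeriv c ι p 1 1 0 = -formDeriv c ι p 0 0 0 := by linarith [hdiv 0]
    have e1 : formDeriv c ι p 1 1 1 = -formDeriv c ι p 0 0 1 := by linarith [hdiv 1]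
    rw [e0, e1]
    module
  have hsnd : ∀ j, fderiv ℝ (fderiv ℝ (lift L f ∘ Φ)) (0, z) (o j) (o j)
      = secondDeriv (lift L f) (p, z) (fderiv ℝ Φ (0, z) (o j)) := by
    intro j
    have hrad : D (-(inner ℝ (o j).1 (o j).1) • p, 0) = 0 := by
      have : ((-(inner ℝ (o j).1 (o j).1) • p, 0) : E3 × E2)
          = (-(inner ℝ (o j).1 (o j).1)) • (p, 0) := by simp
      rw [this, map_smul]
      have h0 : D (p, 0) = 0 := fderiv_lift_radial hf (y := (p, z)) hp0
      rw [h0, smul_zero]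
    rw [fderiv_fderiv_comp hlift (hΦ.contDiffAt.of_le (by norm_cast)), hΦ'', hΦ0]
    exact (congrArg (_ + ·) hrad).trans (add_zero _)
  have hhor : ∀ i, fderiv ℝ Φ (0, z) (o (Sum.inl i))
      = horizontalLift c p (ι (EuclideanSpace.single i 1)) := by
    intro i
    rw [hΦ', show o (Sum.inl i) = _ from shearBasis_inl _ i, fderiv_invStereo_zero,
      chartForm_zero, horizontalLift_apply]
  have hver : ∀ i, fderiv ℝ Φ (0, z) (o (Sum.inr i)) = (0, EuclideanSpace.single i 1) := by
    intro i
    rw [hΦ', show o (Sum.inr i) = _ from shearBasis_inr _ i]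
    simp
  rw [h1, hA, metricTrace_eq_sum hg.isInvertible.self_of_nhds o ho A, liftLaplacian_eq_sum b]
  congr 1
  have hsum : ∑ j, A (o j) (o j) = ∑ j, secondDeriv (lift L f) (p, z) (fderiv ℝ Φ (0, z) (o j)) := by
    have e : ∀ j, A (o j) (o j) = secondDeriv (lift L f) (p, z) (fderiv ℝ Φ (0, z) (o j))
        - fderiv ℝ (lift L f ∘ Φ) (0, z) (christoffel g (0, z) (o j) (o j)) := by
      intro j
      rw [← hsnd j]
      rfl
    simp_rw [e, Finset.sum_sub_distrib, ← map_sum, hΓ, map_zero, sub_zero]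
  rw [hsum, Fintype.sum_sum_type]
  simp_rw [hhor, hver]
  congr 1
  -- The sum over ℝ³ has one direction more than the tangent plane, the radial one. Its horizontal
  -- lift is (p, 0), along which the second derivative vanishes.
  rw [Fin.sum_univ_three, Fin.sum_univ_two, hb0, hb1, hb2, horizontalLift_apply c p p,
    oneForm_self, neg_zero]
  have h0 : secondDeriv (lift L f) (p, z) (p, 0) = 0 :=
    secondDeriv_lift_radial hf (y := (p, z)) hp0
  rw [h0, add_zero]

end Laplacian

/-! ### Eigenfunctions in terms of their lifts -/

section Translation

variable {E G : Type*} [NormedAddCommGroup E] [NormedSpace ℝ E] [NormedAddCommGroup G]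
  [NormedSpace ℝ G]

theorem secondDeriv_comp_add_right (F : E → G) (a y v : E) :
    secondDeriv (fun y => F (y + a)) y v = secondDeriv F (y + a) v := by
  have h : fderiv ℝ (fun y => F (y + a)) = fun y => fderiv ℝ F (y + a) :=
    funext fun y => fderiv_comp_add_right a
  rw [secondDeriv, h, fderiv_comp_add_right]
  rfl

theorem liftLaplacian_comp_add_right (c : E2 →ₗ[ℝ] Matrix (Fin 3) (Fin 3) ℝ) (F : E3 × E2 → ℂ)
    (w : E2) (y : E3 × E2) :
    liftLaplacian c (fun y => F (y + (0, w))) y = liftLaplacian c F (y + (0, w)) := by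
  simp [liftLaplacian, secondDeriv_comp_add_right]

variable (L : Submodule ℤ E2) {f : SphereTorus L → ℂ}

theorem lift_add_of_mem (f : SphereTorus L → ℂ) {l : E2} (hl : l ∈ L) (y : E3 × E2) :
    lift L f (y + (0, l)) = lift L f y := by
  have : (QuotientAddGroup.mk (y.2 + l) : Torus L) = QuotientAddGroup.mk y.2 :=
    QuotientAddGroup.eq.2 (by simpa using hl)
  simp [lift, this]

variable [DiscreteTopology L] {c : E2 →ₗ[ℝ] Matrix (Fin 3) (Fin 3) ℝ}

/-- `laplacian_metric` evaluates at the representative chosen by a chart; any other differs by a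
lattice vector, and the operator commutes with vertical translations. -/
theorem mem_eigenspace_iff (hs : ∀ Z, (c Z).IsSymm) {μ : ℝ} :
    f ∈ eigenspace (metric L c) μ ↔ ContMDiff IST 𝓘(ℝ, ℂ) ∞ f ∧
      ∀ (p : S2) (z : E2), liftLaplacian c (lift L f) (p, z) = -(μ * lift L f (p, z)) := by
  refine and_congr_right fun hf => ⟨fun h p z => ?_, fun h x => ?_⟩
  · have h1 := h (p, QuotientAddGroup.mk z)
    rw [laplacian_metric hs hf] at h1
    simp only at h1
    set z' := chartAt E2 (QuotientAddGroup.mk z : Torus L) (QuotientAddGroup.mk z) with hz'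
    have hl : z' - z ∈ L := by
      have := QuotientAddGroup.eq.1 (mk_of_mem_atlas L (chart_mem_atlas E2 (QuotientAddGroup.mk z : Torus L))
        (mem_chart_source E2 (QuotientAddGroup.mk z : Torus L))).symm
      rwa [neg_add_eq_sub] at this
    have h2 := liftLaplacian_comp_add_right c (lift L f) (z' - z) ((p : E3), z)
    simp_rw [lift_add_of_mem L f hl] at h2
    rw [lift_coe, h2, ← h1, neg_neg]
    simp
  · rw [laplacian_metric hs hf, h, neg_neg, lift_coe,
      mk_of_mem_atlas L (chart_mem_atlas E2 _) (mem_chart_source E2 _)]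

end Translation

/-! ### Functions which transform under vertical translations by a character -/

section Weight

set_option maxSynthPendingDepth 5

variable {G : Type*} [NormedAddCommGroup G] [NormedSpace ℂ G]

/-- The character `w ↦ exp(2πi⟨k, w⟩)` of `ℝ²`. -/
def character (k w : E2) : ℂ := Complex.exp (2 * Real.pi * Complex.I * (inner ℝ k w : ℝ))

theorem norm_character (k w : E2) : ‖character k w‖ = 1 := by
  rw [character, Complex.norm_exp]
  simp

theorem hasDerivAt_character (k w : E2) :
    HasDerivAt (fun t : ℝ => character k (t • w)) (2 * Real.pi * Complex.I * (inner ℝ k w : ℝ)) 0 := by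
  have h1 : HasDerivAt (fun t : ℝ => 2 * Real.pi * Complex.I * ((t * inner ℝ k w : ℝ) : ℂ))
      (2 * Real.pi * Complex.I * (inner ℝ k w : ℝ)) 0 := by
    have := ((hasDerivAt_id (0 : ℝ)).mul_const (inner ℝ k w)).ofReal_comp.const_mul
      (2 * Real.pi * Complex.I)
    simpa using this
  have h2 := h1.cexp
  simp only [zero_mul, Complex.ofReal_zero, mul_zero, Complex.exp_zero, one_mul] at h2
  refine h2.congr_of_eventuallyEq (.of_forall fun t => ?_)
  simp [character, inner_smul_right]

theorem fderiv_weight {F : E3 × E2 → G} {k : E2} (hF : ∀ y w, F (y + (0, w)) = character k w • F y)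
    {y : E3 × E2} (hd : DifferentiableAt ℝ F y) (w : E2) :
    fderiv ℝ F y (0, w) = (2 * Real.pi * Complex.I * (inner ℝ k w : ℝ) : ℂ) • F y := by
  have hl : HasDerivAt (fun t : ℝ => y + t • ((0, w) : E3 × E2)) (0, w) 0 := by
    simpa using ((hasDerivAt_id (0 : ℝ)).smul_const ((0, w) : E3 × E2)).const_add y
  have hd' : HasFDerivAt F (fderiv ℝ F y) (y + (0 : ℝ) • ((0, w) : E3 × E2)) := by
    rw [zero_smul, add_zero]
    exact hd.hasFDerivAt
  have h := hd'.comp_hasDerivAt (0 : ℝ) hl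
  have h2 := (hasDerivAt_character k w).smul_const (F y)
  refine h.unique (h2.congr_of_eventuallyEq (.of_forall fun t => ?_))
  simp [← hF]

theorem fderiv_weight_smul {F : E3 × E2 → ℂ} {k : E2}
    (hF : ∀ y w, F (y + (0, w)) = character k w • F y) (y : E3 × E2) (w : E2) :
    fderiv ℝ F (y + (0, w)) = character k w • fderiv ℝ F y := by
  have h1 : fderiv ℝ (fun y => F (y + (0, w))) y = fderiv ℝ F (y + (0, w)) :=
    fderiv_comp_add_right _
  rw [← h1, show (fun y => F (y + (0, w))) = character k w • F from funext fun y => hF y w]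
  exact congrFun (fderiv_const_smul_field (character k w)) y

/-- The derivative of a function of weight k again has weight k, so every vertical differentiation
is multiplication by 2πi⟨k, w⟩. -/
theorem secondDeriv_weight {F : E3 × E2 → ℂ} {k : E2}
    (hF : ∀ y w, F (y + (0, w)) = character k w • F y) {y : E3 × E2} (hd : ContDiffAt ℝ 2 F y)
    (X : E3) (w : E2) :
    secondDeriv F y (X, w) = secondDeriv F y (X, 0)
      + 2 * ((2 * Real.pi * Complex.I * (inner ℝ k w : ℝ)) * fderiv ℝ F y (X, 0))
      + (2 * Real.pi * Complex.I * (inner ℝ k w : ℝ)) ^ 2 * F y := by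
  have hd1 : DifferentiableAt ℝ (fderiv ℝ F) y :=
    (hd.fderiv_right (m := 1) (by norm_num)).differentiableAt (by simp)
  have h1 : ∀ v, fderiv ℝ (fderiv ℝ F) y (0, w) v
      = (2 * Real.pi * Complex.I * (inner ℝ k w : ℝ)) * fderiv ℝ F y v := fun v => by
    rw [fderiv_weight (fderiv_weight_smul hF) hd1]
    rfl
  have hsymm : IsSymmSndFDerivAt ℝ F y := hd.isSymmSndFDerivAt (by simp)
  have h2 := hsymm.eq (X, 0) (0, w)
  have e : ((X, w) : E3 × E2) = (X, 0) + (0, w) := by simp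
  rw [secondDeriv, e, map_add (fderiv ℝ (fderiv ℝ F) y), add_apply, map_add, map_add, h2, h1, h1,
    fderiv_weight hF (hd.differentiableAt (by simp)), secondDeriv, smul_eq_mul]
  ring

/-- The crux of isospectrality: on weight k, two horizontal lifts with the same k-component cannot
be told apart. -/
theorem secondDeriv_weight_congr {F : E3 × E2 → ℂ} {k : E2}
    (hF : ∀ y w, F (y + (0, w)) = character k w • F y) {y : E3 × E2} (hd : ContDiffAt ℝ 2 F y)
    (X : E3) {w w' : E2} (h : inner ℝ k w = inner ℝ k w') :
    secondDeriv F y (X, w) = secondDeriv F y (X, w') := by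
  rw [secondDeriv_weight hF hd, secondDeriv_weight hF hd X w', h]

theorem sum_secondDeriv_vertical {F : E3 × E2 → ℂ} {k : E2}
    (hF : ∀ y w, F (y + (0, w)) = character k w • F y) {y : E3 × E2} (hd : ContDiffAt ℝ 2 F y) :
    ∑ a : Fin 2, secondDeriv F y (0, EuclideanSpace.single a 1)
      = -((4 * Real.pi ^ 2 * ‖k‖ ^ 2 : ℝ) * F y) := by
  have h0 : ∀ w, secondDeriv F y (0, w)
      = (2 * Real.pi * Complex.I * (inner ℝ k w : ℝ)) ^ 2 * F y := fun w => by
    rw [secondDeriv_weight hF hd]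
    have : ((0, 0) : E3 × E2) = 0 := rfl
    simp [secondDeriv, this]
  simp_rw [h0, EuclideanSpace.norm_sq_eq, Fin.sum_univ_two]
  simp [EuclideanSpace.inner_single_right, mul_pow]
  ring

end Weight

/-! ### Second derivatives at a maximum of the modulus -/

section MaximumPrinciple

/-- A positive second derivative would make x a local minimum as well, hence h locally constant, a
contradiction. -/
theorem deriv_deriv_nonpos_of_isLocalMax {h : ℝ → ℝ} {x : ℝ} (hm : IsLocalMax h x)
    (hc : ContinuousAt h x) : deriv (deriv h) x ≤ 0 := by
  by_contra! hpos
  have hmin := isLocalMin_of_deriv_deriv_pos hpos hm.deriv_eq_zero hc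
  have he : h =ᶠ[𝓝 x] fun _ => h x := by
    filter_upwards [hm, hmin] with y h1 h2
    exact le_antisymm h1 h2
  have he' : deriv h =ᶠ[𝓝 x] fun _ => 0 := by
    filter_upwards [he.eventuallyEq_nhds] with y hy
    rw [hy.deriv_eq, deriv_const]
  rw [he'.deriv_eq, deriv_const] at hpos
  exact lt_irrefl _ hpos

theorem re_secondDeriv_nonpos {E : Type*} [NormedAddCommGroup E] [NormedSpace ℝ E] {F : E → ℂ}
    {y : E} (hF : ContDiffAt ℝ 2 F y) (hm : ∀ z, ‖F z‖ ≤ ‖F y‖) (v : E) :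
    ((starRingEnd ℂ) (F y) * secondDeriv F y v).re ≤ 0 := by
  -- The real function Re(conj(F y) F(y + t v)) is bounded by ‖F y‖², with equality at t = 0. It
  -- replaces the modulus, which need not be smooth.
  let ℓ : ℂ →L[ℝ] ℝ := Complex.reCLM ∘L
    (ContinuousLinearMap.mul ℝ ℂ ((starRingEnd ℂ) (F y)))
  have hℓ : ∀ z, ℓ z = ((starRingEnd ℂ) (F y) * z).re := fun z => rfl
  have hl : ∀ t : ℝ, HasDerivAt (fun t : ℝ => y + t • v) v t := fun t => by
    simpa using ((hasDerivAt_id t).smul_const v).const_add y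
  have hy0 : y + (0 : ℝ) • v = y := by simp
  have hcont : ContinuousAt (fun t : ℝ => y + t • v) 0 := (hl 0).continuousAt
  have hev : ∀ᶠ t in 𝓝 (0 : ℝ), ContDiffAt ℝ 2 F (y + t • v) := by
    have := hF.eventually (by simp)
    rw [← hy0] at this
    exact hcont.eventually this
  have hd1 : deriv (fun t : ℝ => ℓ (F (y + t • v))) =ᶠ[𝓝 0]
      fun t => ℓ (fderiv ℝ F (y + t • v) v) := by
    filter_upwards [hev] with t ht
    have h1 : HasFDerivAt F (fderiv ℝ F (y + t • v)) (y + t • v) :=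
      (ht.differentiableAt (by simp)).hasFDerivAt
    exact (ℓ.hasFDerivAt.comp_hasDerivAt t (h1.comp_hasDerivAt t (hl t))).deriv
  have hd2 : HasDerivAt (fun t : ℝ => ℓ (fderiv ℝ F (y + t • v) v)) (ℓ (secondDeriv F y v)) 0 := by
    have h1 : HasFDerivAt (fderiv ℝ F) (fderiv ℝ (fderiv ℝ F) y) (y + (0 : ℝ) • v) := by
      rw [hy0]
      exact ((hF.fderiv_right (m := 1) (by norm_num)).differentiableAt (by simp)).hasFDerivAt
    have h2 := h1.comp_hasDerivAt (0 : ℝ) (hl 0)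
    have h3 := (ContinuousLinearMap.apply ℝ ℂ v).hasFDerivAt.comp_hasDerivAt (0 : ℝ) h2
    exact ℓ.hasFDerivAt.comp_hasDerivAt (0 : ℝ) h3
  have hmax : IsLocalMax (fun t : ℝ => ℓ (F (y + t • v))) 0 := by
    refine .of_forall fun t => ?_
    simp only [hℓ, hy0]
    have e : ((starRingEnd ℂ) (F y) * F y).re = ‖F y‖ * ‖F y‖ := by
      rw [← Complex.normSq_eq_conj_mul_self, Complex.ofReal_re, Complex.normSq_eq_norm_sq, sq]
    rw [e]
    calc ((starRingEnd ℂ) (F y) * F (y + t • v)).re ≤ ‖(starRingEnd ℂ) (F y) * F (y + t • v)‖ :=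
          Complex.re_le_norm _
      _ = ‖F y‖ * ‖F (y + t • v)‖ := by rw [norm_mul, RCLike.norm_conj]
      _ ≤ ‖F y‖ * ‖F y‖ := by gcongr; exact hm _
  have hc : ContinuousAt (fun t : ℝ => ℓ (F (y + t • v))) 0 := by
    refine ℓ.continuous.continuousAt.comp (ContinuousAt.comp ?_ hcont)
    rw [hy0]
    exact hF.continuousAt
  have := deriv_deriv_nonpos_of_isLocalMax hmax hc
  rwa [hd1.deriv_eq, hd2.deriv] at this

end MaximumPrinciple

/-! ### Bound on the weights which occur in an eigenspace -/

section WeightSpace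

set_option linter.unusedSectionVars false

variable (L : Submodule ℤ E2) [DiscreteTopology L] (c : E2 →ₗ[ℝ] Matrix (Fin 3) (Fin 3) ℝ)

/-- The eigenfunctions on which the torus acts by the character with weight `k`. -/
def weightSpace (μ : ℝ) (k : E2) : Submodule ℂ (SphereTorus L → ℂ) where
  carrier := {f | f ∈ eigenspace (metric L c) μ ∧
    ∀ (p : S2) (q : Torus L) (w : E2), f (p, q + QuotientAddGroup.mk w) = character k w * f (p, q)}
  add_mem' := by
    rintro a b ⟨ha, ha'⟩ ⟨hb, hb'⟩
    exact ⟨add_mem ha hb, fun p q w => by simp [ha', hb', mul_add]⟩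
  zero_mem' := ⟨zero_mem _, fun p q w => by simp⟩
  smul_mem' := by
    rintro r a ⟨ha, ha'⟩
    exact ⟨Submodule.smul_mem _ r ha, fun p q w => by simp [ha']; ring⟩

variable {L c} {μ : ℝ} {k : E2} {f : SphereTorus L → ℂ}

theorem weightSpace_le : weightSpace L c μ k ≤ eigenspace (metric L c) μ := fun _ h => h.1

theorem lift_weight (h : ∀ (p : S2) (q : Torus L) (w : E2),
      f (p, q + QuotientAddGroup.mk w) = character k w * f (p, q)) (y : E3 × E2) (w : E2) :
    lift L f (y + (0, w)) = character k w • lift L f y := by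
  simp [lift, h]

/-- The modulus is invariant under the torus, so it has a maximum over the compact sphere. There the
horizontal terms are nonpositive, while the vertical ones contribute exactly -4π²‖k‖² times the
squared modulus. -/
theorem norm_weight_le (hs : ∀ Z, (c Z).IsSymm) (hf : f ∈ weightSpace L c μ k) (hf0 : f ≠ 0) :
    4 * Real.pi ^ 2 * ‖k‖ ^ 2 ≤ μ := by
  obtain ⟨hfe, hw⟩ := hf
  obtain ⟨hsm, hl⟩ := (mem_eigenspace_iff L hs).1 hfe
  have hcont : Continuous fun p : S2 => ‖f (p, 0)‖ := by
    have := hsm.continuous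
    fun_prop
  have : Nonempty S2 := ⟨sphereProj 0⟩
  obtain ⟨p, hp⟩ := hcont.exists_forall_ge_of_hasCompactSupport
    (HasCompactSupport.of_compactSpace _)
  have hnorm : ∀ y : E3 × E2, ‖lift L f y‖ = ‖f (sphereProj y.1, 0)‖ := fun y => by
    have := hw (sphereProj y.1) 0 y.2
    rw [zero_add] at this
    rw [lift, this, norm_mul, norm_character, one_mul]
  have hmax : ∀ y, ‖lift L f y‖ ≤ ‖lift L f ((p : E3), 0)‖ := fun y => by
    rw [hnorm, hnorm, sphereProj_coe]
    exact hp _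
  have hp0 : (p : E3) ≠ 0 := ne_zero_of_mem_unit_sphere p
  set y : E3 × E2 := ((p : E3), 0) with hy
  have hF0 : lift L f y ≠ 0 := fun h0 => hf0 <| by
    funext x
    obtain ⟨z, hz⟩ := QuotientAddGroup.mk_surjective x.2
    have h1 := hmax ((x.1 : E3), z)
    rw [h0, norm_zero, norm_le_zero_iff, lift_coe, hz] at h1
    exact h1
  have hF : ContDiffAt ℝ 2 (lift L f) y := (contDiffAt_lift L hsm hp0).of_le (by norm_cast)
  have h1 := hl p 0
  rw [liftLaplacian, sum_secondDeriv_vertical (lift_weight hw) hF, ← hy] at h1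
  have h2 := congrArg (fun t => ((starRingEnd ℂ) (lift L f y) * t).re) h1
  simp only [mul_add, Finset.mul_sum, Complex.add_re, Complex.re_sum] at h2
  have h3 : ∑ i : Fin 3, ((starRingEnd ℂ) (lift L f y) * secondDeriv (lift L f) y
      (horizontalLift c y.1 (EuclideanSpace.single i 1))).re ≤ 0 :=
    Finset.sum_nonpos fun i _ => re_secondDeriv_nonpos hF hmax _
  have e : ∀ r : ℝ, ((starRingEnd ℂ) (lift L f y) * -((r : ℂ) * lift L f y)).re
      = -(r * Complex.normSq (lift L f y)) := fun r => by
    rw [show (starRingEnd ℂ) (lift L f y) * -((r : ℂ) * lift L f y)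
      = -(r * ((starRingEnd ℂ) (lift L f y) * lift L f y)) by ring,
      ← Complex.normSq_eq_conj_mul_self, ← Complex.ofReal_mul, ← Complex.ofReal_neg,
      Complex.ofReal_re]
  rw [e, e] at h2
  have hpos : 0 < Complex.normSq (lift L f y) := Complex.normSq_pos.2 hF0
  by_contra! hlt
  nlinarith

end WeightSpace

/-! ### Weight spaces of two forms related by a rotation -/

section Rotation

set_option linter.unusedSectionVars false

set_option maxSynthPendingDepth 5

variable {L : Submodule ℤ E2} [DiscreteTopology L] {c c' : E2 →ₗ[ℝ] Matrix (Fin 3) (Fin 3) ℝ}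
  {μ : ℝ} {k : E2} {f : SphereTorus L → ℂ}

/-- A linear isometry as a map of the sphere. -/
def sphereMap (R : E3 ≃ₗᵢ[ℝ] E3) (p : S2) : S2 := ⟨R p, by simp⟩

theorem sphereMap_sphereProj (R : E3 ≃ₗᵢ[ℝ] E3) {x : E3} (hx : x ≠ 0) :
    sphereMap R (sphereProj x) = sphereProj (R x) := by
  apply Subtype.ext
  have hR : R x ≠ 0 := by simpa using hx
  rw [coe_sphereProj hR, sphereMap]
  simp [coe_sphereProj hx]

theorem lift_comp_sphereMap (R : E3 ≃ₗᵢ[ℝ] E3) (f : SphereTorus L → ℂ) {y : E3 × E2}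
    (hy : y.1 ≠ 0) :
    lift L (fun x => f (sphereMap R x.1, x.2)) y = lift L f (R y.1, y.2) := by
  simp only [lift, sphereMap_sphereProj R hy]

theorem comp_sphereMap_mem_weightSpace (hs : ∀ Z, (c Z).IsSymm) (hs' : ∀ Z, (c' Z).IsSymm)
    (R : E3 ≃ₗᵢ[ℝ] E3)
    (hR : ∀ x X, inner ℝ k (oneForm c' (R x) (R X)) = inner ℝ k (oneForm c x X))
    (hf : f ∈ weightSpace L c' μ k) :
    (fun x => f (sphereMap R x.1, x.2)) ∈ weightSpace L c μ k := by
  obtain ⟨hfe, hw⟩ := hf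
  obtain ⟨hsm, hl⟩ := (mem_eigenspace_iff L hs').1 hfe
  let Φ : E3 × E2 →L[ℝ] E3 × E2 := (R.toContinuousLinearEquiv : E3 →L[ℝ] E3).prodMap (.id ℝ E2)
  have hΦ : ∀ y : E3 × E2, Φ y = (R y.1, y.2) := fun y => rfl
  have hne : ∀ {x : E3}, x ≠ 0 → R x ≠ 0 := fun hx => by simpa using hx
  refine ⟨(mem_eigenspace_iff L hs).2 ⟨contMDiff_of_lift L (G := lift L f ∘ Φ)
    (fun y hy => ?_) (fun p z => ?_), fun p z => ?_⟩, fun p q w => hw _ q w⟩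
  · exact (contDiffAt_lift L hsm (y := Φ y) (hne hy)).comp y Φ.contDiff.contDiffAt
  · rw [← lift_coe L (fun x => f (sphereMap R x.1, x.2)),
      lift_comp_sphereMap R f (ne_zero_of_mem_unit_sphere p)]
    rfl
  · have hp : (p : E3) ≠ 0 := ne_zero_of_mem_unit_sphere p
    set F' := lift L (fun x => f (sphereMap R x.1, x.2))
    have he : F' =ᶠ[𝓝 ((p : E3), z)] lift L f ∘ Φ := by
      filter_upwards [(isOpen_compl_singleton.preimage continuous_fst).mem_nhds
        (show ((p : E3), z) ∈ Prod.fst ⁻¹' {(0 : E3)}ᶜ from hp)] with y hy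
      exact lift_comp_sphereMap R f hy
    have hF : ContDiffAt ℝ 2 (lift L f) (Φ ((p : E3), z)) :=
      (contDiffAt_lift L hsm (hne hp)).of_le (by norm_cast)
    have hsnd : ∀ v, secondDeriv F' ((p : E3), z) v
        = secondDeriv (lift L f) (R p, z) (R v.1, v.2) := fun v => by
      have hΦ1 : fderiv ℝ Φ = fun _ => Φ := funext fun y => Φ.fderiv
      have h1 := fderiv_fderiv_comp hF Φ.contDiff.contDiffAt v v
      rw [hΦ1] at h1
      simp only [fderiv_fun_const] at h1
      rw [secondDeriv, he.fderiv.fderiv_eq, h1]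
      simp [secondDeriv, hΦ]
    -- In the rotated basis the horizontal directions for `c'` match the images of those for `c`,
    -- except for vertical parts with equal k-component.
    have hb := liftLaplacian_eq_sum (c := c') ((EuclideanSpace.basisFun (Fin 3) ℝ).map R)
      (lift L f) (R p, z)
    have hl' := hl (sphereMap R p) z
    have hcoe : ((sphereMap R p : S2) : E3) = R p := rfl
    rw [hcoe, hb] at hl'
    have hv : F' ((p : E3), z) = lift L f (R p, z) := lift_comp_sphereMap R f hp
    rw [hv, ← hl', liftLaplacian]
    simp only [hsnd, map_zero]
    congr 1
    refine Finset.sum_congr rfl fun i _ => ?_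
    rw [horizontalLift_apply, horizontalLift_apply, OrthonormalBasis.map_apply,
      EuclideanSpace.basisFun_apply]
    refine secondDeriv_weight_congr (lift_weight hw) hF _ ?_
    rw [inner_neg_right, inner_neg_right, hR]

/-- Composition with a rotation intertwining the `k`-components of the two forms. -/
def weightSpaceEquiv (hs : ∀ Z, (c Z).IsSymm) (hs' : ∀ Z, (c' Z).IsSymm) (R : E3 ≃ₗᵢ[ℝ] E3)
    (hR : ∀ x X, inner ℝ k (oneForm c' (R x) (R X)) = inner ℝ k (oneForm c x X)) :
    weightSpace L c' μ k ≃ₗ[ℂ] weightSpace L c μ k where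
  toFun f := ⟨_, comp_sphereMap_mem_weightSpace hs hs' R hR f.2⟩
  invFun f := ⟨_, comp_sphereMap_mem_weightSpace hs' hs R.symm
    (fun x X => by rw [← hR]; simp) f.2⟩
  map_add' _ _ := rfl
  map_smul' _ _ := rfl
  left_inv f := by
    ext x
    simp [sphereMap]
  right_inv f := by
    ext x
    simp [sphereMap]

end Rotation

/-! ### Conjugacy of the two pencils of symmetric matrices -/

section Conjugacy

/-- Equal characteristic polynomials give the same ordered eigenvalues; match the two orthonormal
eigenbases. -/
theorem exists_orthogonal_conj {n : Type*} [Fintype n] [DecidableEq n] {A B : Matrix n n ℝ}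
    (hA : A.IsHermitian) (hB : B.IsHermitian) (h : A.charpoly = B.charpoly) :
    ∃ U : Matrix n n ℝ, Uᵀ * U = 1 ∧ B * U = U * A := by
  have he := (Matrix.IsHermitian.eigenvalues_eq_eigenvalues_iff hA hB).2 h
  let P := hA.eigenvectorUnitary
  let Q := hB.eigenvectorUnitary
  have hP1 : (star P : Matrix n n ℝ) * P = 1 := Unitary.coe_star_mul_self P
  have hP2 : (P : Matrix n n ℝ) * star P = 1 := Unitary.coe_mul_star_self P
  have hQ1 : (star Q : Matrix n n ℝ) * Q = 1 := Unitary.coe_star_mul_self Q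
  have hst : ∀ M : Matrix n n ℝ, Mᵀ = star M := fun M => by
    rw [Matrix.star_eq_conjTranspose, Matrix.conjTranspose_eq_transpose_of_trivial]
  refine ⟨(Q : Matrix n n ℝ) * star (P : Matrix n n ℝ), ?_, ?_⟩
  · rw [hst, star_mul, star_star]
    calc (P : Matrix n n ℝ) * star (Q : Matrix n n ℝ) * (Q * star (P : Matrix n n ℝ))
        = P * (star (Q : Matrix n n ℝ) * Q) * star (P : Matrix n n ℝ) := by simp only [mul_assoc]
      _ = 1 := by rw [hQ1, mul_one]; exact hP2
  · have sA := hA.spectral_theorem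
    have sB := hB.spectral_theorem
    rw [← he] at sB
    rw [Unitary.conjStarAlgAut_apply] at sA sB
    set D : Matrix n n ℝ := Matrix.diagonal (RCLike.ofReal ∘ hA.eigenvalues)
    have eA : A = P * D * star (P : Matrix n n ℝ) := sA
    have eB : B = Q * D * star (Q : Matrix n n ℝ) := sB
    calc B * (Q * star (P : Matrix n n ℝ))
        = Q * D * (star (Q : Matrix n n ℝ) * Q) * star (P : Matrix n n ℝ) := by
          rw [eB]; simp only [mul_assoc]
      _ = Q * (star (P : Matrix n n ℝ) * P) * D * star (P : Matrix n n ℝ) := by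
          rw [hQ1, mul_one]
          rw [show star (P : Matrix n n ℝ) * (P : Matrix n n ℝ) = 1 from hP1, mul_one]
      _ = Q * star (P : Matrix n n ℝ) * A := by
          rw [eA]; simp only [mul_assoc]

theorem cross_dotProduct_mulVec (U : Matrix (Fin 3) (Fin 3) ℝ) (u v w : Fin 3 → ℝ) :
    ((U *ᵥ u) ⨯₃ (U *ᵥ v)) ⬝ᵥ (U *ᵥ w) = U.det * ((u ⨯₃ v) ⬝ᵥ w) := by
  simp [cross_apply, Matrix.mulVec, dotProduct, Fin.sum_univ_three, Matrix.det_fin_three]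
  ring

theorem exists_rotation_conj {A B : Matrix (Fin 3) (Fin 3) ℝ} (hA : A.IsHermitian)
    (hB : B.IsHermitian) (h : A.charpoly = B.charpoly) :
    ∃ R : E3 ≃ₗᵢ[ℝ] E3, ∀ x X : E3,
      ((B *ᵥ (R x).ofLp) ⨯₃ (R x).ofLp) ⬝ᵥ (R X).ofLp = ((A *ᵥ x.ofLp) ⨯₃ x.ofLp) ⬝ᵥ X.ofLp := by
  obtain ⟨V, hV, hBV⟩ := exists_orthogonal_conj hA hB h
  have hd : V.det * V.det = 1 := by
    have := congrArg Matrix.det hV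
    rwa [Matrix.det_mul, Matrix.det_transpose, Matrix.det_one] at this
  -- In odd dimension, scaling by det V = ±1 makes the determinant 1. The sign matters because the
  -- triple product is multiplied by the determinant.
  let U := V.det • V
  have hU : Uᵀ * U = 1 := by simp [U, smul_smul, hd, hV]
  have hBU : B * U = U * A := by simp [U, hBV]
  have hdet : U.det = 1 := by
    simp only [U, Matrix.det_smul, Fintype.card_fin]
    calc V.det ^ 3 * V.det = (V.det * V.det) * (V.det * V.det) := by ring
      _ = 1 := by rw [hd, one_mul]
  have hinner : ∀ x y : E3, inner ℝ (Matrix.toEuclideanLin U x) (Matrix.toEuclideanLin U y)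
      = inner ℝ x y := fun x y => by
    simp only [EuclideanSpace.inner_eq_star_dotProduct, Matrix.toLpLin_apply, star_trivial]
    rw [Matrix.dotProduct_mulVec, ← Matrix.mulVec_transpose, Matrix.mulVec_mulVec, hU,
      Matrix.one_mulVec]
  let R := ((Matrix.toEuclideanLin U).isometryOfInner hinner).toLinearIsometryEquiv rfl
  have hR : ∀ x : E3, (R x).ofLp = U *ᵥ x.ofLp := fun x => rfl
  refine ⟨R, fun x X => ?_⟩
  rw [hR, hR, Matrix.mulVec_mulVec, hBU, ← Matrix.mulVec_mulVec, cross_dotProduct_mulVec, hdet,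
    one_mul]

theorem pencil_one (A B : Matrix (Fin 3) (Fin 3) ℝ) (k : E2) :
    pencil A B k = k 0 • A + k 1 • B := rfl

theorem c₁_isSymm (Z : E2) : (c₁ Z).IsSymm := by
  ext i j
  fin_cases i <;> fin_cases j <;> simp [c₁, pencil]

theorem c₂_isSymm (Z : E2) : (c₂ Z).IsSymm := by
  ext i j
  fin_cases i <;> fin_cases j <;> simp [c₂, pencil]

theorem c₁_trace (Z : E2) : (c₁ Z).trace = 0 := by
  simp [c₁, pencil, Matrix.trace_fin_three]

theorem c₂_trace (Z : E2) : (c₂ Z).trace = 0 := by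
  simp [c₂, pencil, Matrix.trace_fin_three]

/-- Both polynomials are X³ - (k₀² + 2k₁²) X; for the second matrix the coefficient 2 arises as the
square of √2. -/
theorem charpoly_c₁_eq_charpoly_c₂ (k : E2) : (c₁ k).charpoly = (c₂ k).charpoly := by
  have h2 : (Polynomial.C √2 : Polynomial ℝ) ^ 2 = 2 := by
    rw [← Polynomial.C_pow, Real.sq_sqrt (by norm_num)]
    rfl
  simp only [Matrix.charpoly, Matrix.charmatrix, Matrix.det_fin_three, c₁, c₂, pencil_one]
  simp
  linear_combination Polynomial.X * Polynomial.C (k 1) ^ 2 * h2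

theorem exists_intertwining_rotation (k : E2) : ∃ R : E3 ≃ₗᵢ[ℝ] E3,
    ∀ x X, inner ℝ k (oneForm c₂ (R x) (R X)) = inner ℝ k (oneForm c₁ x X) := by
  obtain ⟨R, hR⟩ := exists_rotation_conj (A := c₁ k) (B := c₂ k)
    ((Matrix.conjTranspose_eq_transpose_of_trivial _).trans (c₁_isSymm k))
    ((Matrix.conjTranspose_eq_transpose_of_trivial _).trans (c₂_isSymm k))
    (charpoly_c₁_eq_charpoly_c₂ k)
  refine ⟨R, fun x X => ?_⟩
  rw [real_inner_comm, oneForm_inner, real_inner_comm _ k, oneForm_inner, ← dotProduct_eq_inner,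
    ← dotProduct_eq_inner]
  exact hR x X

end Conjugacy

/-! ### Smoothness of averages of translates over the unit cube -/

section CubeAverage

set_option linter.unusedSectionVars false

set_option maxSynthPendingDepth 5

/-- The half-open unit cube. -/
def unitCube (d : Type) : Set (d → ℝ) := {x | ∀ i, x i ∈ Ioc (0 : ℝ) (0 + 1)}

variable {d : Type} [Fintype d]

theorem unitCube_subset : unitCube d ⊆ Icc 0 1 := fun x hx =>
  ⟨fun i => (hx i).1.le, fun i => by simpa using (hx i).2⟩

/-- The mean over the unit cube, with weight `χ`, of the translates of `H`. -/
def cubeAverage {W G : Type} [AddCommGroup W] [NormedAddCommGroup G] [NormedSpace ℂ G]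
    (A : (d → ℝ) → W) (χ : (d → ℝ) → ℂ) (H : W → G) (y : W) : G :=
  ∫ t in unitCube d, χ t • H (y + A t)

theorem integrableOn_unitCube {G : Type} [NormedAddCommGroup G]
    {h : (d → ℝ) → G} (hh : Continuous h) : IntegrableOn h (unitCube d) :=
  (hh.continuousOn.integrableOn_compact isCompact_Icc).mono_set unitCube_subset

theorem continuous_translate {W G : Type} [NormedAddCommGroup W] [NormedAddCommGroup G]
    [NormedSpace ℂ G] {A : (d → ℝ) → W} {χ : (d → ℝ) → ℂ} {U : Set W}
    (hA : Continuous A) (hχ : Continuous χ) (hAU : ∀ y ∈ U, ∀ t, y + A t ∈ U)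
    {H : W → G} (hH : ContinuousOn H U) {y : W} (hy : y ∈ U) :
    Continuous fun t => χ t • H (y + A t) :=
  hχ.smul (hH.comp_continuous (continuous_const.add hA) (hAU y hy))

variable {W : Type} [NormedAddCommGroup W] [NormedSpace ℝ W] [FiniteDimensional ℝ W]
  {A : (d → ℝ) → W} {χ : (d → ℝ) → ℂ} {U : Set W}

/-- Differentiation under the integral sign; the dominating constant comes from compactness of a
closed ball times the closed cube. -/
theorem hasFDerivAt_cubeAverage {G : Type} [NormedAddCommGroup G] [NormedSpace ℂ G]
    (hU : IsOpen U) (hA : Continuous A) (hχ : Continuous χ) (hAU : ∀ y ∈ U, ∀ t, y + A t ∈ U)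
    {H : W → G} (hH : ContDiffOn ℝ 1 H U) {y : W} (hy : y ∈ U) :
    HasFDerivAt (cubeAverage A χ H) (cubeAverage A χ (fderiv ℝ H) y) y := by
  have hfd : ContinuousOn (fderiv ℝ H) U := hH.continuousOn_fderiv_of_isOpen hU le_rfl
  obtain ⟨ε, hε, hball⟩ := nhds_basis_closedBall.mem_iff.1 (hU.mem_nhds hy)
  have hc : ContinuousOn (fun q : W × (d → ℝ) => χ q.2 • fderiv ℝ H (q.1 + A q.2))
      (closedBall y ε ×ˢ Icc 0 1) := by
    refine (hχ.comp continuous_snd).continuousOn.smul (hfd.comp ?_ fun q hq =>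
      hAU _ (hball hq.1) _)
    exact (continuous_fst.add (hA.comp continuous_snd)).continuousOn
  obtain ⟨C, hC⟩ := ((isCompact_closedBall y ε).prod isCompact_Icc).exists_bound_of_continuousOn hc
  refine hasFDerivAt_integral_of_dominated_of_fderiv_le (bound := fun _ => C)
    (F' := fun y t => χ t • fderiv ℝ H (y + A t)) (closedBall_mem_nhds y hε) ?_ ?_ ?_ ?_ ?_ ?_
  · filter_upwards [hU.mem_nhds hy] with z hz
    exact (continuous_translate hA hχ hAU hH.continuousOn hz).aestronglyMeasurable
  · exact integrableOn_unitCube (continuous_translate hA hχ hAU hH.continuousOn hy)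
  · exact (continuous_translate hA hχ hAU hfd hy).aestronglyMeasurable
  · refine (ae_restrict_mem (MeasurableSet.univ_pi' fun i => measurableSet_Ioc)).mono ?_
    intro t ht z hz
    exact hC (z, t) ⟨hz, unitCube_subset ht⟩
  · exact integrableOn_unitCube continuous_const
  · refine .of_forall fun t z hz => ?_
    have h1 : DifferentiableAt ℝ H (z + A t) :=
      (hH.contDiffAt (hU.mem_nhds (hAU z (hball hz) t))).differentiableAt (by simp)
    have h2 : HasFDerivAt (fun z => H (z + A t)) (fderiv ℝ H (z + A t)) z :=
      (hasFDerivAt_comp_add_right (A t)).2 h1.hasFDerivAt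
    exact h2.const_smul (χ t)

/-- The derivative of the average is the average of the derivative, so induct on n with the target
space varying. One order of differentiability is given away, harmlessly for smooth functions. -/
theorem contDiffOn_cubeAverage (hU : IsOpen U) (hA : Continuous A) (hχ : Continuous χ)
    (hAU : ∀ y ∈ U, ∀ t, y + A t ∈ U) (n : ℕ) {G : Type} [NormedAddCommGroup G]
    [NormedSpace ℂ G] {H : W → G} (hH : ContDiffOn ℝ (n + 1) H U) :
    ContDiffOn ℝ n (cubeAverage A χ H) U := by
  have hd : ∀ {G : Type} [NormedAddCommGroup G] [NormedSpace ℂ G] {H : W → G} (n : ℕ),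
      ContDiffOn ℝ (n + 1) H U → ∀ y ∈ U,
      HasFDerivAt (cubeAverage A χ H) (cubeAverage A χ (fderiv ℝ H) y) y := fun n hH y hy =>
    hasFDerivAt_cubeAverage hU hA hχ hAU (hH.of_le (by norm_cast; simp)) hy
  induction n generalizing G with
  | zero =>
    exact contDiffOn_zero.2 fun y hy => (hd 0 hH y hy).continuousAt.continuousWithinAt
  | succ n ih =>
    rw [show ((n + 1 : ℕ) : WithTop ℕ∞) = n + 1 by norm_cast,
      contDiffOn_succ_iff_fderiv_of_isOpen hU]
    refine ⟨fun y hy => (hd _ hH y hy).differentiableAt.differentiableWithinAt, by simp, ?_⟩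
    have h1 : ContDiffOn ℝ (n + 1) (fderiv ℝ H) U := hH.fderiv_of_isOpen hU (by norm_cast)
    exact (ih h1).congr fun y hy => (hd _ hH y hy).fderiv

theorem secondDeriv_cubeAverage (hU : IsOpen U) (hA : Continuous A) (hχ : Continuous χ)
    (hAU : ∀ y ∈ U, ∀ t, y + A t ∈ U) {H : W → ℂ} (hH : ContDiffOn ℝ 2 H U) {y : W} (hy : y ∈ U)
    (v : W) : secondDeriv (cubeAverage A χ H) y v = cubeAverage A χ (fun z => secondDeriv H z v) y := by
  have h1 : ContDiffOn ℝ 1 (fderiv ℝ H) U := hH.fderiv_of_isOpen hU (by norm_num)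
  have h2 : ContinuousOn (fderiv ℝ (fderiv ℝ H)) U := h1.continuousOn_fderiv_of_isOpen hU le_rfl
  have he : fderiv ℝ (cubeAverage A χ H) =ᶠ[𝓝 y] cubeAverage A χ (fderiv ℝ H) := by
    filter_upwards [hU.mem_nhds hy] with z hz
    exact (hasFDerivAt_cubeAverage hU hA hχ hAU (hH.of_le (by norm_num)) hz).fderiv
  rw [secondDeriv, he.fderiv_eq, (hasFDerivAt_cubeAverage hU hA hχ hAU h1 hy).fderiv]
  have hi := integrableOn_unitCube (continuous_translate hA hχ hAU h2 hy)
  let ev : (W →L[ℝ] W →L[ℝ] ℂ) →L[ℝ] ℂ :=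
    (ContinuousLinearMap.apply ℝ ℂ v) ∘L (ContinuousLinearMap.apply ℝ (W →L[ℝ] ℂ) v)
  exact (ev.integral_comp_comm hi).symm

end CubeAverage

/-! ### Fourier coefficients on the standard torus -/

section Fourier

local instance : MeasureSpace UnitAddCircle := ⟨AddCircle.haarAddCircle⟩

local instance : Measure.IsAddHaarMeasure (volume : Measure UnitAddCircle) :=
  inferInstanceAs (Measure.IsAddHaarMeasure AddCircle.haarAddCircle)

open UnitAddTorus

variable {d : Type} [Fintype d]

theorem mFourierCoeff_translate (g : UnitAddTorus d → ℂ) (n : d → ℤ) (σ : UnitAddTorus d) :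
    mFourierCoeff (fun τ => g (τ + σ)) n = mFourier n σ * mFourierCoeff g n := by
  unfold mFourierCoeff
  rw [← integral_sub_right_eq_self _ σ, ← integral_const_mul]
  congr 1
  funext τ
  have h1 : mFourier (-n) (τ - σ) = mFourier n σ * mFourier (-n) τ := by
    simp only [mFourier, ContinuousMap.coe_mk, ← Finset.prod_mul_distrib]
    refine Finset.prod_congr rfl fun i _ => ?_
    simp [fourier_apply, AddCircle.toCircle_add, sub_eq_add_neg, mul_comm]
  simp only [h1, sub_add_cancel, smul_eq_mul, mul_assoc]

theorem mFourierCoeff_mFourier [DecidableEq d] (m n : d → ℤ) :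
    mFourierCoeff (mFourier n) m = if m = n then 1 else 0 := by
  have h := orthonormal_iff_ite.1 (orthonormal_mFourier (d := d)) m n
  rw [← h, ← mFourierCoeff_toLp, ← mFourierBasis_repr, HilbertBasis.repr_apply_apply,
    coe_mFourierBasis]

theorem eq_zero_of_mFourierCoeff_eq_zero {g : UnitAddTorus d → ℂ} (hg : Continuous g)
    (h : ∀ n, mFourierCoeff g n = 0) (τ : UnitAddTorus d) : g τ = 0 := by
  have h0 : mFourierCoeff (⟨g, hg⟩ : C(UnitAddTorus d, ℂ)) = 0 := funext h
  have h1 := hasSum_mFourier_series_apply_of_summable (f := ⟨g, hg⟩)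
    (by rw [h0]; exact summable_zero) τ
  rw [h0] at h1
  simp only [Pi.zero_apply, zero_smul] at h1
  exact h1.unique hasSum_zero

theorem mFourierCoeff_add {g g' : UnitAddTorus d → ℂ} (hg : Continuous g) (hg' : Continuous g')
    (n : d → ℤ) : mFourierCoeff (g + g') n = mFourierCoeff g n + mFourierCoeff g' n := by
  have hi : ∀ {g : UnitAddTorus d → ℂ}, Continuous g →
      Integrable (fun t => mFourier (-n) t • g t) := fun hg =>
    ((mFourier (-n)).continuous.smul hg).integrable_of_hasCompactSupport
      (HasCompactSupport.of_compactSpace _)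
  simp only [mFourierCoeff, Pi.add_apply, smul_add]
  exact integral_add (hi hg) (hi hg')

theorem mFourierCoeff_const_mul (r : ℂ) (g : UnitAddTorus d → ℂ) (n : d → ℤ) :
    mFourierCoeff (fun τ => r * g τ) n = r * mFourierCoeff g n := by
  simp only [mFourierCoeff]
  rw [← integral_const_mul]
  congr 1
  funext τ
  simp only [smul_eq_mul]
  ring

end Fourier

/-! ### The torus ℝ² / L, its lattice basis and the dual lattice -/

section LatticeTorus

open UnitAddTorus

variable (L : Submodule ℤ E2) [DiscreteTopology L] [IsZLattice ℝ L]

/-- The index set of a basis of the lattice. -/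
abbrev LatticeIndex := Module.Free.ChooseBasisIndex ℤ L

/-- A basis of `ℝ²` which generates the lattice. -/
def latticeBasis : Basis (LatticeIndex L) ℝ E2 := (Module.Free.chooseBasis ℤ L).ofZLatticeBasis ℝ L

theorem latticeBasis_mem (i : LatticeIndex L) : latticeBasis L i ∈ L := by
  rw [latticeBasis, Basis.ofZLatticeBasis_apply]
  exact SetLike.coe_mem _

/-- The homomorphism from the circle to the torus given by a lattice vector. -/
def circleMap (i : LatticeIndex L) : UnitAddCircle →+ Torus L :=
  QuotientAddGroup.lift _
    ((QuotientAddGroup.mk' L.toAddSubgroup).comp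
      ((LinearMap.toSpanSingleton ℝ E2 (latticeBasis L i)).toAddMonoidHom)) <| by
    rw [AddSubgroup.zmultiples_le]
    simpa using latticeBasis_mem L i

theorem continuous_circleMap (i : LatticeIndex L) : Continuous (circleMap L i) := by
  refine continuous_quot_lift _ ?_
  exact continuous_quotient_mk'.comp (continuous_id.smul continuous_const)

/-- The isomorphism from the standard torus to `ℝ² / L`. -/
def torusMap (τ : UnitAddTorus (LatticeIndex L)) : Torus L := ∑ i, circleMap L i (τ i)

/-- The linear combination of the lattice basis with given coefficients. -/
def latticeComb (t : LatticeIndex L → ℝ) : E2 := ∑ i, t i • latticeBasis L i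

theorem continuous_latticeComb : Continuous (latticeComb L) := by
  unfold latticeComb
  fun_prop

theorem latticeComb_repr (w : E2) : latticeComb L (fun i => (latticeBasis L).repr w i) = w :=
  (latticeBasis L).sum_repr w

theorem torusMap_coe (t : LatticeIndex L → ℝ) :
    torusMap L (fun i => (t i : UnitAddCircle)) = QuotientAddGroup.mk (latticeComb L t) := by
  have := map_sum (QuotientAddGroup.mk' L.toAddSubgroup) (fun i => t i • latticeBasis L i)
    Finset.univ
  exact this.symm

theorem torusMap_add (τ σ : UnitAddTorus (LatticeIndex L)) :
    torusMap L (τ + σ) = torusMap L τ + torusMap L σ := by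
  simp [torusMap, Finset.sum_add_distrib]

theorem continuous_torusMap : Continuous (torusMap L) :=
  continuous_finsetSum _ fun i _ => (continuous_circleMap L i).comp (continuous_apply i)

/-- The point of the standard torus with the coordinates of `w`. -/
def torusCoord (w : E2) : UnitAddTorus (LatticeIndex L) :=
  fun i => (((latticeBasis L).repr w i : ℝ) : UnitAddCircle)

theorem torusMap_torusCoord (w : E2) : torusMap L (torusCoord L w) = QuotientAddGroup.mk w := by
  have := torusMap_coe L (fun i => (latticeBasis L).repr w i)
  rwa [latticeComb_repr] at this

/-- The element of the dual lattice with given coefficients. -/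
def dualVector (n : LatticeIndex L → ℤ) : E2 :=
  (InnerProductSpace.toDual ℝ E2).symm
    (∑ i, (n i : ℝ) • ((latticeBasis L).coord i).toContinuousLinearMap)

theorem inner_dualVector (n : LatticeIndex L → ℤ) (w : E2) :
    inner ℝ (dualVector L n) w = ∑ i, n i * (latticeBasis L).repr w i := by
  rw [dualVector, InnerProductSpace.toDual_symm_apply]
  simp

theorem inner_dualVector_latticeBasis (n : LatticeIndex L → ℤ) (i : LatticeIndex L) :
    inner ℝ (dualVector L n) (latticeBasis L i) = n i := by
  rw [inner_dualVector]
  simp [Finsupp.single_apply]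

theorem mFourier_torusCoord (n : LatticeIndex L → ℤ) (w : E2) :
    mFourier n (torusCoord L w) = character (dualVector L n) w := by
  simp only [mFourier, ContinuousMap.coe_mk, torusCoord, fourier_coe_apply, character,
    inner_dualVector, ← Complex.exp_sum]
  congr 1
  push_cast
  rw [Finset.mul_sum]
  refine Finset.sum_congr rfl fun i _ => ?_
  ring

/-- The coefficient nᵢ is the inner product of the dual vector with the i-th basis vector, so
Cauchy–Schwarz confines n to a box of integers. -/
theorem finite_dualVector (r : ℝ) : {n : LatticeIndex L → ℤ | ‖dualVector L n‖ ≤ r}.Finite := by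
  refine (finite_Icc (fun i => ⌊-(r * ‖latticeBasis L i‖)⌋) (fun i => ⌈r * ‖latticeBasis L i‖⌉)).subset ?_
  intro n hn
  have h : ∀ i, |(n i : ℝ)| ≤ r * ‖latticeBasis L i‖ := fun i => by
    rw [← inner_dualVector_latticeBasis L n i]
    exact (abs_real_inner_le_norm _ _).trans
      (mul_le_mul_of_nonneg_right hn (norm_nonneg _))
  refine ⟨fun i => ?_, fun i => ?_⟩
  · have := (abs_le.1 (h i)).1
    exact_mod_cast (Int.floor_le _).trans this
  · have := (abs_le.1 (h i)).2
    exact_mod_cast this.trans (Int.le_ceil _)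

end LatticeTorus

/-! ### Fourier components of eigenfunctions -/

section FourierProjection

set_option linter.unusedSectionVars false

open UnitAddTorus

set_option maxSynthPendingDepth 5

variable (L : Submodule ℤ E2) [DiscreteTopology L] [IsZLattice ℝ L]

/-- The component of a function on `S² × T²` in the direction of the `n`-th character of `T²`. -/
def fourierComponent (n : LatticeIndex L → ℤ) (f : SphereTorus L → ℂ) : SphereTorus L → ℂ :=
  fun x => mFourierCoeff (fun τ => f (x.1, x.2 + torusMap L τ)) n

variable {L} {c : E2 →ₗ[ℝ] Matrix (Fin 3) (Fin 3) ℝ} {μ : ℝ} {f g : SphereTorus L → ℂ}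
  (n : LatticeIndex L → ℤ)

theorem continuous_orbit (hf : Continuous f) (x : SphereTorus L) :
    Continuous fun τ => f (x.1, x.2 + torusMap L τ) :=
  hf.comp (continuous_const.prodMk (continuous_const.add (continuous_torusMap L)))

theorem fourierComponent_add (hf : Continuous f) (hg : Continuous g) :
    fourierComponent L n (f + g) = fourierComponent L n f + fourierComponent L n g :=
  funext fun x => mFourierCoeff_add (continuous_orbit hf x) (continuous_orbit hg x) n

theorem fourierComponent_smul (r : ℂ) :
    fourierComponent L n (r • f) = r • fourierComponent L n f :=
  funext fun _ => mFourierCoeff_const_mul r _ n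

theorem fourierComponent_translate (p : S2) (q : Torus L) (w : E2) :
    fourierComponent L n f (p, q + QuotientAddGroup.mk w)
      = character (dualVector L n) w * fourierComponent L n f (p, q) := by
  rw [← mFourier_torusCoord, fourierComponent, fourierComponent, ← mFourierCoeff_translate]
  simp only [torusMap_add, torusMap_torusCoord]
  congr 1
  funext τ
  rw [add_assoc, add_comm (QuotientAddGroup.mk w)]

theorem eq_zero_of_fourierComponent_eq_zero (hf : Continuous f)
    (h : ∀ n, fourierComponent L n f = 0) : f = 0 := by
  funext x
  obtain ⟨w, hw⟩ := QuotientAddGroup.mk_surjective x.2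
  have h1 := eq_zero_of_mFourierCoeff_eq_zero (continuous_orbit hf (x.1, 0))
    (fun n => congrFun (h n) (x.1, 0)) (torusCoord L w)
  rw [torusMap_torusCoord, hw, zero_add] at h1
  exact h1

/-- On every torus orbit such a function is a multiple of the n-th character, so orthogonality of
characters applies. -/
theorem fourierComponent_of_weight [DecidableEq (LatticeIndex L)] (m n : LatticeIndex L → ℤ)
    (h : ∀ (p : S2) (q : Torus L) (w : E2),
      f (p, q + QuotientAddGroup.mk w) = character (dualVector L n) w * f (p, q)) :
    fourierComponent L m f = if m = n then f else 0 := by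
  funext x
  have h1 : (fun τ => f (x.1, x.2 + torusMap L τ)) = fun τ => f x * mFourier n τ := by
    funext τ
    obtain ⟨t, rfl⟩ : ∃ t : LatticeIndex L → ℝ, (fun i => (t i : UnitAddCircle)) = τ := by
      choose t ht using fun i => QuotientAddGroup.mk_surjective (τ i)
      exact ⟨t, funext ht⟩
    have h2 : torusCoord L (latticeComb L t) = fun i => (t i : UnitAddCircle) := by
      funext i
      simp [torusCoord, latticeComb, Finsupp.single_apply]
    rw [torusMap_coe, h, ← mFourier_torusCoord, h2, mul_comm]
  rw [fourierComponent, h1, mFourierCoeff_const_mul, mFourierCoeff_mFourier]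
  split_ifs <;> simp

/-- The weight of the cube average which computes a Fourier component. -/
def cubeWeight (t : LatticeIndex L → ℝ) : ℂ := mFourier (-n) (fun i => (t i : UnitAddCircle))

theorem continuous_cubeWeight : Continuous (cubeWeight n) :=
  (mFourier (-n)).continuous.comp
    (continuous_pi fun i => (AddCircle.continuous_mk' 1).comp (continuous_apply i))

/-- In the flat cover the Fourier coefficient is an average of translates, to which differentiation
under the integral applies. -/
theorem lift_fourierComponent (y : E3 × E2) :
    lift L (fourierComponent L n f) y
      = cubeAverage (fun t => ((0 : E3), latticeComb L t)) (cubeWeight n) (lift L f) y := by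
  rw [lift, fourierComponent, mFourierCoeff_eq_integral _ _ 0]
  simp only [torusMap_coe]
  simp [cubeAverage, unitCube, lift, cubeWeight]

/-- The coefficients of the operator depend on the ℝ³ variable only, which the averaged translations
leave fixed. -/
theorem liftLaplacian_cubeAverage {F : E3 × E2 → ℂ} (hF : ∀ y : E3 × E2, y.1 ≠ 0 → ContDiffAt ℝ ∞ F y)
    {y : E3 × E2} (hy : y.1 ≠ 0) :
    liftLaplacian c (cubeAverage (fun t => ((0 : E3), latticeComb L t)) (cubeWeight n) F) y
      = cubeAverage (fun t => ((0 : E3), latticeComb L t)) (cubeWeight n) (liftLaplacian c F) y := by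
  have hU : IsOpen {y : E3 × E2 | y.1 ≠ 0} := isOpen_compl_singleton.preimage continuous_fst
  have hA : Continuous fun t => ((0 : E3), latticeComb L t) :=
    continuous_const.prodMk (continuous_latticeComb L)
  have hAU : ∀ y ∈ {y : E3 × E2 | y.1 ≠ 0}, ∀ t, y + ((0 : E3), latticeComb L t) ∈
      {y : E3 × E2 | y.1 ≠ 0} := fun y hy t => by simpa using hy
  have hF2 : ContDiffOn ℝ 2 F {y : E3 × E2 | y.1 ≠ 0} := fun y hy =>
    ((hF y hy).of_le (by norm_cast)).contDiffWithinAt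
  have h2 : ContinuousOn (fderiv ℝ (fderiv ℝ F)) {y : E3 × E2 | y.1 ≠ 0} :=
    (hF2.fderiv_of_isOpen (m := 1) hU (by norm_num)).continuousOn_fderiv_of_isOpen hU le_rfl
  have hi : ∀ v, IntegrableOn (fun t => cubeWeight n t •
      secondDeriv F (y + ((0 : E3), latticeComb L t)) v) (unitCube (LatticeIndex L)) := fun v =>
    integrableOn_unitCube (continuous_translate hA (continuous_cubeWeight n) hAU
      (H := fun z => secondDeriv F z v)
      ((h2.clm_apply continuousOn_const).clm_apply continuousOn_const) hy)
  simp only [liftLaplacian, secondDeriv_cubeAverage hU hA (continuous_cubeWeight n) hAU hF2 hy]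
  simp only [cubeAverage, liftLaplacian, smul_add, Finset.smul_sum, Prod.fst_add, add_zero]
  rw [integral_add (integrable_finsetSum _ fun i _ => hi _)
    (integrable_finsetSum _ fun i _ => hi _), integral_finsetSum _ fun i _ => hi _,
    integral_finsetSum _ fun i _ => hi _]

theorem fourierComponent_mem_weightSpace (hs : ∀ Z, (c Z).IsSymm)
    (hf : f ∈ eigenspace (metric L c) μ) :
    fourierComponent L n f ∈ weightSpace L c μ (dualVector L n) := by
  obtain ⟨hsm, hl⟩ := (mem_eigenspace_iff L hs).1 hf
  have hcd : ∀ y : E3 × E2, y.1 ≠ 0 → ContDiffAt ℝ ∞ (lift L f) y := fun y hy =>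
    contDiffAt_lift L hsm hy
  refine ⟨(mem_eigenspace_iff L hs).2 ⟨contMDiff_of_lift L
    (G := lift L (fourierComponent L n f)) (fun y hy => ?_) (fun p z => (lift_coe L _ p z).symm),
    fun p z => ?_⟩, fourierComponent_translate n⟩
  · have hU : IsOpen {y : E3 × E2 | y.1 ≠ 0} := isOpen_compl_singleton.preimage continuous_fst
    have hon : ContDiffOn ℝ ∞ (lift L (fourierComponent L n f)) {y : E3 × E2 | y.1 ≠ 0} := by
      refine contDiffOn_infty.2 fun m => ?_
      rw [show lift L (fourierComponent L n f) = _ from funext (lift_fourierComponent n)]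
      exact contDiffOn_cubeAverage hU (continuous_const.prodMk (continuous_latticeComb L))
        (continuous_cubeWeight n) (fun y hy t => by simpa using hy) m
        fun y hy => ((hcd y hy).of_le (by norm_cast; simp)).contDiffWithinAt
    exact hon.contDiffAt (hU.mem_nhds hy)
  · rw [show lift L (fourierComponent L n f) = _ from funext (lift_fourierComponent n),
      liftLaplacian_cubeAverage n hcd (ne_zero_of_mem_unit_sphere p), cubeAverage, cubeAverage,
      ← integral_const_mul, ← integral_neg]
    congr 1
    funext t
    have := hl p (z + latticeComb L t)
    have e : ((p : E3), z) + ((0 : E3), latticeComb L t) = ((p : E3), z + latticeComb L t) := by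
      simp
    rw [e, this]
    simp only [smul_eq_mul]
    ring

end FourierProjection

/-! ### Decomposition of eigenspaces, and isospectrality -/

section Isospectral

set_option linter.unusedSectionVars false

variable {L : Submodule ℤ E2} [DiscreteTopology L] [IsZLattice ℝ L]
  {c : E2 →ₗ[ℝ] Matrix (Fin 3) (Fin 3) ℝ}

theorem continuous_of_mem_eigenspace {f : SphereTorus L → ℂ} {μ : ℝ}
    (hf : f ∈ eigenspace (metric L c) μ) : Continuous f := by
  obtain ⟨h, -⟩ := hf
  exact h.continuous

variable (L) in
/-- The finitely many weights which occur in an eigenspace. -/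
def eigenWeights (μ : ℝ) : Set (LatticeIndex L → ℤ) :=
  {n | 4 * Real.pi ^ 2 * ‖dualVector L n‖ ^ 2 ≤ μ}

theorem finite_eigenWeights (μ : ℝ) : (eigenWeights L μ).Finite := by
  refine (finite_dualVector L √(μ / (4 * Real.pi ^ 2))).subset fun n hn => ?_
  refine Real.le_sqrt_of_sq_le ?_
  rw [le_div_iff₀ (by positivity), mul_comm]
  exact hn

/-- The `n`-th Fourier component of an eigenfunction. -/
def fourierProjection (hs : ∀ Z, (c Z).IsSymm) (μ : ℝ) (n : LatticeIndex L → ℤ) :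
    eigenspace (metric L c) μ →ₗ[ℂ] weightSpace L c μ (dualVector L n) where
  toFun f := ⟨fourierComponent L n f, fourierComponent_mem_weightSpace n hs f.2⟩
  map_add' f g := by
    have := fourierComponent_add n (continuous_of_mem_eigenspace f.2)
      (continuous_of_mem_eigenspace g.2)
    apply Subtype.ext
    simp only [Submodule.coe_add, this]
  map_smul' r f := by
    have := fourierComponent_smul n r (f := f.1)
    apply Subtype.ext
    simp only [Submodule.coe_smul, this, RingHom.id_apply]

/-- The decomposition of an eigenspace into Fourier components. -/
def fourierDecomposition (hs : ∀ Z, (c Z).IsSymm) (μ : ℝ) :=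
  LinearMap.pi (R := ℂ) fun n : eigenWeights L μ => fourierProjection (c := c) hs μ n.1

theorem bijective_fourierDecomposition (hs : ∀ Z, (c Z).IsSymm) (μ : ℝ) :
    Function.Bijective (fourierDecomposition (L := L) hs μ) := by
  classical
  constructor
  · rw [injective_iff_map_eq_zero]
    intro f hf
    refine Subtype.ext (eq_zero_of_fourierComponent_eq_zero (continuous_of_mem_eigenspace f.2) fun n => ?_)
    by_cases hn : n ∈ eigenWeights L μ
    · exact congrArg Subtype.val (congrFun hf ⟨n, hn⟩)
    -- A nonzero component would have a weight within the bound of `norm_weight_le`, that is, in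
    -- `eigenWeights`.
    · by_contra h0
      exact hn (norm_weight_le hs (fourierComponent_mem_weightSpace n hs f.2) h0)
  · intro h
    -- Finiteness lets prescribed components simply be added up to an eigenfunction.
    have : Fintype (eigenWeights L μ) := (finite_eigenWeights μ).fintype
    let ι (n : eigenWeights L μ) : weightSpace L c μ (dualVector L n) →ₗ[ℂ]
      eigenspace (metric L c) μ := Submodule.inclusion weightSpace_le
    refine ⟨∑ n, ι n (h n), funext fun m => ?_⟩
    have h1 : ∀ n, ((fourierProjection hs μ m.1 (ι n (h n)) :
        weightSpace L c μ (dualVector L m)) : SphereTorus L → ℂ)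
        = if m = n then (h n : SphereTorus L → ℂ) else 0 := fun n => by
      have := fourierComponent_of_weight (m : LatticeIndex L → ℤ) n (h n).2.2
      simp only [Subtype.coe_inj] at this
      exact this
    have h2 : fourierProjection hs μ m.1 (∑ n, ι n (h n)) = h m := by
      rw [map_sum]
      apply Subtype.ext
      rw [Submodule.coe_sum, Finset.sum_congr rfl fun n _ => h1 n]
      simp
    exact h2

/-- The eigenspaces are matched weight by weight, with a rotation chosen separately for each weight.
-/
theorem isospectral_of_rotations {c' : E2 →ₗ[ℝ] Matrix (Fin 3) (Fin 3) ℝ}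
    (hs : ∀ Z, (c Z).IsSymm) (hs' : ∀ Z, (c' Z).IsSymm)
    (h : ∀ k, ∃ R : E3 ≃ₗᵢ[ℝ] E3, ∀ x X, inner ℝ k (oneForm c' (R x) (R X))
      = inner ℝ k (oneForm c x X)) :
    Isospectral (metric L c) (metric L c') := by
  intro μ
  choose R hR using h
  exact (LinearEquiv.ofBijective _ (bijective_fourierDecomposition (L := L) hs μ) ≪≫ₗ
    (LinearEquiv.piCongrRight fun n : eigenWeights L μ =>
      weightSpaceEquiv hs hs' (R (dualVector L n)) (hR (dualVector L n))).symm ≪≫ₗ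
    (LinearEquiv.ofBijective _ (bijective_fourierDecomposition (L := L) hs' μ)).symm).rank_eq

end Isospectral

/-! ### The sets of maximal scalar curvature -/

section ScalarCurvatureValues

variable (L : Submodule ℤ E2) [DiscreteTopology L]

theorem scalarCurvature_c₁ (x : SphereTorus L) : scalarCurvature (metric L c₁) x
    = 2 - 9 / 2 * ((x.1.1 2 ^ 2 - x.1.1 0 ^ 2) ^ 2 + (2 * x.1.1 1 * (x.1.1 0 + x.1.1 2)) ^ 2) := by
  rw [scalarCurvature_metric c₁_isSymm c₁_trace]
  simp [c₁, pencil, Matrix.mulVec, dotProduct, Fin.sum_univ_three]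
  ring

theorem scalarCurvature_c₂ (x : SphereTorus L) : scalarCurvature (metric L c₂) x
    = 2 - 9 / 2 * ((x.1.1 2 ^ 2 - x.1.1 0 ^ 2) ^ 2 + 8 * (x.1.1 0 * x.1.1 2) ^ 2) := by
  rw [scalarCurvature_metric c₂_isSymm c₂_trace]
  have h : √2 ^ 2 = 2 := Real.sq_sqrt (by norm_num)
  simp [c₂, pencil, Matrix.mulVec, dotProduct, Fin.sum_univ_three]
  linear_combination 4 * (x.1.1 0 * x.1.1 2) ^ 2 * h

theorem sum_sq_sphere (p : S2) : p.1 0 ^ 2 + p.1 1 ^ 2 + p.1 2 ^ 2 = 1 := by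
  have h := norm_eq_of_mem_sphere p
  rw [EuclideanSpace.norm_eq, Real.sqrt_eq_one, Fin.sum_univ_three] at h
  simpa using h

theorem scalarCurvature_c₁_eq_two_iff (x : SphereTorus L) :
    scalarCurvature (metric L c₁) x = 2 ↔ x.1.1 0 = -x.1.1 2 ∨
      (x.1.1 = !₂[1 / √2, 0, 1 / √2] ∨ x.1.1 = !₂[-1 / √2, 0, -1 / √2]) := by
  rw [scalarCurvature_c₁]
  have hs := sum_sq_sphere x.1
  obtain ⟨p, hp⟩ := x
  obtain ⟨p, hp'⟩ := p
  simp only at hs ⊢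
  have h2 : (0 : ℝ) < √2 := by positivity
  have h2' : √2 ^ 2 = 2 := Real.sq_sqrt (by norm_num)
  have hext : ∀ q : E3, p = q ↔ p 0 = q 0 ∧ p 1 = q 1 ∧ p 2 = q 2 := fun q => by
    constructor
    · rintro rfl; simp
    · rintro ⟨h0, h1, h2⟩
      ext i; fin_cases i <;> assumption
  rw [hext, hext]
  simp
  constructor
  · intro h
    have e1 : p 2 ^ 2 - p 0 ^ 2 = 0 := by
      rw [← sq_eq_zero_iff]
      nlinarith [sq_nonneg (p 2 ^ 2 - p 0 ^ 2), sq_nonneg (2 * p 1 * (p 0 + p 2))]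
    have e2 : p 1 * (p 0 + p 2) = 0 := by
      rw [← sq_eq_zero_iff]
      nlinarith [sq_nonneg (p 2 ^ 2 - p 0 ^ 2), sq_nonneg (2 * p 1 * (p 0 + p 2))]
    by_cases h0 : p 0 = -p 2
    · exact .inl h0
    have h0' : p 0 + p 2 ≠ 0 := fun h => h0 (by linarith)
    have e3 : p 2 = p 0 := by
      have : (p 2 - p 0) * (p 0 + p 2) = 0 := by linarith [e1, show (p 2 - p 0) * (p 0 + p 2) = p 2 ^ 2 - p 0 ^ 2 by ring]
      have := (mul_eq_zero.1 this).resolve_right h0'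
      linarith
    have e4 : p 1 = 0 := (mul_eq_zero.1 e2).resolve_right h0'
    rw [e3, e4] at hs
    have e5 : (√2 * p 0 - 1) * (√2 * p 0 + 1) = 0 := by
      linear_combination p 0 ^ 2 * h2' + hs
    right
    rcases mul_eq_zero.1 e5 with h | h
    · left
      have : p 0 = (√2)⁻¹ := by field_simp; linarith
      exact ⟨this, e4, e3.trans this⟩
    · right
      have : p 0 = -1 / √2 := by field_simp; linarith
      exact ⟨this, e4, e3.trans this⟩
  · rintro (h | ⟨h0, h1, h2⟩ | ⟨h0, h1, h2⟩)
    · rw [h]; ring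
    · simp [h0, h1, h2]
    · simp [h0, h1, h2]

theorem scalarCurvature_c₂_eq_two_iff (x : SphereTorus L) :
    scalarCurvature (metric L c₂) x = 2 ↔ x.1.1 = !₂[0, 1, 0] ∨ x.1.1 = !₂[0, -1, 0] := by
  rw [scalarCurvature_c₂]
  have hs := sum_sq_sphere x.1
  obtain ⟨p, hp⟩ := x
  obtain ⟨p, hp'⟩ := p
  simp only at hs ⊢
  have hext : ∀ q : E3, p = q ↔ p 0 = q 0 ∧ p 1 = q 1 ∧ p 2 = q 2 := fun q => by
    constructor
    · rintro rfl; simp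
    · rintro ⟨h0, h1, h2⟩
      ext i; fin_cases i <;> assumption
  rw [hext, hext]
  simp
  constructor
  · intro h
    -- The left side equals (p₂² - p₀²)² + 4(p₀p₂)², and both squares vanish by `h`.
    have e : (p 2 ^ 2 + p 0 ^ 2) ^ 2 = 0 := by
      nlinarith [sq_nonneg (p 2 ^ 2 - p 0 ^ 2), sq_nonneg (p 0 * p 2)]
    have e' := pow_eq_zero_iff (two_ne_zero) |>.1 e
    have e0 : p 0 = 0 := by nlinarith [sq_nonneg (p 2), sq_nonneg (p 0)]
    have e2 : p 2 = 0 := by nlinarith [sq_nonneg (p 2), sq_nonneg (p 0)]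
    rw [e0, e2] at hs
    have : (p 1 - 1) * (p 1 + 1) = 0 := by linarith [show (p 1 - 1) * (p 1 + 1) = p 1 ^ 2 - 1 by ring]
    rcases mul_eq_zero.1 this with h | h
    · exact .inl ⟨e0, by linarith, e2⟩
    · exact .inr ⟨e0, by linarith, e2⟩
  · rintro (⟨h0, h1, h2⟩ | ⟨h0, h1, h2⟩) <;> simp [h0, h2]

end ScalarCurvatureValues

/-! ### Local isometries of manifolds read in charts -/

section LocalIsometry

variable {E : Type*} [NormedAddCommGroup E] [NormedSpace ℝ E] [FiniteDimensional ℝ E]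
  {H : Type*} [TopologicalSpace H] {I : ModelWithCorners ℝ E H} [I.Boundaryless]
  {M : Type*} [TopologicalSpace M] [ChartedSpace H M] [IsManifold I ∞ M]
  {g g' : RMetric I M} {e : OpenPartialHomeomorph M M} {x : M}

/-- The pullback of a metric under a linear map from the model space into a tangent space. -/
def pullbackMetric (g : RMetric I M) (y : M) (A : E →L[ℝ] E) : E →L[ℝ] E →L[ℝ] ℝ :=
  pullbackForm (W := TangentSpace I y) (g.inner y) A

theorem isPullbackNear_chartMetric (hx : x ∈ e.source) (he : ContMDiffOn I I ∞ e e.source)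
    (hiso : ∀ y ∈ e.source, ∀ v w : TangentSpace I y,
      g'.inner (e y) (mfderiv I I e y v) (mfderiv I I e y w) = g.inner y v w)
    (h : IsRiemannianNear (chartMetric g x) (extChartAt I x x))
    (h' : IsRiemannianNear (chartMetric g' (e x)) (extChartAt I (e x) (e x))) :
    IsPullbackNear (chartMetric g x) (chartMetric g' (e x))
      (extChartAt I (e x) ∘ e ∘ (extChartAt I x).symm) (extChartAt I x x) := by
  set A := extChartAt I x
  set B := extChartAt I (e x)
  set φ : E → E := B ∘ e ∘ A.symm
  have hAx : A.symm (A x) = x := extChartAt_to_inv x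
  have hφ : φ (A x) = B (e x) := by simp only [φ, Function.comp_apply, hAx]
  have hgood : ∀ᶠ u in 𝓝 (A x), u ∈ A.target ∧ A.symm u ∈ e.source ∧
      e (A.symm u) ∈ B.source := by
    have hc : Filter.Tendsto A.symm (𝓝 (A x)) (𝓝 x) := by
      have := continuousAt_extChartAt_symm (I := I) x
      rwa [ContinuousAt, hAx] at this
    have hc' : Filter.Tendsto (fun u => e (A.symm u)) (𝓝 (A x)) (𝓝 (e x)) :=
      (e.continuousAt hx).tendsto.comp hc
    filter_upwards [extChartAt_target_mem_nhds (I := I) x, hc.eventually (e.open_source.mem_nhds hx),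
      hc'.eventually (extChartAt_source_mem_nhds (I := I) (e x))] with u h1 h2 h3 using ⟨h1, h2, h3⟩
  have hψ : ∀ᶠ u in 𝓝 (A x), ContMDiffAt 𝓘(ℝ, E) I ∞ (e ∘ A.symm) u := by
    filter_upwards [hgood] with u hu
    have h1 : ContMDiffAt 𝓘(ℝ, E) I ∞ A.symm u :=
      (contMDiffOn_extChartAt_symm x).contMDiffAt ((isOpen_extChartAt_target x).mem_nhds hu.1)
    exact ContMDiffAt.comp u (he.contMDiffAt (e.open_source.mem_nhds hu.2.1)) h1
  have hφs : ∀ᶠ u in 𝓝 (A x), ContDiffAt ℝ ∞ φ u := by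
    filter_upwards [hgood, hψ] with u hu hu'
    have h1 : ContMDiffAt I 𝓘(ℝ, E) ∞ B (e (A.symm u)) :=
      contMDiffAt_extChartAt' (by rw [← extChartAt_source I]; exact hu.2.2)
    exact contMDiffAt_iff_contDiffAt.1 (ContMDiffAt.comp u h1 hu')
  have hpull : ∀ᶠ u in 𝓝 (A x), ∀ v w, chartMetric g x u v w
      = chartMetric g' (e x) (φ u) (fderiv ℝ φ u v) (fderiv ℝ φ u w) := by
    filter_upwards [hgood.eventually_nhds, hψ, hφs] with u hu hu' hus v w
    obtain ⟨hu1, hu2, hu3⟩ := hu.self_of_nhds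
    have dA : MDifferentiableAt 𝓘(ℝ, E) I A.symm u :=
      ((contMDiffOn_extChartAt_symm (n := ∞) x).contMDiffAt
        ((isOpen_extChartAt_target x).mem_nhds hu1)).mdifferentiableAt (by simp)
    have de : MDifferentiableAt I I e (A.symm u) :=
      (he.contMDiffAt (e.open_source.mem_nhds hu2)).mdifferentiableAt (by simp)
    have dB : MDifferentiableAt 𝓘(ℝ, E) I B.symm (φ u) :=
      ((contMDiffOn_extChartAt_symm (n := ∞) (e x)).contMDiffAt
        ((isOpen_extChartAt_target (e x)).mem_nhds (B.map_source hu3))).mdifferentiableAt (by simp)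
    have dφ : MDifferentiableAt 𝓘(ℝ, E) 𝓘(ℝ, E) φ u :=
      (hus.differentiableAt (by simp)).mdifferentiableAt
    have heq : B.symm ∘ φ =ᶠ[𝓝 u] e ∘ A.symm := by
      filter_upwards [hu] with t ht
      exact B.left_inv ht.2.2
    have c1 := mfderiv_comp u de dA
    have c2 := mfderiv_comp u dB dφ
    have hval : B.symm (φ u) = e (A.symm u) := heq.self_of_nhds
    have hder : (mfderiv 𝓘(ℝ, E) I (B.symm ∘ φ) u : E →L[ℝ] E)
        = (mfderiv 𝓘(ℝ, E) I (e ∘ A.symm) u : E →L[ℝ] E) := heq.mfderiv_eq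
    -- The base points are equal only propositionally; `pullbackMetric` types both differentials as
    -- maps of the model space, so that point and map can be replaced together.
    have hQ : pullbackMetric g' (B.symm (φ u)) (mfderiv 𝓘(ℝ, E) I (B.symm ∘ φ) u)
        = pullbackMetric g' (e (A.symm u)) (mfderiv 𝓘(ℝ, E) I (e ∘ A.symm) u) :=
      congrArg₂ (pullbackMetric g') hval hder
    have hQ' := congrArg (fun Q => Q v w) hQ
    rw [c1, c2, mfderiv_eq_fderiv] at hQ'
    exact (hiso (A.symm u) hu2 (mfderiv 𝓘(ℝ, E) I A.symm u v)
      (mfderiv 𝓘(ℝ, E) I A.symm u w)).symm.trans hQ'.symm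
  refine ⟨h, by rw [hφ]; exact h', hφs, ?_, hpull⟩
  filter_upwards [hpull, h.pos] with u hu hpos
  have hinj : Function.Injective (fderiv ℝ φ u : E →ₗ[ℝ] E) := by
    rw [← LinearMap.ker_eq_bot, LinearMap.ker_eq_bot']
    intro v hv
    by_contra hv0
    have h1 := hpos v hv0
    have hv' : fderiv ℝ φ u v = 0 := hv
    rw [hu, hv', map_zero] at h1
    simp at h1
  exact LinearMap.injective_iff_surjective.1 hinj

end LocalIsometry

/-! ### Isometry invariance of the scalar curvature of g_λ -/

section SphereTorus

variable {L : Submodule ℤ E2} [DiscreteTopology L] {c c' : E2 →ₗ[ℝ] Matrix (Fin 3) (Fin 3) ℝ}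
  {e : OpenPartialHomeomorph (SphereTorus L) (SphereTorus L)}

theorem isRiemannianNear_chartMetric (x : SphereTorus L) :
    IsRiemannianNear (chartMetric (metric L c) x) (extChartAt IST x x) := by
  obtain ⟨ι, hι, h⟩ := exists_extChartAt_sphere_symm x.1
  exact (isRiemannianNear_modelMetric hι (norm_eq_of_mem_sphere x.1) _).congr
    (chartMetric_eventuallyEq L h)

theorem scalarCurvature_eq_of_isometry (he : ContMDiffOn IST IST ∞ e e.source)
    (hiso : ∀ y ∈ e.source, ∀ v w : TangentSpace IST y,
      (metric L c').inner (e y) (mfderiv IST IST e y v) (mfderiv IST IST e y w)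
        = (metric L c).inner y v w) {x : SphereTorus L} (hx : x ∈ e.source) :
    scalarCurvature (metric L c) x = scalarCurvature (metric L c') (e x) := by
  have hp := isPullbackNear_chartMetric hx he hiso (isRiemannianNear_chartMetric x)
    (isRiemannianNear_chartMetric (e x))
  obtain ⟨ι, hι, h⟩ := exists_extChartAt_sphere_symm x.1
  have ho : ∀ i j, chartMetric (metric L c) x (extChartAt IST x x)
      (shearBasis (chartForm c ι x.1 0) i) (shearBasis (chartForm c ι x.1 0) j)
        = if i = j then 1 else 0 := fun i j => by
    rw [(chartMetric_eventuallyEq L h).self_of_nhds, extChartAt_self_eq]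
    exact shearBasis_orthonormal hι (norm_eq_of_mem_sphere x.1) _ i j
  have := hp.scalarCurvatureAt_eq (shearBasis (chartForm c ι x.1 0)) ho
  simp only [Function.comp_apply, extChartAt_to_inv] at this
  exact this

theorem injective_mfderiv_of_isometry {y : SphereTorus L}
    (hiso : ∀ v w : TangentSpace IST y,
      (metric L c').inner (e y) (mfderiv IST IST e y v) (mfderiv IST IST e y w)
        = (metric L c).inner y v w) : Function.Injective (mfderiv IST IST e y) := by
  rw [injective_iff_map_eq_zero]
  intro v hv
  by_contra hv0
  have h1 := (metric L c).pos y v hv0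
  rw [← hiso, hv, map_zero] at h1
  simp at h1

end SphereTorus

/-! ### The hypersurface and the codimension-two set -/

section Submanifolds

variable {L : Submodule ℤ E2} [DiscreteTopology L]

theorem exists_dSphere_eq (y : SphereTorus L) {X : E3} (hX : inner ℝ (y.1 : E3) X = 0) :
    ∃ v : TangentSpace IST y, dSphere L y v = X := by
  have : Fact (finrank ℝ E3 = 2 + 1) := ⟨by simp⟩
  have h : X ∈ (ℝ ∙ (y.1 : E3))ᗮ := Submodule.mem_orthogonal_singleton_iff_inner_right.2 hX
  rw [← range_mvfderiv_subtypeVal (n := 2) y.1] at h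
  obtain ⟨v, hv⟩ := h
  exact ⟨((v, 0) : E2 × E2), (dSphere_apply L y ((v, 0) : E2 × E2)).trans hv⟩

/-- The defining function is a linear map in the sphere variable, so it is a submersion as soon as
it is onto on each tangent plane. -/
theorem isSubmanifoldOfCodim_of_linear {k : ℕ} (ℓ : E3 →L[ℝ] EuclideanSpace ℝ (Fin k))
    {N : Set (SphereTorus L)} {V : Set E3} (hV : IsOpen V) (hne : N.Nonempty)
    (hNV : ∀ y ∈ N, (y.1 : E3) ∈ V)
    (hsurj : ∀ p : S2, (p : E3) ∈ V → ∀ r, ∃ X : E3, inner ℝ (p : E3) X = 0 ∧ ℓ X = r)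
    (hN : ∀ y : SphereTorus L, (y.1 : E3) ∈ V → (y ∈ N ↔ ℓ y.1 = 0)) :
    IsSubmanifoldOfCodim IST k N := by
  have hs : ContMDiff IST 𝓘(ℝ, E3) ∞ (fun y : SphereTorus L => (y.1 : E3)) := by
    have : Fact (finrank ℝ E3 = 2 + 1) := ⟨by simp⟩
    exact contMDiff_coe_sphere.comp contMDiff_fst
  refine ⟨hne, fun x hx => ⟨(fun y : SphereTorus L => (y.1 : E3)) ⁻¹' V,
    fun y => ℓ y.1, hV.preimage hs.continuous, hNV x hx, ?_, fun y hy r => ?_, ?_⟩⟩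
  · exact (ℓ.contDiff.contMDiff.comp hs).contMDiffOn
  · obtain ⟨X, hX, hr⟩ := hsurj y.1 hy r
    obtain ⟨v, hv⟩ := exists_dSphere_eq y hX
    have hd : MDifferentiableAt IST 𝓘(ℝ, E3) (fun y : SphereTorus L => (y.1 : E3)) y :=
      hs.mdifferentiableAt (by simp)
    have h := mfderiv_comp y (g := ℓ) ℓ.mdifferentiableAt hd
    rw [ContinuousLinearMap.mfderiv_eq] at h
    have h2 := congrArg (fun A => A v) h
    exact ⟨v, h2.trans ((congrArg ℓ hv).trans hr)⟩
  · ext y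
    constructor
    · rintro ⟨h1, h2⟩
      exact ⟨h2, (hN y h2).1 h1⟩
    · rintro ⟨h1, h2⟩
      exact ⟨(hN y h1).2 h2, h1⟩

variable (L) in
theorem isSubmanifoldOfCodim_one :
    IsSubmanifoldOfCodim IST 1 ({p : S2 | p.1 0 = -p.1 2} ×ˢ (univ : Set (Torus L))) := by
  let ℓ : E3 →L[ℝ] EuclideanSpace ℝ (Fin 1) :=
    ((EuclideanSpace.proj 0 : E3 →L[ℝ] ℝ) + (EuclideanSpace.proj 2 : E3 →L[ℝ] ℝ)).smulRight
      (EuclideanSpace.single 0 1)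
  have hℓ : ∀ X : E3, ℓ X = (X 0 + X 2) • EuclideanSpace.single 0 1 := fun X => rfl
  -- `V` leaves out exactly the line spanned by (1, 0, 1), where X₀ + X₂ is critical on the sphere.
  refine isSubmanifoldOfCodim_of_linear ℓ (V := {X | 0 < (X 0 - X 2) ^ 2 + X 1 ^ 2})
    (isOpen_lt continuous_const (by fun_prop)) ⟨(⟨EuclideanSpace.single 1 1, by simp⟩, 0), ?_⟩ ?_ ?_ ?_
  · simp
  · rintro y ⟨hy, -⟩
    have hs := sum_sq_sphere y.1
    simp only [mem_ofPred_eq] at hy ⊢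
    rw [hy] at hs ⊢
    nlinarith
  · intro p hp r
    have hs := sum_sq_sphere p
    simp only [mem_ofPred_eq] at hp
    have hpos : 0 < 2 - (p.1 0 + p.1 2) ^ 2 := by nlinarith
    let b := (r 0) / (2 - (p.1 0 + p.1 2) ^ 2)
    let s := p.1 0 + p.1 2
    -- A multiple of the tangential part of (1, 0, 1); on the unmultiplied vector the functional
    -- takes the value 2 - s².
    refine ⟨!₂[b * (1 - s * p.1 0), b * (0 - s * p.1 1), b * (1 - s * p.1 2)], ?_, ?_⟩
    · simp [PiLp.inner_apply, Fin.sum_univ_three]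
      linear_combination (-b * s) * hs
    · rw [hℓ]
      ext i
      fin_cases i
      simp
      have : b * (2 - s ^ 2) = r 0 := div_mul_cancel₀ _ hpos.ne'
      linear_combination this
  · intro y _
    rw [hℓ]
    simp [eq_neg_iff_add_eq_zero]

variable (L) in
theorem isSubmanifoldOfCodim_two : IsSubmanifoldOfCodim IST 2
    ({p : S2 | p.1 = !₂[0, 1, 0] ∨ p.1 = !₂[0, -1, 0]} ×ˢ (univ : Set (Torus L))) := by
  let ℓ : E3 →L[ℝ] EuclideanSpace ℝ (Fin 2) :=
    (EuclideanSpace.proj 0 : E3 →L[ℝ] ℝ).smulRight (EuclideanSpace.single 0 1)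
      + (EuclideanSpace.proj 2 : E3 →L[ℝ] ℝ).smulRight (EuclideanSpace.single 1 1)
  have hℓ : ∀ X : E3, ℓ X = X 0 • EuclideanSpace.single 0 1 + X 2 • EuclideanSpace.single 1 1 :=
    fun X => rfl
  refine isSubmanifoldOfCodim_of_linear ℓ (V := {X | X 1 ≠ 0})
    (isOpen_ne_fun (by fun_prop) continuous_const)
    ⟨(⟨!₂[0, 1, 0], by simp [EuclideanSpace.norm_eq, Fin.sum_univ_three]⟩, 0), ?_⟩ ?_ ?_ ?_
  · simp
  · rintro y ⟨hy | hy, -⟩ <;> simp [hy]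
  · intro p hp r
    simp only [mem_ofPred_eq] at hp
    -- The outer coordinates are prescribed; the middle one is solved from orthogonality to p, which
    -- needs p₁ ≠ 0.
    refine ⟨!₂[r 0, -(r 0 * p.1 0 + r 1 * p.1 2) / p.1 1, r 1], ?_, ?_⟩
    · simp [PiLp.inner_apply, Fin.sum_univ_three]
      field_simp
      ring
    · rw [hℓ]
      ext i
      fin_cases i <;> simp
  · intro y hy
    rw [hℓ]
    have hs := sum_sq_sphere y.1
    constructor
    · rintro ⟨hy | hy, -⟩ <;> simp [hy]
    · intro h
      have h0 : y.1.1 0 = 0 := by simpa using congrArg (fun X : E2 => X 0) h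
      have h2 : y.1.1 2 = 0 := by simpa using congrArg (fun X : E2 => X 1) h
      rw [h0, h2] at hs
      have : (y.1.1 1 - 1) * (y.1.1 1 + 1) = 0 := by linear_combination hs
      refine ⟨?_, mem_univ _⟩
      rcases mul_eq_zero.1 this with h | h
      · left
        ext i
        fin_cases i <;> simp [h0, h2]
        linarith
      · right
        ext i
        fin_cases i <;> simp [h0, h2]
        linarith

end Submanifolds

/-! ### The metrics are not locally isometric -/

section NotLocallyIsometric

variable (L : Submodule ℤ E2) [DiscreteTopology L]

theorem injective_mfderiv_torusMk :
    Function.Injective (mfderiv 𝓘(ℝ, E2) 𝓘(ℝ, E2) (QuotientAddGroup.mk : E2 → Torus L) 0) := by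
  let q : Torus L := QuotientAddGroup.mk (0 : E2)
  let χ := chartAt E2 q
  have hc : Continuous (QuotientAddGroup.mk : E2 → Torus L) := (contMDiff_torusMk L).continuous
  have hopen : IsOpen ((QuotientAddGroup.mk : E2 → Torus L) ⁻¹' χ.source) :=
    χ.open_source.preimage hc
  have h0 : (0 : E2) ∈ (QuotientAddGroup.mk : E2 → Torus L) ⁻¹' χ.source := mem_chart_source E2 q
  have he := eventually_sub_eq L hopen h0 (a := fun w => χ (QuotientAddGroup.mk w)) (b := id)
    (χ.continuousOn.comp hc.continuousOn fun w hw => hw) continuousOn_id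
    (fun w hw => mk_of_mem_atlas L (chart_mem_atlas E2 q) hw)
  have hd : HasFDerivAt (χ ∘ (QuotientAddGroup.mk : E2 → Torus L)) (ContinuousLinearMap.id ℝ E2) 0 :=
    ((hasFDerivAt_id (0 : E2)).add_const _).congr_of_eventuallyEq he
  have hχ : MDifferentiableAt 𝓘(ℝ, E2) 𝓘(ℝ, E2) χ (QuotientAddGroup.mk (0 : E2)) :=
    mdifferentiableAt_atlas (chart_mem_atlas E2 q) (mem_chart_source E2 q)
  have hcomp := mfderiv_comp (0 : E2) hχ ((contMDiff_torusMk L).mdifferentiableAt (by simp))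
  rw [mfderiv_eq_fderiv, hd.fderiv] at hcomp
  intro v w hvw
  have h1 := congrArg (fun A => A v) hcomp
  have h2 := congrArg (fun A => A w) hcomp
  exact h1.trans ((congrArg (mfderiv 𝓘(ℝ, E2) 𝓘(ℝ, E2) χ _) hvw).trans h2.symm)

/-- A great circle on which the scalar curvature of the first metric is maximal. -/
def greatCircle (t : ℝ) : S2 := ⟨!₂[Real.sin t / √2, Real.cos t, -(Real.sin t / √2)], by
  have h2 : √2 ^ 2 = 2 := Real.sq_sqrt (by norm_num)
  rw [mem_sphere_zero_iff_norm, EuclideanSpace.norm_eq, Real.sqrt_eq_one, Fin.sum_univ_three]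
  simp [div_pow, h2]
  linarith [Real.sin_sq_add_cos_sq t]⟩

theorem contDiff_coe_greatCircle : ContDiff ℝ ∞ fun t => (greatCircle t : E3) := by
  unfold greatCircle
  rw [contDiff_euclidean]
  intro i
  fin_cases i <;> simp
  · exact Real.contDiff_sin.div_const _
  · exact Real.contDiff_cos
  · exact (Real.contDiff_sin.div_const _).neg

theorem contMDiff_greatCircle : ContMDiff 𝓘(ℝ, ℝ) (𝓡 2) ∞ greatCircle := by
  have : Fact (finrank ℝ E3 = 2 + 1) := ⟨by simp⟩
  exact contDiff_coe_greatCircle.contMDiff.codRestrict_sphere (n := 2) fun t => (greatCircle t).2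

theorem injective_mfderiv_greatCircle :
    Function.Injective (mfderiv 𝓘(ℝ, ℝ) (𝓡 2) greatCircle 0) := by
  have : Fact (finrank ℝ E3 = 2 + 1) := ⟨by simp⟩
  have hp : ContDiff ℝ ∞ fun t => (greatCircle t : E3) 0 :=
    (EuclideanSpace.proj (𝕜 := ℝ) (0 : Fin 3)).contDiff.comp contDiff_coe_greatCircle
  have hd : HasDerivAt (fun t => (greatCircle t : E3) 0) (1 / √2) 0 := by
    simpa [greatCircle] using (Real.hasDerivAt_sin 0).div_const √2
  let h : S2 → ℝ := fun p => (p : E3) 0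
  have hh : ContMDiff (𝓡 2) 𝓘(ℝ, ℝ) ∞ h :=
    (EuclideanSpace.proj (𝕜 := ℝ) (0 : Fin 3)).contDiff.contMDiff.comp contMDiff_coe_sphere
  have hcomp := mfderiv_comp (0 : ℝ) (g := h) (hh.mdifferentiableAt (by simp))
    (contMDiff_greatCircle.mdifferentiableAt (by simp))
  have hd' : HasFDerivAt (h ∘ greatCircle) (ContinuousLinearMap.toSpanSingleton ℝ (1 / √2)) 0 :=
    hd.hasFDerivAt
  rw [mfderiv_eq_fderiv, hd'.fderiv] at hcomp
  rw [injective_iff_map_eq_zero]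
  intro (v : ℝ) hv
  have h1 := congrArg (fun A => A v) hcomp
  have h2 := h1.trans ((congrArg (mfderiv (𝓡 2) 𝓘(ℝ, ℝ) h _) hv).trans (map_zero _))
  have h3 : v * (1 / √2) = 0 := h2
  exact (mul_eq_zero.1 h3).resolve_right (by positivity)

/-- Dimension count: the image of great circle × torus has locally constant sphere component, so an
injective differential would embed a three-dimensional space into ℝ². -/
theorem not_locallyIsometric : ¬ LocallyIsometric (metric L c₁) (metric L c₂) := by
  intro hloc
  let σ : ℝ × E2 → SphereTorus L := Prod.map greatCircle QuotientAddGroup.mk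
  obtain ⟨e, hx, he, -, hiso⟩ := hloc (σ 0)
  let J := 𝓘(ℝ, ℝ).prod 𝓘(ℝ, E2)
  have hσ : ContMDiff J IST ∞ σ := contMDiff_greatCircle.prodMap (contMDiff_torusMk L)
  have hcont : ContinuousAt (fun s => (e (σ s)).1) 0 :=
    continuous_fst.continuousAt.comp ((e.continuousAt hx).comp hσ.continuous.continuousAt)
  let S : Set S2 := {p : S2 | p.1 = !₂[0, 1, 0] ∨ p.1 = !₂[0, -1, 0]}
  have hS : S.Finite := by
    refine Set.Finite.subset (s := Subtype.val ⁻¹' {!₂[0, 1, 0], !₂[0, -1, 0]})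
      ((Set.toFinite _).preimage Subtype.val_injective.injOn) fun p hp => hp
  have hmem : ∀ᶠ s in 𝓝 (0 : ℝ × E2), (e (σ s)).1 ∈ S := by
    filter_upwards [hσ.continuous.continuousAt.eventually (e.open_source.mem_nhds hx)] with s hs
    refine (scalarCurvature_c₂_eq_two_iff L (e (σ s))).1 ?_
    rw [← scalarCurvature_eq_of_isometry he hiso hs, scalarCurvature_c₁_eq_two_iff]
    left
    simp [σ, greatCircle]
  -- A continuous map with values near 0 in a finite set is constant near 0.
  have hconst : (fun s => (e (σ s)).1) =ᶠ[𝓝 0] fun _ => (e (σ 0)).1 := by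
    have hfin : (S \ {(e (σ 0)).1}).Finite := hS.sdiff
    filter_upwards [hmem, hcont.eventually (hfin.isClosed.isOpen_compl.mem_nhds
      (show (e (σ 0)).1 ∈ (S \ {(e (σ 0)).1})ᶜ by simp))] with s h1 h2
    by_contra h3
    exact h2 ⟨h1, h3⟩
  have dσ : MDifferentiableAt J IST σ 0 := hσ.mdifferentiableAt (by simp)
  have de : MDifferentiableAt IST IST e (σ 0) :=
    (he.contMDiffAt (e.open_source.mem_nhds hx)).mdifferentiableAt (by simp)
  have hσ' : Function.Injective (mfderiv J IST σ 0) := by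
    have h := mfderiv_prodMap (p := (0 : ℝ × E2))
      (contMDiff_greatCircle.mdifferentiableAt (x := 0) (by simp))
      ((contMDiff_torusMk L).mdifferentiableAt (x := 0) (by simp))
    rw [show mfderiv J IST σ 0 = _ from h]
    exact Function.Injective.prodMap injective_mfderiv_greatCircle (injective_mfderiv_torusMk L)
  have hinj : Function.Injective (mfderiv J IST (e ∘ σ) 0) := by
    rw [mfderiv_comp (0 : ℝ × E2) de dσ]
    exact (injective_mfderiv_of_isometry (hiso (σ 0) hx)).comp hσ'
  have hfst : ∀ v, (mfderiv J IST (e ∘ σ) 0 v : E2 × E2).1 = 0 := by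
    intro v
    have h1 := mfderiv_comp (0 : ℝ × E2) (g := (Prod.fst : SphereTorus L → S2))
      (I' := IST) (I'' := 𝓡 2) mdifferentiableAt_fst (de.comp (0 : ℝ × E2) dσ)
    rw [mfderiv_fst] at h1
    have h2 : mfderiv J (𝓡 2) (fun s => (e (σ s)).1) 0 = mfderiv J (𝓡 2) (fun _ => (e (σ 0)).1) 0 :=
      hconst.mfderiv_eq
    rw [mfderiv_const] at h2
    exact (congrArg (fun A => A v) h1).symm.trans (congrArg (fun A => A v) h2)
  let T : ℝ × E2 →L[ℝ] E2 × E2 := mfderiv J IST (e ∘ σ) 0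
  have hT : Function.Injective ((LinearMap.snd ℝ E2 E2) ∘ₗ T.toLinearMap) := by
    intro v w hvw
    exact hinj (Prod.ext ((hfst v).trans (hfst w).symm) hvw)
  have := LinearMap.finrank_le_finrank_of_injective hT
  simp at this

end NotLocallyIsometric

end SphereTorusMetrics

end

open SphereTorusMetrics in
theorem proposition2p10 (L : Submodule ℤ (EuclideanSpace ℝ (Fin 2)))
    [DiscreteTopology L] [IsZLattice ℝ L] :
    -- the two metrics are isospectral
    Isospectral (metric L c₁) (metric L c₂) ∧
    -- the maximal scalar curvature equals 2 for both metrics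
    IsGreatest (Set.range (scalarCurvature (metric L c₁))) 2 ∧
    IsGreatest (Set.range (scalarCurvature (metric L c₂))) 2 ∧
    -- the set where the first metric attains it, and a hypersurface contained in this set
    scalarCurvature (metric L c₁) ⁻¹' {2} =
      ({p : S2 | p.1 0 = -p.1 2} ∪
        {p : S2 | p.1 = !₂[1 / √2, 0, 1 / √2] ∨ p.1 = !₂[-1 / √2, 0, -1 / √2]}) ×ˢ Set.univ ∧
    (∃ N ⊆ scalarCurvature (metric L c₁) ⁻¹' {2}, IsSubmanifoldOfCodim IST 1 N) ∧
    -- the set where the second metric attains it, which has codimension two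
    scalarCurvature (metric L c₂) ⁻¹' {2} =
      {p : S2 | p.1 = !₂[0, 1, 0] ∨ p.1 = !₂[0, -1, 0]} ×ˢ Set.univ ∧
    IsSubmanifoldOfCodim IST 2 (scalarCurvature (metric L c₂) ⁻¹' {2}) ∧
    -- the two manifolds are not locally isometric
    ¬ LocallyIsometric (metric L c₁) (metric L c₂) := by
  -- The point `greatCircle 0` is (0, 1, 0), where both scalar curvatures attain 2.
  refine ⟨isospectral_of_rotations c₁_isSymm c₂_isSymm exists_intertwining_rotation,
    ⟨⟨(greatCircle 0, 0), ?_⟩, ?_⟩, ⟨⟨(greatCircle 0, 0), ?_⟩, ?_⟩, ?_,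
    ⟨{p : S2 | p.1 0 = -p.1 2} ×ˢ Set.univ, ?_, isSubmanifoldOfCodim_one L⟩, ?_, ?_,
    not_locallyIsometric L⟩
  · rw [scalarCurvature_c₁]
    simp [greatCircle]
  · rintro _ ⟨x, rfl⟩
    rw [scalarCurvature_c₁]
    have := sq_nonneg (x.1.1 2 ^ 2 - x.1.1 0 ^ 2)
    have := sq_nonneg (2 * x.1.1 1 * (x.1.1 0 + x.1.1 2))
    linarith
  · rw [scalarCurvature_c₂]
    simp [greatCircle]
  · rintro _ ⟨x, rfl⟩
    rw [scalarCurvature_c₂]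
    have := sq_nonneg (x.1.1 2 ^ 2 - x.1.1 0 ^ 2)
    have := sq_nonneg (x.1.1 0 * x.1.1 2)
    linarith
  · ext x
    exact (scalarCurvature_c₁_eq_two_iff L x).trans (and_iff_left (Set.mem_univ _)).symm
  · intro x hx
    exact (scalarCurvature_c₁_eq_two_iff L x).2 (.inl hx.1)
  · ext x
    exact (scalarCurvature_c₂_eq_two_iff L x).trans (and_iff_left (Set.mem_univ _)).symm
  · have h : scalarCurvature (metric L c₂) ⁻¹' {2}
        = {p : S2 | p.1 = !₂[0, 1, 0] ∨ p.1 = !₂[0, -1, 0]} ×ˢ Set.univ := by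
      ext x
      exact (scalarCurvature_c₂_eq_two_iff L x).trans (and_iff_left (Set.mem_univ _)).symm
    rw [h]
    exact isSubmanifoldOfCodim_two L
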